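/- **Patterns.** A linear XY-fusion pattern has a register of qubits $1,\dots,n$ with subsets $I$, $O$ of inputs and outputs, and is a finite sequence of the following commands: preparations $N_i$ ($i\notin I$) of $|+\rangle$; $CZ$-gates $E_{ij}$ with $|i-j|=1$; $X$- or $Y$-fusions $F_{ij}$ ($i\neq j$), whose success branch with outcome $\kappa\in\{0,1\}$ acts as follows: link a fresh node in state $|+\rangle$ to $i$ and $j$ by $CZ$ and project this node onto the outcome-$\kappa$ state of the Pauli $X$ (respectively $Y$) basis, and then apply $S^c$, $S=\mathrm{diag}(1,i)$, to both qubits ($c\in\{0,1\}$ is a Clifford parameter of the fusion); destructive single-qubit measurements ($i\notin O$) in the plane XY, XZ or YZ with any angle, or in a Pauli basis; and corrections $X_i^t$, $Z_i^t$, where $t$ is an $\mathbb F_2$-linear combination of measurement and fusion outcomes. It is runnable if no command acts on a qubit already measured or not yet prepared, no correction depends on an outcome not yet obtained, every non-input qubit is prepared exactly once and exactly the non-output qubits are measured. For a list $m$ of outcomes of all measurements and fusions let $B_m$ be the linear map from the input qubits to the output qubits of the success branch $m$ (all fusions successful). **Protocol.** A single atom, initially in $|+\rangle$, emits one dual-rail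 photon per time step ($|b\rangle\mapsto|b\rangle|b\rangle$), and a unitary $u_t$ is then applied to the atom, which is discarded at the end. A delay module permutes the photons ($\sigma$), and in each later time slot a router ($\rho$) sends photons (i) to a repeat-until-success (RUS) fusion module, (ii) to a Pauli correction module followed by a single-qubit measurement with chosen label $\lambda$ and angle $\alpha$, or (iii) to a Pauli correction module followed by an output line. The corrections are functions of the classical record of earlier slots. A RUS fusion takes $k$ pairs of photons. In each round, a pair enters the linear optical fusion circuit, consisting of the phase $c\pi/2$ and a beam splitter on each photon, a Type I fusion, and a measurement of the remaining mode pair in the $X$ or $Y$ basis, with number-resolving detectors; success is heralded by exactly one photon in the two Type I detectors. After a success, the photons of the remaining rounds undergo the same phase and beam splitter and are measured separately. All components are ideal. Since the emitter creates all qubits, an input qubit is created as one half of a maximally entangled pair whose other half (the open input leg) leaves through an output line of its own. **Proposition.** Let $P$ be any runnable linear XY-fusion pattern with $f$ fusions. For every odd $k\ge 1$ the protocol has settings with exactly $f$ RUS fusions of $k$ rounds each ($k$ photons for each of the two nodes of a fusion) such that 1. all $f$ fusions succeed with probability exactly $(1-2^{-k})^f$, and 2. conditioned on this, the protocol implements $P$: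 the outcomes $m$ of the pattern can be read off the classical record, and for each $m$ the unnormalised state on the output lines, divided by the success probability, is the normalised Choi state of the map $\psi\mapsto B_m\psi B_m^\dagger$ (if $I=\emptyset$, it is the state $B_mB_m^\dagger$). Moreover, for every $\varepsilon>0$ there is an odd $k$ with $(1-2^{-k})^f>1-\varepsilon$. Hence the settings implement the pattern with success probability arbitrarily close to $1$. -/

import Mathlib

open scoped BigOperators ComplexConjugate

noncomputable section

namespace FBQC

/-! ### Qubit states and effects -/

/-- Amplitude vectors of a family of qubits indexed by `ι`, in the computational basis. -/
abbrev Vec (ι : Type) : Type := (ι → Bool) → ℂ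

/-- The scalar `1 / √2`. -/
def rsqrt2 : ℂ := ((1 / Real.sqrt 2 : ℝ) : ℂ)

/-- `(-1)^k`. -/
def sgn (k : Bool) : ℂ := if k then -1 else 1

/-- `|0⟩` and `|1⟩`. -/
def ketZ (k : Bool) : Bool → ℂ := fun b => if b = k then 1 else 0

/-- `|+⟩` and `|-⟩`. -/
def ketX (k : Bool) : Bool → ℂ := fun b => rsqrt2 * (ketZ false b + sgn k * ketZ true b)

/-- `|i⟩` and `|-i⟩`. -/
def ketY (k : Bool) : Bool → ℂ := fun b =>
  rsqrt2 * (ketZ false b + sgn k * Complex.I * ketZ true b)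

/-- Measurement labels: the three planes of the Bloch sphere and the three Pauli bases. -/
inductive Label where
  | XY | XZ | YZ | X | Y | Z

/-- The state `|±_{lam,α}⟩`, with sign `+` for `k = false` and `-` for `k = true`.
The angle is not used for the three Pauli labels. -/
def Label.ket : Label → ℝ → Bool → Bool → ℂ
  | .XY, α, k => fun b =>
      rsqrt2 * (ketZ false b + sgn k * Complex.exp (α * Complex.I) * ketZ true b)
  | .YZ, α, k => fun b =>
      rsqrt2 * (ketX false b + sgn k * Complex.exp (α * Complex.I) * ketX true b)
  | .XZ, α, k => fun b =>
      rsqrt2 * (ketY false b + sgn k * Complex.exp (α * Complex.I) * ketY true b)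
  | .X, _, k => ketX k
  | .Y, _, k => ketY k
  | .Z, _, k => ketZ k

/-- Matrix entry of the Pauli operator `X^x Z^z`. -/
def pauli (x z : Bool) : Matrix Bool Bool ℂ := fun b c =>
  if b = xor c x then (if z && c then -1 else 1) else 0

/-- Diagonal entries of the controlled-`Z` gate. -/
def cz (a b : Bool) : ℂ := if a && b then -1 else 1

/-- Apply a one-qubit operator to qubit `i`. -/
def apply1 {ι : Type} [DecidableEq ι] (A : Matrix Bool Bool ℂ) (i : ι) (ψ : Vec ι) : Vec ι :=
  fun x => ∑ b : Bool, A (x i) b * ψ (Function.update x i b)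

/-- Apply a diagonal two-qubit operator to qubits `i` and `j`. -/
def applyDiag2 {ι : Type} (d : Bool → Bool → ℂ) (i j : ι) (ψ : Vec ι) : Vec ι :=
  fun x => d (x i) (x j) * ψ x

/-! ### XY-fusion patterns -/

/-- The two types of fusion: `X`-fusion and `Y`-fusion. -/
inductive FusionType where
  | X | Y

/-- The measurement basis of the fusion node. -/
def FusionType.label : FusionType → Label
  | .X => .X
  | .Y => .Y

/-- The (diagonal) Kraus operator of a successful non-destructive fusion with outcome `k`: a node
in the state `|+⟩` is linked by `CZ` to both qubits and measured in the `X` or `Y` basis with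
outcome `k`. If the Clifford parameter `c` is `1`, both qubits also undergo the phase gate
`S = diag(1, i)`; a `Y`-fusion with `c = 1` is then a `CZ` gate up to Pauli operators. -/
def fusionKraus (τ : FusionType) (c k : Bool) (a b : Bool) : ℂ :=
  (∑ v : Bool, conj (τ.label.ket 0 k v) * cz v a * cz v b * ketX false v) *
    ((if c && a then Complex.I else 1) * (if c && b then Complex.I else 1))

/-- A formal `𝔽₂`-linear combination of outcomes of measurements and fusions. -/
structure Signal (n f : ℕ) (O : Finset (Fin n)) where
  meas : Finset {i : Fin n // i ∉ O}
  fus : Finset (Fin f)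

/-- The classical outcomes of a pattern: one bit for each measured qubit, one for each fusion. -/
abbrev Outcomes (n f : ℕ) (O : Finset (Fin n)) : Type :=
  ({i : Fin n // i ∉ O} → Bool) × (Fin f → Bool)

/-- The value in `{0,1}` of a linear combination of outcomes. -/
def Signal.val {n f : ℕ} {O : Finset (Fin n)} (t : Signal n f O) (m : Outcomes n f O) : Bool :=
  decide (Odd ((t.meas.filter fun i => m.1 i = true).card +
    (t.fus.filter fun a => m.2 a = true).card))

/-- Commands of an XY-fusion pattern on the register `Fin n` with inputs `I` and outputs `O`.
The `f` fusions of the pattern are named by `Fin f`, a measurement by the measured qubit. -/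
inductive Command (n f : ℕ) (I O : Finset (Fin n)) where
  | prep (i : {i : Fin n // i ∉ I})
  | entangle (i j : Fin n)
  | fuse (name : Fin f) (τ : FusionType) (c : Bool) (i j : Fin n)
  | measure (i : {i : Fin n // i ∉ O}) (lam : Label) (α : ℝ)
  | corrX (i : Fin n) (t : Signal n f O)
  | corrZ (i : Fin n) (t : Signal n f O)

/-- An XY-fusion pattern is a sequence of commands, listed in the order of execution. -/
abbrev Pattern (n f : ℕ) (I O : Finset (Fin n)) : Type := List (Command n f I O)

section Pattern

variable {n f : ℕ} {I O : Finset (Fin n)}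

/-- After the commands `pre`, qubit `i` has been prepared (or is an input). -/
def Prepared (pre : Pattern n f I O) (i : Fin n) : Prop :=
  i ∈ I ∨ ∃ h : i ∉ I, Command.prep ⟨i, h⟩ ∈ pre

/-- Qubit `i` is measured by one of the commands `pre`. -/
def Measured (pre : Pattern n f I O) (i : Fin n) : Prop :=
  ∃ (h : i ∉ O) (lam : Label) (α : ℝ), Command.measure ⟨i, h⟩ lam α ∈ pre

/-- The fusion named `a` is among the commands `pre`. -/
def Fused (pre : Pattern n f I O) (a : Fin f) : Prop :=
  ∃ (τ : FusionType) (c : Bool) (i j : Fin n), Command.fuse a τ c i j ∈ pre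

/-- Qubit `i` has been prepared and not yet been measured. -/
def Live (pre : Pattern n f I O) (i : Fin n) : Prop := Prepared pre i ∧ ¬ Measured pre i

/-- All outcomes that occur in `t` have been obtained. -/
def Signal.Known (pre : Pattern n f I O) (t : Signal n f O) : Prop :=
  (∀ i ∈ t.meas, Measured pre i.1) ∧ ∀ a ∈ t.fus, Fused pre a

/-- The command may be executed after the commands `pre`. -/
def Command.Allowed (pre : Pattern n f I O) : Command n f I O → Prop
  | .prep i => ¬ Prepared pre i.1
  | .entangle i j => i ≠ j ∧ Live pre i ∧ Live pre j
  | .fuse a _ _ i j => i ≠ j ∧ Live pre i ∧ Live pre j ∧ ¬ Fused pre a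
  | .measure i _ _ => Live pre i.1
  | .corrX i t => Live pre i ∧ t.Known pre
  | .corrZ i t => Live pre i ∧ t.Known pre

/-- No command acts on a qubit already measured or not yet prepared, no correction depends on an
outcome not yet obtained, and in the end all register qubits have been prepared, precisely the
non-output qubits have been measured and every fusion has been done. -/
def Pattern.Runnable (P : Pattern n f I O) : Prop :=
  (∀ (pre post : Pattern n f I O) (c : Command n f I O), P = pre ++ c :: post → c.Allowed pre) ∧
  (∀ i, Prepared P i) ∧ (∀ i, i ∉ O → Measured P i) ∧ ∀ a, Fused P a

/-- Entangling commands only join neighbours of the ordered register. -/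
def Pattern.Linear (P : Pattern n f I O) : Prop :=
  ∀ i j : Fin n, Command.entangle i j ∈ P → i.val + 1 = j.val ∨ j.val + 1 = i.val

/-- Kraus operator of a command for given outcomes (all fusions being successful), on the space of
the whole register; a register qubit that is not yet prepared or already measured is kept in the
state `|0⟩`. -/
def Command.op (m : Outcomes n f O) : Command n f I O → Vec (Fin n) → Vec (Fin n)
  | .prep i => apply1 (fun b c => ketX false b * conj (ketZ false c)) i.1
  | .entangle i j => applyDiag2 cz i j
  | .fuse a τ c i j => applyDiag2 (fusionKraus τ c (m.2 a)) i j
  | .measure i lam α => apply1 (fun b c => ketZ false b * conj (lam.ket α (m.1 i) c)) i.1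
  | .corrX i t => apply1 (pauli (t.val m) false) i
  | .corrZ i t => apply1 (pauli false (t.val m)) i

/-- Extend a bit string on `A` by zeros. -/
def extend (A : Finset (Fin n)) (x : {i // i ∈ A} → Bool) : Fin n → Bool :=
  fun i => if h : i ∈ A then x ⟨i, h⟩ else false

/-- The success branch of the pattern for the outcomes `m`: the matrix of the Kraus operator from
the input qubits to the output qubits. -/
def Pattern.branch (P : Pattern n f I O) (m : Outcomes n f O) :
    Matrix ({i // i ∈ O} → Bool) ({i // i ∈ I} → Bool) ℂ := fun y x =>
  P.foldl (fun ψ c => c.op m ψ) (fun z => if z = extend I x then 1 else 0) (extend O y)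

end Pattern

/-! ### Linear optical fusion of two dual-rail photons

Modes `0, 1` are the two rails of photon `A`, modes `2, 3` are those of photon `B`. -/

/-- Phase shift `θ` on mode `m`. -/
def phaseShift (m : Fin 4) (θ : ℝ) : Matrix (Fin 4) (Fin 4) ℂ :=
  Matrix.diagonal fun p => if p = m then Complex.exp (θ * Complex.I) else 1

/-- Beam splitter (Hadamard matrix) on the modes `m` and `p`. -/
def beamSplitter (m p : Fin 4) : Matrix (Fin 4) (Fin 4) ℂ := fun i j =>
  if i = m ∧ j = m then rsqrt2 else if i = m ∧ j = p then rsqrt2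
  else if i = p ∧ j = m then rsqrt2 else if i = p ∧ j = p then -rsqrt2
  else if i = j then 1 else 0

/-- The rotation in front of the fusion, on both photons: phase `c π / 2`, then beam splitter. -/
def preRotation (c : Bool) : Matrix (Fin 4) (Fin 4) ℂ :=
  let θ : ℝ := if c then Real.pi / 2 else 0
  beamSplitter 0 1 * beamSplitter 2 3 * phaseShift 1 θ * phaseShift 3 θ

/-- The destructive fusion circuit. After the rotations the rails `1` and `3` are exchanged (Type I
fusion): the rails `2, 1` enter a beam splitter and are detected (this heralds success), the rails
`0, 3` are the remaining qubit, which is measured in the `X` basis or (phase `-π/2`) in the `Y`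
basis. -/
def fusionCircuit (τ : FusionType) (c : Bool) : Matrix (Fin 4) (Fin 4) ℂ :=
  let φ : ℝ := match τ with
    | .X => 0
    | .Y => -(Real.pi / 2)
  beamSplitter 0 3 * phaseShift 3 φ * beamSplitter 2 1 * preRotation c

/-- An outcome of number-resolving detection of two photons in four modes: the unordered pair of
the modes in which they are found. -/
abbrev Detection : Type := Sym2 (Fin 4)

/-- Number of photons detected in mode `m`. -/
def Detection.count (o : Detection) (m : Fin 4) : ℕ := (Sym2.toMultiset o).count m

/-- Amplitude of the detection outcome `o` if one photon enters mode `p`, another one enters mode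
`q ≠ p`, and the modes undergo the unitary `U`: a permanent divided by `√(∏ rᵢ!)`, where `rᵢ` are
the detected photon numbers. -/
def detectionAmplitude (U : Matrix (Fin 4) (Fin 4) ℂ) (p q : Fin 4) (o : Detection) : ℂ :=
  Sym2.lift ⟨fun m l => (U m p * U l q + U l p * U m q) /
      ((Real.sqrt (if m = l then 2 else 1) : ℝ) : ℂ), fun m l => by
        simp only [eq_comm (a := m) (b := l), add_comm (U m p * U l q)]⟩ o

/-- The fusion attempt succeeds if precisely one photon is found in the heralding modes. -/
def Heralds (o : Detection) : Prop := Detection.count o 2 + Detection.count o 1 = 1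

/-- Rails of photon `A` and of photon `B` for the basis states of the dual-rail qubits. -/
def railA (a : Bool) : Fin 4 := if a then 1 else 0

/-- See `railA`. -/
def railB (b : Bool) : Fin 4 := if b then 3 else 2

open Classical in
/-- Effect of `k` rounds of repeat-until-success fusion with detection record `o`: each round takes
a fresh pair of photons, which is sent to the fusion circuit as long as no success has been
heralded; after a success, the two photons of a round are measured separately (rotation, then
detection). Photon `A` of round `t` is `x (t, false)`, photon `B` is `x (t, true)`. -/
def rusEffect {k : ℕ} (τ : FusionType) (c : Bool) (o : Fin k → Detection)
    (x : Fin k × Bool → Bool) : ℂ :=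
  ∏ t : Fin k, detectionAmplitude
    (if ∃ s : Fin k, s < t ∧ Heralds (o s) then preRotation c else fusionCircuit τ c)
    (railA (x (t, false))) (railB (x (t, true))) (o t)

/-! ### The single-emitter protocol -/

/-- State of the first `N` emitted photons and of the atom. The atom starts in `|+⟩`; in time step
`t` it emits a photon, `|b⟩ ↦ |b⟩|b⟩`, and then undergoes the unitary `u t`. -/
def emitterState (u : ℕ → Matrix.unitaryGroup Bool ℂ) : (N : ℕ) → (Fin N → Bool) → Bool → ℂ
  | 0, _, a => ketX false a
  | N + 1, x, a => ∑ b : Bool, (u N : Matrix Bool Bool ℂ) a b *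
      (if x (Fin.last N) = b then emitterState u N (Fin.init x) b else 0)

/-- What the router connects in a time slot: the repeat-until-success fusion module, the correction
and measurement modules, or the correction module and the output line `l`. -/
inductive Route (L : Type) where
  | rus (τ : FusionType) (c : Bool)
  | detect (lam : Label) (α : ℝ)
  | out (l : L)

/-- The photons consumed in a time slot: `k` pairs for fusion, otherwise one photon. -/
def Route.Port {L : Type} (k : ℕ) : Route L → Type
  | .rus _ _ => Fin k × Bool
  | .detect _ _ => Unit
  | .out _ => Unit

/-- The classical data produced in a time slot. -/
def Route.Record {L : Type} (k : ℕ) : Route L → Type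
  | .rus _ _ => Fin k → Detection
  | .detect _ _ => Bool
  | .out _ => Unit

instance {L : Type} (k : ℕ) : (ρ : Route L) → Fintype (ρ.Record k)
  | .rus _ _ => inferInstanceAs (Fintype (Fin k → Detection))
  | .detect _ _ => inferInstanceAs (Fintype Bool)
  | .out _ => inferInstanceAs (Fintype Unit)

/-- The slot is a fusion slot. -/
def Route.IsFusion {L : Type} : Route L → Prop
  | .rus _ _ => True
  | _ => False

/-- The repeat-until-success module of the slot (if any) has heralded a success. -/
def Route.Succeeds {L : Type} {k : ℕ} : (ρ : Route L) → ρ.Record k → Prop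
  | .rus _ _, o => ∃ t : Fin k, Heralds ((show Fin k → Detection from o) t)
  | .detect _ _, _ => True
  | .out _, _ => True

/-- Amplitude of the record `o`, and of the bits `y` on the output lines, for the basis state `q` of
the consumed photons, if the correction module is set to `X^x Z^z`. -/
def Route.effect {L : Type} {k : ℕ} (x z : Bool) :
    (ρ : Route L) → ρ.Record k → (ρ.Port k → Bool) → (L → Bool) → ℂ
  | .rus τ c, o, q, _ => rusEffect τ c o q
  | .detect lam α, o, q, _ => ∑ b : Bool, conj (lam.ket α o b) * pauli x z b (q ())
  | .out l, _, q, y => pauli x z (y l) (q ())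

/-- Settings of the single-emitter protocol with output lines `L` and `k` rounds for each
repeat-until-success fusion. -/
structure Protocol (k : ℕ) (L : Type) where
  /-- Number of emitted photons. -/
  photons : ℕ
  /-- Unitaries on the atom. -/
  u : ℕ → Matrix.unitaryGroup Bool ℂ
  /-- Number of time slots after the delay module. -/
  slots : ℕ
  /-- Router setting, with type or measurement basis, for each slot. -/
  ρ : Fin slots → Route L
  /-- Delay module: every emitted photon is assigned to a place in a slot. -/
  σ : Fin photons ≃ Σ r : Fin slots, (ρ r).Port k
  /-- Every output line receives precisely one photon. -/
  out_unique : ∀ l : L, ∃! r : Fin slots, ρ r = Route.out l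
  /-- Classical feedforward: `X`-correction as a function of the records of earlier slots. -/
  corrX : (r : Fin slots) → ((s : Fin slots) → s < r → (ρ s).Record k) → Bool
  /-- Classical feedforward: `Z`-correction as a function of the records of earlier slots. -/
  corrZ : (r : Fin slots) → ((s : Fin slots) → s < r → (ρ s).Record k) → Bool

namespace Protocol

variable {k : ℕ} {L : Type} (S : Protocol k L)

/-- Complete classical record of a run. -/
abbrev Record : Type := (r : Fin S.slots) → (S.ρ r).Record k

/-- Unnormalised joint state of the output lines and the atom after a run with record `ω`. -/
def amplitude (ω : S.Record) (y : L → Bool) (a : Bool) : ℂ :=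
  ∑ x : Fin S.photons → Bool,
    (∏ r : Fin S.slots, (S.ρ r).effect (S.corrX r fun s _ => ω s) (S.corrZ r fun s _ => ω s)
      (ω r) (fun p => x (S.σ.symm ⟨r, p⟩)) y) * emitterState S.u S.photons x a

open Classical in
/-- Unnormalised density matrix of the output lines in the event `E`; the atom is discarded. -/
def outputState (E : S.Record → Prop) : Matrix (L → Bool) (L → Bool) ℂ := fun y y' =>
  ∑ ω : S.Record, if E ω then ∑ a : Bool, S.amplitude ω y a * conj (S.amplitude ω y' a) else 0

/-- Every repeat-until-success fusion has heralded a success. -/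
def Success (ω : S.Record) : Prop := ∀ r, (S.ρ r).Succeeds (ω r)

/-- Probability that all fusions succeed. -/
def successProb [Fintype L] [DecidableEq L] : ℝ := (Matrix.trace (S.outputState S.Success)).re

/-- Number of repeat-until-success fusions. -/
def fusions : ℕ := Nat.card {r : Fin S.slots // (S.ρ r).IsFusion}

end Protocol

/-- The output lines for a pattern: one for each output qubit and one for each input qubit. The
emitter creates all qubits itself, so an input qubit is created as one half of a maximally
entangled pair, the other half of which (the open input leg) leaves the protocol. -/
abbrev Legs {n : ℕ} (I O : Finset (Fin n)) : Type := {i // i ∈ I} ⊕ {i // i ∈ O}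

/-- Conditioned on success of all fusions, the protocol realises the quantum instrument of the
pattern's success branches: the outcomes `m` of the pattern can be read off the record, and for
each `m` the (unnormalised) state of the output lines, divided by the success probability, is the
normalised Choi state of `ψ ↦ B_m ψ B_m†`, where `B_m` is the branch of the pattern. If there are
no inputs, this is the output state `B_m B_m†` itself. -/
def Protocol.Implements {k n f : ℕ} {I O : Finset (Fin n)} (S : Protocol k (Legs I O))
    (P : Pattern n f I O) : Prop :=
  ∃ read : S.Record → Outcomes n f O, ∀ (m : Outcomes n f O) (y y' : Legs I O → Bool),
    S.outputState (fun ω => S.Success ω ∧ read ω = m) y y' =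
      (S.successProb : ℂ) * ((1 / 2 ^ I.card : ℂ) *
        (P.branch m (fun i => y (Sum.inr i)) (fun i => y (Sum.inl i)) *
          conj (P.branch m (fun i => y' (Sum.inr i)) (fun i => y' (Sum.inl i)))))

end FBQC

end

/-!
The photons that one qubit of the pattern needs, namely `k` for each of its fusions, one for its
measurement or its output line, and one for its open input leg, are emitted in succession. As the
atom is left alone meanwhile, they all carry the same bit, so this group of photons is a redundantly
encoded qubit. After each group the atom undergoes a Hadamard gate and emits one more photon, the
separator. If the qubit and its successor are to be joined by an odd number of `CZ` gates, the
separator is measured in the `X` basis, and the next group is then linked to the previous one by a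
`CZ` gate; otherwise a second Hadamard gate and a measurement in the `Z` basis disconnect the two
groups (`sum_separator`). Up to known powers of `Z` this creates the linear cluster state of the
pattern, since a linear pattern entangles neighbours only (`exists_emitter`,
`entangleProd_eq_prod_joins`).

Every round of a repeat-until-success fusion applies `S^c` and a known power of `Z` to each qubit,
and the successful one in addition applies the Kraus operator of the fusion for `c = 0`. All `k`
rounds together apply `S^(ck)`, which is `S^c` up to a power of `Z` because `k` is odd. An attempt
succeeds with probability `1/2` for every input, and its two logical outcomes have the same weight
(`rusEffect_eq`).

Fusions and measurements of different qubits commute, so only the order of the corrections matters.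
They are pushed to the measurements and the output lines, where the correction modules are: the
powers of `X` and `Z` pass the entangling gates and fusions as a Pauli frame, and an `X` before a
fusion flips its outcome (`pathWeight_eq_postponed`). Because corrections depend on earlier outcomes
only, the outcomes of the pattern can be recovered from those that are found, and the frame of a
qubit is known when the qubit is measured (`Pattern.Runnable.rawOutcomes_bijective`,
`Pattern.Runnable.frame_congr`).

Hence the amplitude of each successful record is a branch of the pattern times a scalar
(`Layout.exists_amplitude_factor`). The squared moduli of these scalars, summed over the records
that belong to one branch, factorise over the slots, and their sum is `(1 - 2^(-k))^f / 2^|I|` for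
every branch (`Layout.sum_record_weight`). The branches form an instrument
(`Pattern.Runnable.sum_norm_sq_branch`), so the total probability of success is `(1 - 2^(-k))^f`
(`successProb_eq`).
-/

open scoped BigOperators ComplexConjugate

noncomputable section

namespace FBQC

/-! ### Fusion of two dual-rail photons -/

@[simp] theorem sgn_false : sgn false = 1 := by simp [sgn]

@[simp] theorem sgn_true : sgn true = -1 := by simp [sgn]

/-- The phase `i^(c a)` that the gate `S^c` gives to the basis state `a`. -/
def phaseS (c a : Bool) : ℂ := if c && a then Complex.I else 1

theorem fusionKraus_eq (τ : FusionType) (c κ a b : Bool) :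
    fusionKraus τ c κ a b = fusionKraus τ false κ a b * (phaseS c a * phaseS c b) := by
  simp [fusionKraus, phaseS]

theorem rsqrt2_mul_self : rsqrt2 * rsqrt2 = 1 / 2 := by
  unfold rsqrt2
  rw [← Complex.ofReal_mul]
  have : (1 / Real.sqrt 2) * (1 / Real.sqrt 2) = 1 / 2 := by
    rw [div_mul_div_comm, Real.mul_self_sqrt (by norm_num)]; norm_num
  rw [this]; norm_num

theorem conj_rsqrt2 : conj rsqrt2 = rsqrt2 := by
  unfold rsqrt2; exact Complex.conj_ofReal _

/-- The relative phase between the two terms of a successful fusion. -/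
def fusionPhase : FusionType → ℂ
  | .X => 1
  | .Y => -Complex.I

theorem fusionKraus_false (τ : FusionType) (κ a b : Bool) :
    fusionKraus τ false κ a b = 1 / 2 * (1 + sgn κ * fusionPhase τ * (sgn a * sgn b)) := by
  have h := rsqrt2_mul_self
  cases τ <;> cases κ <;> cases a <;> cases b <;>
    simp [fusionKraus, fusionPhase, FusionType.label, Label.ket, ketX, ketY, ketZ, cz, sgn,
      conj_rsqrt2] <;>
    first
    | linear_combination 2 * h
    | linear_combination (1 + Complex.I) * h
    | linear_combination (1 - Complex.I) * h

theorem beamSplitter_zero_one : beamSplitter 0 1 =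
    !![rsqrt2, rsqrt2, 0, 0; rsqrt2, -rsqrt2, 0, 0; 0, 0, 1, 0; 0, 0, 0, 1] := by
  ext i j; fin_cases i <;> fin_cases j <;> simp [beamSplitter]

theorem beamSplitter_two_three : beamSplitter 2 3 =
    !![1, 0, 0, 0; 0, 1, 0, 0; 0, 0, rsqrt2, rsqrt2; 0, 0, rsqrt2, -rsqrt2] := by
  ext i j; fin_cases i <;> fin_cases j <;> simp [beamSplitter]

theorem beamSplitter_two_one : beamSplitter 2 1 =
    !![1, 0, 0, 0; 0, -rsqrt2, rsqrt2, 0; 0, rsqrt2, rsqrt2, 0; 0, 0, 0, 1] := by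
  ext i j; fin_cases i <;> fin_cases j <;> simp [beamSplitter]

theorem beamSplitter_zero_three : beamSplitter 0 3 =
    !![rsqrt2, 0, 0, rsqrt2; 0, 1, 0, 0; 0, 0, 1, 0; rsqrt2, 0, 0, -rsqrt2] := by
  ext i j; fin_cases i <;> fin_cases j <;> simp [beamSplitter]

theorem preRotation_eq (c : Bool) : preRotation c =
    !![rsqrt2, rsqrt2 * phaseS c true, 0, 0; rsqrt2, -(rsqrt2 * phaseS c true), 0, 0;
      0, 0, rsqrt2, rsqrt2 * phaseS c true; 0, 0, rsqrt2, -(rsqrt2 * phaseS c true)] := by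
  have h : Complex.exp (Real.pi / 2 * Complex.I) = Complex.I := Complex.exp_pi_div_two_mul_I
  unfold preRotation
  rw [beamSplitter_zero_one, beamSplitter_two_three]
  ext i j
  simp only [phaseShift, Matrix.mul_diagonal]
  fin_cases i <;> fin_cases j <;> cases c <;> simp [phaseS, h]

/-- The entries of the destructive fusion circuit. -/
theorem fusionCircuit_eq (τ : FusionType) (c : Bool) : fusionCircuit τ c =
    !![1 / 2, 1 / 2 * phaseS c true, 1 / 2 * fusionPhase τ,
        -(1 / 2 * fusionPhase τ * phaseS c true);
      -(1 / 2), 1 / 2 * phaseS c true, 1 / 2, 1 / 2 * phaseS c true;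
      1 / 2, -(1 / 2 * phaseS c true), 1 / 2, 1 / 2 * phaseS c true;
      1 / 2, 1 / 2 * phaseS c true, -(1 / 2 * fusionPhase τ),
        1 / 2 * fusionPhase τ * phaseS c true] := by
  have key : ∀ (φ : ℝ) (p : ℂ), Complex.exp (φ * Complex.I) = p →
      beamSplitter 0 3 * phaseShift 3 φ * beamSplitter 2 1 * preRotation c =
      !![1 / 2, 1 / 2 * phaseS c true, 1 / 2 * p, -(1 / 2 * p * phaseS c true);
        -(1 / 2), 1 / 2 * phaseS c true, 1 / 2, 1 / 2 * phaseS c true;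
        1 / 2, -(1 / 2 * phaseS c true), 1 / 2, 1 / 2 * phaseS c true;
        1 / 2, 1 / 2 * phaseS c true, -(1 / 2 * p), 1 / 2 * p * phaseS c true] := by
    intro φ p h
    have h1 : beamSplitter 0 3 * phaseShift 3 φ =
        !![rsqrt2, 0, 0, rsqrt2 * p; 0, 1, 0, 0; 0, 0, 1, 0; rsqrt2, 0, 0, -rsqrt2 * p] := by
      rw [beamSplitter_zero_three]
      ext i j
      simp only [phaseShift, Matrix.mul_diagonal]
      fin_cases i <;> fin_cases j <;> simp [h]
    have h2 := rsqrt2_mul_self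
    rw [h1, preRotation_eq, beamSplitter_two_one]
    generalize phaseS c true = g
    ext i j
    fin_cases i <;> fin_cases j <;> simp [Matrix.mul_apply, Fin.sum_univ_four] <;> grind
  cases τ
  · exact key 0 1 (by simp)
  · refine key (-(Real.pi / 2)) (-Complex.I) ?_
    rw [← Complex.exp_neg_pi_div_two_mul_I]
    push_cast
    ring_nf

theorem heralds_mk (m l : Fin 4) :
    Heralds s(m, l) ↔ ((m = 1 ∨ m = 2) ↔ ¬ (l = 1 ∨ l = 2)) := by
  revert m l
  unfold Heralds Detection.count
  decide

theorem sum_detection {M : Type*} [AddCommMonoid M] (F : Detection → M) :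
    ∑ o, F o = F s(0, 0) + (F s(0, 1) + (F s(0, 2) + (F s(0, 3) + (F s(1, 1) + (F s(1, 2) +
      (F s(1, 3) + (F s(2, 2) + (F s(2, 3) + F s(3, 3))))))))) := by
  have h : (Finset.univ : Finset Detection) = {s(0, 0), s(0, 1), s(0, 2), s(0, 3), s(1, 1),
    s(1, 2), s(1, 3), s(2, 2), s(2, 3), s(3, 3)} := by decide
  rw [h]
  repeat rw [Finset.sum_insert (by decide)]
  rw [Finset.sum_singleton]

theorem norm_fusionPhase (τ : FusionType) : ‖fusionPhase τ‖ = 1 := by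
  cases τ <;> simp [fusionPhase]

/-- The logical outcome of a successful fusion attempt. -/
def attemptOutcome (o : Detection) : Bool := decide (o = s(0, 1) ∨ o = s(2, 3))

open Classical in
/-- The squared modulus of the amplitude of an outcome of a fusion attempt, without the factor that
comes from the effect on the qubits. The outcomes without a herald and of nonzero amplitude have
both photons in one mode; the factor `1 / √2` for such a detection turns `1 / 4` into `1 / 8`. -/
def attemptWeight (o : Detection) : ℝ :=
  if Heralds o then 1 / 4 else if o.IsDiag then 1 / 8 else 0

theorem phaseS_false (c : Bool) : phaseS c false = 1 := by simp [phaseS]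

theorem fusionCircuit_railA (τ : FusionType) (c a : Bool) (m : Fin 4) :
    fusionCircuit τ c m (railA a) = phaseS c a * (1 / 2 * ![1, -sgn a, sgn a, 1] m) := by
  rw [fusionCircuit_eq]
  cases a <;> fin_cases m <;> simp [railA, sgn, phaseS_false] <;> ring

theorem fusionCircuit_railB (τ : FusionType) (c b : Bool) (m : Fin 4) :
    fusionCircuit τ c m (railB b) =
      phaseS c b * (1 / 2 * ![fusionPhase τ * sgn b, 1, 1, -(fusionPhase τ * sgn b)] m) := by
  rw [fusionCircuit_eq]
  cases b <;> fin_cases m <;> simp [railB, sgn, phaseS_false] <;> ring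

theorem preRotation_railA (c a : Bool) (m : Fin 4) :
    preRotation c m (railA a) = phaseS c a * (rsqrt2 * ![1, sgn a, 0, 0] m) := by
  rw [preRotation_eq]
  cases a <;> fin_cases m <;> simp [railA, sgn, phaseS_false] <;> ring

theorem preRotation_railB (c b : Bool) (m : Fin 4) :
    preRotation c m (railB b) = phaseS c b * (rsqrt2 * ![0, 0, 1, sgn b] m) := by
  rw [preRotation_eq]
  cases b <;> fin_cases m <;> simp [railB, sgn, phaseS_false] <;> ring

/-- A fusion attempt applies `S^c` and a known power of `Z` to each qubit; if it succeeds, it also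
applies the Kraus operator of the fusion. -/
theorem detectionAmplitude_fusionCircuit (τ : FusionType) (c : Bool) (o : Detection) :
    ∃ (sA sB : Bool) (D : ℂ), ‖D‖ ^ 2 = attemptWeight o ∧
      (Heralds o → ∀ a b, detectionAmplitude (fusionCircuit τ c) (railA a) (railB b) o =
        phaseS c a * phaseS c b * (D * fusionKraus τ false (attemptOutcome o) a b *
          sgn (sA && a) * sgn (sB && b))) ∧
      (¬ Heralds o → ∀ a b, detectionAmplitude (fusionCircuit τ c) (railA a) (railB b) o =
        phaseS c a * phaseS c b * (D * sgn (sA && a) * sgn (sB && b))) := by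
  have hn : ∀ z : ℂ, ‖z‖ = 1 → ‖z / (2 * ((Real.sqrt 2 : ℝ) : ℂ))‖ ^ 2 = 1 / 8 := by
    intro z hz
    simp [hz, mul_pow]; norm_num
  have hph := norm_fusionPhase τ
  induction o using Sym2.ind with | _ m l =>
  simp only [detectionAmplitude, Sym2.lift_mk, fusionCircuit_railA, fusionCircuit_railB,
    fusionKraus_false, heralds_mk, attemptWeight, Sym2.mk_isDiag_iff]
  generalize fusionPhase τ = p at *
  match m, l with
  | 0, 0 =>
    refine ⟨false, true, p / (2 * ((Real.sqrt 2 : ℝ) : ℂ)), ?_, by simp, fun _ a b => ?_⟩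
    · rw [hn _ hph]; simp
    · simp; ring
  | 3, 3 =>
    refine ⟨false, true, -p / (2 * ((Real.sqrt 2 : ℝ) : ℂ)), ?_, by simp, fun _ a b => ?_⟩
    · rw [hn _ (by simpa using hph)]; simp
    · simp; ring
  | 1, 1 =>
    refine ⟨true, false, -1 / (2 * ((Real.sqrt 2 : ℝ) : ℂ)), ?_, by simp, fun _ a b => ?_⟩
    · rw [hn _ (by simp)]; simp
    · simp; ring
  | 2, 2 =>
    refine ⟨true, false, 1 / (2 * ((Real.sqrt 2 : ℝ) : ℂ)), ?_, by simp, fun _ a b => ?_⟩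
    · rw [hn _ (by simp)]; simp
    · simp; ring
  | 0, 3 | 3, 0 | 1, 2 | 2, 1 =>
    refine ⟨false, false, 0, by simp, by simp, fun _ a b => ?_⟩
    simp
  | 0, 1 | 1, 0 | 0, 2 | 2, 0 | 3, 1 | 1, 3 | 3, 2 | 2, 3 =>
    refine ⟨false, false, 1 / 2, by simp; norm_num, fun _ a b => ?_, by simp⟩
    simp [attemptOutcome]
    ring

/-- Photons of a round after the success are measured separately; this applies `S^c` and a known
power of `Z` to each qubit. -/
theorem detectionAmplitude_preRotation (c : Bool) (o : Detection) :
    ∃ (sA sB : Bool) (D : ℂ),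
      ‖D‖ ^ 2 = (if o = s(0, 2) ∨ o = s(0, 3) ∨ o = s(1, 2) ∨ o = s(1, 3) then 1 / 4 else 0) ∧
      ∀ a b, detectionAmplitude (preRotation c) (railA a) (railB b) o =
        phaseS c a * phaseS c b * (D * sgn (sA && a) * sgn (sB && b)) := by
  have h : ∀ x y z w : ℂ, x * (rsqrt2 * y) * (z * (rsqrt2 * w)) = x * z * (1 / 2 * (y * w)) :=
    fun x y z w => by linear_combination x * y * z * w * rsqrt2_mul_self
  induction o using Sym2.ind with | _ m l =>
  simp only [detectionAmplitude, Sym2.lift_mk, preRotation_railA, preRotation_railB, h]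
  match m, l with
  | 0, 2 | 2, 0 => exact ⟨false, false, 1 / 2, by simp; norm_num, fun a b => by simp⟩
  | 0, 3 | 3, 0 => exact ⟨false, true, 1 / 2, by simp; norm_num, fun a b => by simp⟩
  | 1, 2 | 2, 1 => exact ⟨true, false, 1 / 2, by simp; norm_num, fun a b => by simp⟩
  | 1, 3 | 3, 1 => exact ⟨true, true, 1 / 2, by simp; norm_num, fun a b => by simp [mul_assoc]⟩
  | 0, 0 | 1, 1 | 2, 2 | 3, 3 | 0, 1 | 1, 0 | 2, 3 | 3, 2 =>
    exact ⟨false, false, 0, by simp, fun a b => by simp⟩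

/-! ### Repeat-until-success fusion -/

theorem sgn_xor_and (s t a : Bool) : sgn ((s ^^ t) && a) = sgn (s && a) * sgn (t && a) := by
  cases s <;> cases t <;> cases a <;> simp

theorem sum_fin_succ_pi {α M : Type*} [Fintype α] [AddCommMonoid M] {k : ℕ}
    (F : (Fin (k + 1) → α) → M) :
    ∑ o, F o = ∑ o₀ : α, ∑ o' : Fin k → α, F (Fin.cons o₀ o') := by
  rw [← (Fin.consEquiv fun _ => α).sum_comp, Fintype.sum_prod_type]
  rfl

/-- The rounds after the success apply `S^(ck)` and a known power of `Z` to each qubit. -/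
theorem prod_detectionAmplitude_preRotation (c : Bool) (k : ℕ) :
    ∃ (sA sB : (Fin k → Detection) → Bool) (D : (Fin k → Detection) → ℂ),
      (∑ o, ‖D o‖ ^ 2 = 1) ∧
      ∀ o a b, ∏ t, detectionAmplitude (preRotation c) (railA a) (railB b) (o t) =
        (phaseS c a * phaseS c b) ^ k * (D o * sgn (sA o && a) * sgn (sB o && b)) := by
  induction k with
  | zero => exact ⟨fun _ => false, fun _ => false, fun _ => 1, by simp, by simp⟩
  | succ k ih =>
    obtain ⟨sA, sB, D, hD, h⟩ := ih
    choose tA tB D1 hD1 h1 using detectionAmplitude_preRotation c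
    refine ⟨fun o => tA (o 0) ^^ sA (Fin.tail o), fun o => tB (o 0) ^^ sB (Fin.tail o),
      fun o => D1 (o 0) * D (Fin.tail o), ?_, fun o a b => ?_⟩
    · rw [sum_fin_succ_pi]
      simp only [Fin.cons_zero, Fin.tail_cons, norm_mul, mul_pow]
      simp_rw [← Finset.mul_sum, hD, mul_one, hD1]
      rw [sum_detection]
      simp
      norm_num
    · rw [Fin.prod_univ_succ, h1]
      have := h (Fin.tail o) a b
      simp only [Fin.tail] at this ⊢
      rw [this, sgn_xor_and, sgn_xor_and]
      ring

open Classical in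
/-- After the first round, either all further rounds measure separately, or a repeat-until-success
fusion with one round less begins. -/
theorem rusEffect_succ {k : ℕ} (τ : FusionType) (c : Bool) (o : Fin (k + 1) → Detection)
    (x : Fin (k + 1) × Bool → Bool) :
    rusEffect τ c o x = detectionAmplitude (fusionCircuit τ c) (railA (x (0, false)))
        (railB (x (0, true))) (o 0) *
      if Heralds (o 0) then ∏ t : Fin k, detectionAmplitude (preRotation c)
        (railA (x (t.succ, false))) (railB (x (t.succ, true))) (o t.succ)
      else rusEffect τ c (Fin.tail o) fun p => x (p.1.succ, p.2) := by
  unfold rusEffect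
  rw [Fin.prod_univ_succ]
  congr 1
  · simp
  · split_ifs with h
    · refine Finset.prod_congr rfl fun t _ => ?_
      rw [if_pos ⟨0, Fin.succ_pos t, h⟩]
    · refine Finset.prod_congr rfl fun t _ => ?_
      have : (∃ s, s < t.succ ∧ Heralds (o s)) ↔ ∃ s, s < t ∧ Heralds (Fin.tail o s) := by
        rw [Fin.exists_fin_succ]
        simp [h, Fin.tail]
      simp only [this, Fin.tail]
      congr!

open Classical in
/-- The two logical outcomes of an attempt have the same total weight. As the Kraus operators of the
two outcomes satisfy the completeness relation, an attempt succeeds with probability `1 / 2`. -/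
theorem sum_attemptWeight_herald (κ : Bool) :
    ∑ o, (if Heralds o ∧ attemptOutcome o = κ then attemptWeight o else 0) = 1 / 2 := by
  rw [sum_detection]
  cases κ <;> simp [heralds_mk, attemptOutcome, attemptWeight] <;> norm_num

open Classical in
theorem sum_attemptWeight_not_herald :
    ∑ o, (if Heralds o then 0 else attemptWeight o) = 1 / 2 := by
  rw [sum_detection]
  simp [heralds_mk, attemptWeight]
  norm_num

open Classical in
/-- A repeat-until-success fusion that succeeds in one of `k` rounds acts, up to Pauli operators
known from the record, as the fusion with `S^(ck)` in place of `S^c`. The probability of success is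
`1 - 2^(-k)`. -/
theorem rusEffect_eq_pow (τ : FusionType) (c : Bool) (k : ℕ) :
    ∃ (κ sA sB : (Fin k → Detection) → Bool) (D : (Fin k → Detection) → ℂ),
      (∀ κ₀, ∑ o, (if (∃ t, Heralds (o t)) ∧ κ o = κ₀ then ‖D o‖ ^ 2 else 0) = 1 - 1 / 2 ^ k) ∧
      ∀ o, (∃ t, Heralds (o t)) → ∀ x a b, (∀ t, x (t, false) = a) → (∀ t, x (t, true) = b) →
        rusEffect τ c o x = (phaseS c a * phaseS c b) ^ k *
          (D o * fusionKraus τ false (κ o) a b * sgn (sA o && a) * sgn (sB o && b)) := by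
  induction k with
  | zero => exact ⟨fun _ => false, fun _ => false, fun _ => false, fun _ => 1, by simp, by simp⟩
  | succ k ih =>
    obtain ⟨κ, sA, sB, D, hD, h⟩ := ih
    choose pA pB Dp hDp hp using prod_detectionAmplitude_preRotation c k
    choose tA tB D1 hD1 hs hf using detectionAmplitude_fusionCircuit τ c
    refine ⟨fun o => if Heralds (o 0) then attemptOutcome (o 0) else κ (Fin.tail o),
      fun o => tA (o 0) ^^ if Heralds (o 0) then pA (Fin.tail o) else sA (Fin.tail o),
      fun o => tB (o 0) ^^ if Heralds (o 0) then pB (Fin.tail o) else sB (Fin.tail o),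
      fun o => D1 (o 0) * if Heralds (o 0) then Dp (Fin.tail o) else D (Fin.tail o),
      fun κ₀ => ?_, fun o ho x a b ha hb => ?_⟩
    · rw [sum_fin_succ_pi]
      have key : ∀ o₀ : Detection, (∑ o' : Fin k → Detection,
          if (∃ t, Heralds ((Fin.cons o₀ o' : Fin (k + 1) → Detection) t)) ∧
            (if Heralds o₀ then attemptOutcome o₀ else κ o') = κ₀
          then ‖D1 o₀ * if Heralds o₀ then Dp o' else D o'‖ ^ 2 else 0) =
          (if Heralds o₀ ∧ attemptOutcome o₀ = κ₀ then attemptWeight o₀ else 0) +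
          (if Heralds o₀ then 0 else attemptWeight o₀) * (1 - 1 / 2 ^ k) := by
        intro o₀
        simp only [Fin.exists_fin_succ, Fin.cons_zero, Fin.cons_succ]
        by_cases h0 : Heralds o₀
        · by_cases h1 : attemptOutcome o₀ = κ₀
          · simp [h0, h1, mul_pow, ← Finset.mul_sum, hDp, hD1]
          · simp [h0, h1]
        · simp only [h0, false_or, if_false, false_and, zero_add, norm_mul, mul_pow, hD1]
          rw [← hD κ₀, Finset.mul_sum]
          refine Finset.sum_congr rfl fun o' _ => ?_
          split_ifs <;> simp
      simp only [Fin.cons_zero, Fin.tail_cons]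
      rw [Finset.sum_congr rfl fun o₀ _ => key o₀, Finset.sum_add_distrib, ← Finset.sum_mul,
        sum_attemptWeight_herald, sum_attemptWeight_not_herald]
      rw [pow_succ]
      field_simp
      ring
    · rw [rusEffect_succ, ha, hb]
      -- Either way the first round contributes `S^c`, and the later rounds contribute `S^(ck)`.
      simp only [ha, hb]
      by_cases h0 : Heralds (o 0)
      · have := hp (Fin.tail o) a b
        simp only [Fin.tail] at this
        simp only [h0, if_true, hs (o 0) h0, this, sgn_xor_and]
        ring
      · rw [Fin.exists_fin_succ] at ho
        have := h (Fin.tail o) (ho.resolve_left h0) (fun p => x (p.1.succ, p.2)) a b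
          (fun t => ha _) (fun t => hb _)
        simp only [h0, if_false, hf (o 0) h0, this, sgn_xor_and]
        ring

theorem phaseS_pow_odd {k : ℕ} (hk : Odd k) (c a : Bool) :
    phaseS c a ^ k = phaseS c a * sgn (decide (Odd (k / 2)) && (c && a)) := by
  obtain ⟨j, rfl⟩ := hk
  have : (2 * j + 1) / 2 = j := by omega
  rw [this]
  unfold phaseS
  cases c && a
  · simp
  · rw [pow_succ, pow_mul]
    rcases Nat.even_or_odd j with hj | hj
    · simp [hj.neg_one_pow, Nat.not_odd_iff_even.mpr hj]
    · simp [hj.neg_one_pow, hj]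

open Classical in
/-- A successful repeat-until-success fusion with an odd number of rounds is the fusion, up to Pauli
operators known from the record: every round applies `S^c`, and `S^(ck)` is `S^c` up to a power of
`Z`. Both logical outcomes have the same total weight. -/
theorem rusEffect_eq (τ : FusionType) (c : Bool) {k : ℕ} (hk : Odd k) :
    ∃ (κ sA sB : (Fin k → Detection) → Bool) (D : (Fin k → Detection) → ℂ),
      (∀ κ₀, ∑ o, (if (∃ t, Heralds (o t)) ∧ κ o = κ₀ then ‖D o‖ ^ 2 else 0) = 1 - 1 / 2 ^ k) ∧
      ∀ o, (∃ t, Heralds (o t)) → ∀ x a b, (∀ t, x (t, false) = a) → (∀ t, x (t, true) = b) →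
        rusEffect τ c o x =
          D o * fusionKraus τ c (κ o) a b * sgn (sA o && a) * sgn (sB o && b) := by
  obtain ⟨κ, sA, sB, D, hD, h⟩ := rusEffect_eq_pow τ c k
  refine ⟨κ, fun o => sA o ^^ (decide (Odd (k / 2)) && c),
    fun o => sB o ^^ (decide (Odd (k / 2)) && c), D, hD, fun o ho x a b ha hb => ?_⟩
  rw [h o ho x a b ha hb, fusionKraus_eq τ c, mul_pow, phaseS_pow_odd hk, phaseS_pow_odd hk,
    sgn_xor_and, sgn_xor_and, Bool.and_assoc, Bool.and_assoc]
  ring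

section Execution

variable {n f : ℕ} {I O : Finset (Fin n)}

/-! ### Execution of patterns -/

/-- The commands of the second list may be executed after those of the first list. -/
def Exec : Pattern n f I O → Pattern n f I O → Prop
  | _, [] => True
  | pre, c :: post => c.Allowed pre ∧ Exec (pre ++ [c]) post

theorem Pattern.Runnable.exec {P : Pattern n f I O} (h : P.Runnable) : Exec [] P := by
  suffices H : ∀ post pre : Pattern n f I O,
      (∀ (p q : Pattern n f I O) c, post = p ++ c :: q → c.Allowed (pre ++ p)) → Exec pre post from
    H P [] fun p q c hc => h.1 p q c hc
  intro post
  induction post with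
  | nil => intro pre _; trivial
  | cons c post ih =>
    intro pre h
    refine ⟨by simpa using h [] post c rfl, ih _ fun p q d hd => ?_⟩
    simpa using h (c :: p) q d (by simp [hd])

theorem prepared_append {p q : Pattern n f I O} {i : Fin n} :
    Prepared (p ++ q) i ↔ Prepared p i ∨ ∃ h : i ∉ I, Command.prep ⟨i, h⟩ ∈ q := by
  simp only [Prepared, List.mem_append, exists_or, or_assoc]

theorem measured_append {p q : Pattern n f I O} {i : Fin n} :
    Measured (p ++ q) i ↔ Measured p i ∨ Measured q i := by
  simp only [Measured, List.mem_append, exists_or]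

theorem fused_append {p q : Pattern n f I O} {a : Fin f} :
    Fused (p ++ q) a ↔ Fused p a ∨ Fused q a := by
  simp only [Fused, List.mem_append, exists_or]

theorem measured_cons {c : Command n f I O} {q : Pattern n f I O} {i : Fin n} :
    Measured (c :: q) i ↔ Measured [c] i ∨ Measured q i :=
  measured_append (p := [c])

theorem fused_cons {c : Command n f I O} {q : Pattern n f I O} {a : Fin f} :
    Fused (c :: q) a ↔ Fused [c] a ∨ Fused q a :=
  fused_append (p := [c])

theorem live_of_measured_ne {pre : Pattern n f I O} {i j : Fin n} (hi : Measured pre i)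
    (hj : Live pre j) : i ≠ j := by
  rintro rfl; exact hj.2 hi

theorem Exec.not_measured {pre post : Pattern n f I O} (h : Exec pre post) {i : Fin n}
    (hi : Measured pre i) : ¬ Measured post i := by
  induction post generalizing pre with
  | nil => simp [Measured]
  | cons c post ih =>
    rw [measured_cons, not_or]
    refine ⟨?_, ih h.2 (measured_append.2 (Or.inl hi))⟩
    rintro ⟨hO, lam, α, hc⟩
    rw [List.mem_singleton] at hc
    subst hc
    exact h.1.2 hi

theorem Exec.not_fused {pre post : Pattern n f I O} (h : Exec pre post) {a : Fin f}
    (ha : Fused pre a) : ¬ Fused post a := by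
  induction post generalizing pre with
  | nil => simp [Fused]
  | cons c post ih =>
    rw [fused_cons, not_or]
    refine ⟨?_, ih h.2 (fused_append.2 (Or.inl ha))⟩
    rintro ⟨τ, c', i, j, hc⟩
    rw [List.mem_singleton] at hc
    subst hc
    exact h.1.2.2.2 ha

theorem Exec.not_prepared {pre post : Pattern n f I O} (h : Exec pre post) {i : Fin n}
    (hi : Prepared pre i) (hI : i ∉ I) : Command.prep ⟨i, hI⟩ ∉ post := by
  induction post generalizing pre with
  | nil => simp
  | cons c post ih =>
    rw [List.mem_cons, not_or]
    refine ⟨?_, ih h.2 (prepared_append.2 (Or.inl hi))⟩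
    rintro rfl
    exact h.1 hi

theorem Exec.of_append {pre p q : Pattern n f I O} (h : Exec pre (p ++ q)) : Exec pre p := by
  induction p generalizing pre with
  | nil => trivial
  | cons c p ih => exact ⟨h.1, ih h.2⟩

theorem Exec.append_right {pre p q : Pattern n f I O} (h : Exec pre (p ++ q)) :
    Exec (pre ++ p) q := by
  induction p generalizing pre with
  | nil => simpa using h
  | cons c p ih => simpa using ih h.2

/-- A fusion is named only once. -/
theorem Exec.fuse_unique {pre post : Pattern n f I O} (h : Exec pre post) {a : Fin f}
    {τ τ' : FusionType} {c c' : Bool} {i i' j j' : Fin n}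
    (h₁ : Command.fuse a τ c i j ∈ post) (h₂ : Command.fuse a τ' c' i' j' ∈ post) :
    τ = τ' ∧ c = c' ∧ i = i' ∧ j = j' := by
  induction post generalizing pre with
  | nil => simp at h₁
  | cons d post ih =>
    have key : ∀ {τ c i j}, Command.fuse a τ c i j = d → ¬ Fused post a := by
      rintro τ c i j rfl
      exact h.2.not_fused (fused_append.2 (Or.inr ⟨_, _, _, _, List.mem_singleton.2 rfl⟩))
    rcases List.mem_cons.1 h₁ with e₁ | m₁ <;> rcases List.mem_cons.1 h₂ with e₂ | m₂
    · have := e₁.trans e₂.symm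
      simpa using this
    · exact absurd ⟨_, _, _, _, m₂⟩ (key e₁)
    · exact absurd ⟨_, _, _, _, m₁⟩ (key e₂)
    · exact ih h.2 m₁ m₂

/-- A qubit is measured only once. -/
theorem Exec.measure_unique {pre post : Pattern n f I O} (h : Exec pre post)
    {i : {i : Fin n // i ∉ O}} {lam lam' : Label} {α α' : ℝ}
    (h₁ : Command.measure i lam α ∈ post) (h₂ : Command.measure i lam' α' ∈ post) :
    lam = lam' ∧ α = α' := by
  induction post generalizing pre with
  | nil => simp at h₁
  | cons d post ih =>
    have key : ∀ {lam α}, Command.measure i lam α = d → ¬ Measured post i.1 := by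
      rintro lam α rfl
      exact h.2.not_measured (measured_append.2 (Or.inr ⟨i.2, _, _, List.mem_singleton.2 rfl⟩))
    rcases List.mem_cons.1 h₁ with e₁ | m₁ <;> rcases List.mem_cons.1 h₂ with e₂ | m₂
    · have := e₁.trans e₂.symm
      simpa using this
    · exact absurd ⟨i.2, _, _, m₂⟩ (key e₁)
    · exact absurd ⟨i.2, _, _, m₁⟩ (key e₂)
    · exact ih h.2 m₁ m₂

/-! ### Sums over computational paths -/

/-- Flip the bit at `i` if `v` is `true`. -/
def flipAt (i : Fin n) (v : Bool) (b : Fin n → Bool) : Fin n → Bool :=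
  Function.update b i (b i ^^ v)

theorem flipAt_self (i : Fin n) (v : Bool) (b : Fin n → Bool) : flipAt i v b i = (b i ^^ v) := by
  simp [flipAt]

theorem flipAt_of_ne {i j : Fin n} (h : j ≠ i) (v : Bool) (b : Fin n → Bool) :
    flipAt i v b j = b j := by
  simp [flipAt, h]

theorem flipAt_involutive (i : Fin n) (v : Bool) : Function.Involutive (flipAt i v) := by
  intro b
  funext j
  by_cases h : j = i
  · subst h; simp [flipAt_self]
  · simp [flipAt_of_ne h]

theorem flipAt_comm {i j : Fin n} (h : i ≠ j) (v w : Bool) (b : Fin n → Bool) :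
    flipAt i v (flipAt j w b) = flipAt j w (flipAt i v b) := by
  unfold flipAt
  simp only [Function.update_of_ne h, Function.update_of_ne h.symm]
  exact Function.update_comm h.symm _ _ _

theorem sum_flipAt {M : Type*} [AddCommMonoid M] (i : Fin n) (v : Bool)
    (F : (Fin n → Bool) → M) : ∑ b, F (flipAt i v b) = ∑ b, F b :=
  Equiv.sum_comp (flipAt_involutive i v).toPerm F

/-- The condition that the output qubits are in the basis state `y`. -/
def readout (y : {i // i ∈ O} → Bool) (b : Fin n → Bool) : ℂ :=
  ∏ i : {i // i ∈ O}, if b i = y i then 1 else 0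

theorem readout_eq_ite (y : {i // i ∈ O} → Bool) (b : Fin n → Bool) :
    readout y b = if ∀ i : {i // i ∈ O}, b i = y i then 1 else 0 := by
  rw [readout, Finset.prod_ite_zero]
  simp

/-- The weight that the commands give to a computational path with outcomes `m` and output bits `y`.
The path is given by the current bits of the live qubits and the initial bits of those that will be
prepared later; it is changed by `X`-corrections only. -/
def pathWeight (m : Outcomes n f O) (y : {i // i ∈ O} → Bool) :
    Pattern n f I O → (Fin n → Bool) → ℂ
  | [], b => readout y b
  | .prep _ :: post, b => rsqrt2 * pathWeight m y post b
  | .entangle i j :: post, b => cz (b i) (b j) * pathWeight m y post b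
  | .fuse a τ c i j :: post, b =>
      fusionKraus τ c (m.2 a) (b i) (b j) * pathWeight m y post b
  | .measure i lam α :: post, b => conj (lam.ket α (m.1 i) (b i)) * pathWeight m y post b
  | .corrX i t :: post, b => pathWeight m y post (flipAt i (t.val m) b)
  | .corrZ i t :: post, b => sgn (t.val m && b i) * pathWeight m y post b

/-- The bit of a measured qubit has no effect on the weight of the remaining commands. -/
theorem pathWeight_flipAt {m : Outcomes n f O} {y : {i // i ∈ O} → Bool}
    {pre post : Pattern n f I O} (h : Exec pre post) {i : Fin n} (hi : Measured pre i)
    (v : Bool) (b : Fin n → Bool) :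
    pathWeight m y post (flipAt i v b) = pathWeight m y post b := by
  induction post generalizing pre b with
  | nil =>
    have : ∀ j : {i // i ∈ O}, flipAt i v b j = b j := fun j =>
      flipAt_of_ne (by rintro rfl; exact hi.1 j.2) _ _
    simp [pathWeight, readout, this]
  | cons c post ih =>
    have ih' := ih h.2 (measured_append.2 (Or.inl hi))
    have hne : ∀ {j}, Live pre j → flipAt i v b j = b j := fun hj =>
      flipAt_of_ne (live_of_measured_ne hi hj).symm _ _
    cases c with
    | prep j => simp [pathWeight, ih']
    | entangle j k => simp [pathWeight, ih', hne h.1.2.1, hne h.1.2.2]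
    | fuse a τ c j k => simp [pathWeight, ih', hne h.1.2.1, hne h.1.2.2.1]
    | measure j lam α => simp [pathWeight, ih', hne h.1]
    | corrX j t =>
      simp only [pathWeight]
      rw [flipAt_comm (live_of_measured_ne hi h.1.1).symm, ih']
    | corrZ j t => simp [pathWeight, ih', hne h.1.1]

/-- A computational basis vector. -/
def basisVec (z : Fin n → Bool) : Vec (Fin n) := fun w => if w = z then 1 else 0

/-- Two bit strings are equal after a change of one of them at `i` if and only if the bits at `i`
match and the strings agree elsewhere. -/
theorem exists_agree_off (i : Fin n) (w z : Fin n → Bool) :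
    ∃ E : Prop, (∀ b, Function.update w i b = z ↔ z i = b ∧ E) ∧
      ∀ b, w = Function.update z i b ↔ w i = b ∧ E := by
  refine ⟨∀ j, j ≠ i → w j = z j, fun b => ?_, fun b => ?_⟩
  · rw [Function.update_eq_iff, eq_comm]
  · rw [Function.eq_update_iff]

variable (m : Outcomes n f O)

theorem op_prep_basisVec (i : {i : Fin n // i ∉ I}) {z : Fin n → Bool} (hz : z i = false) :
    (Command.prep i : Command n f I O).op m (basisVec z) =
      rsqrt2 • (basisVec (Function.update z i false) + basisVec (Function.update z i true)) := by
  funext w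
  classical
  obtain ⟨E, h1, h2⟩ := exists_agree_off i.1 w z
  simp only [Command.op, apply1, basisVec, Pi.smul_apply, Pi.add_apply, h1, h2, hz]
  cases h : w i <;> simp [ketX, ketZ]

theorem op_entangle_basisVec (i j : Fin n) (z : Fin n → Bool) :
    (Command.entangle i j : Command n f I O).op m (basisVec z) =
      cz (z i) (z j) • basisVec z := by
  funext w
  simp only [Command.op, applyDiag2, basisVec, Pi.smul_apply]
  split_ifs with h
  · subst h; simp
  · simp

theorem op_fuse_basisVec (a : Fin f) (τ : FusionType) (c : Bool) (i j : Fin n)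
    (z : Fin n → Bool) :
    (Command.fuse a τ c i j : Command n f I O).op m (basisVec z) =
      fusionKraus τ c (m.2 a) (z i) (z j) • basisVec z := by
  funext w
  simp only [Command.op, applyDiag2, basisVec, Pi.smul_apply]
  split_ifs with h
  · subst h; simp
  · simp

theorem op_measure_basisVec (i : {i : Fin n // i ∉ O}) (lam : Label) (α : ℝ)
    (z : Fin n → Bool) :
    (Command.measure i lam α : Command n f I O).op m (basisVec z) =
      conj (lam.ket α (m.1 i) (z i)) • basisVec (Function.update z i false) := by
  funext w
  classical
  obtain ⟨E, h1, h2⟩ := exists_agree_off i.1 w z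
  simp only [Command.op, apply1, basisVec, Pi.smul_apply, h1, h2]
  cases h : w i <;> cases h' : z i <;> simp [ketZ]

theorem op_corrX_basisVec (i : Fin n) (t : Signal n f O) (z : Fin n → Bool) :
    (Command.corrX i t : Command n f I O).op m (basisVec z) =
      basisVec (flipAt i (t.val m) z) := by
  funext w
  classical
  obtain ⟨E, h1, h2⟩ := exists_agree_off i w z
  simp only [Command.op, apply1, basisVec, flipAt, h1, h2]
  cases h : w i <;> cases h' : z i <;> cases t.val m <;> simp [pauli]

theorem op_corrZ_basisVec (i : Fin n) (t : Signal n f O) (z : Fin n → Bool) :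
    (Command.corrZ i t : Command n f I O).op m (basisVec z) =
      sgn (t.val m && z i) • basisVec z := by
  funext w
  classical
  obtain ⟨E, h1, h2⟩ := exists_agree_off i w z
  have h3 : w = z ↔ w i = z i ∧ E := by rw [← h2]; simp
  simp only [Command.op, apply1, basisVec, Pi.smul_apply, h1, h3]
  cases h : w i <;> cases h' : z i <;> cases t.val m <;> simp [pauli]

theorem op_add (c : Command n f I O) (ψ φ : Vec (Fin n)) :
    c.op m (ψ + φ) = c.op m ψ + c.op m φ := by
  funext w
  cases c <;> simp [Command.op, apply1, applyDiag2] <;> ring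

theorem op_smul (c : Command n f I O) (r : ℂ) (ψ : Vec (Fin n)) :
    c.op m (r • ψ) = r • c.op m ψ := by
  funext w
  cases c <;> simp [Command.op, apply1, applyDiag2] <;> ring

theorem foldl_op_add (P : Pattern n f I O) (ψ φ : Vec (Fin n)) :
    P.foldl (fun ψ c => c.op m ψ) (ψ + φ) =
      P.foldl (fun ψ c => c.op m ψ) ψ + P.foldl (fun ψ c => c.op m ψ) φ := by
  induction P generalizing ψ φ with
  | nil => rfl
  | cons c P ih => simp only [List.foldl_cons, op_add, ih]

theorem foldl_op_smul (P : Pattern n f I O) (r : ℂ) (ψ : Vec (Fin n)) :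
    P.foldl (fun ψ c => c.op m ψ) (r • ψ) = r • P.foldl (fun ψ c => c.op m ψ) ψ := by
  induction P generalizing ψ with
  | nil => rfl
  | cons c P ih => simp only [List.foldl_cons, op_smul, ih]

end Execution

section Paths

variable {n f : ℕ} {I O : Finset (Fin n)}

theorem prepared_append_of_ne {pre : Pattern n f I O} {c : Command n f I O}
    (hc : ∀ i, c ≠ .prep i) (j : Fin n) : Prepared (pre ++ [c]) j ↔ Prepared pre j := by
  rw [prepared_append]
  refine or_iff_left ?_
  rintro ⟨h, hm⟩
  exact hc _ (List.mem_singleton.1 hm).symm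

theorem measured_append_of_ne {pre : Pattern n f I O} {c : Command n f I O}
    (hc : ∀ i lam α, c ≠ .measure i lam α) (j : Fin n) :
    Measured (pre ++ [c]) j ↔ Measured pre j := by
  rw [measured_append]
  refine or_iff_left ?_
  rintro ⟨h, lam, α, hm⟩
  exact hc _ _ _ (List.mem_singleton.1 hm).symm

theorem measured_append_measure {pre : Pattern n f I O} {i : {i : Fin n // i ∉ O}} {lam : Label}
    {α : ℝ} (j : Fin n) :
    Measured (pre ++ [Command.measure i lam α]) j ↔ Measured pre j ∨ j = i := by
  rw [measured_append]
  refine or_congr_right ⟨?_, ?_⟩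
  · rintro ⟨h, lam', α', hm⟩
    rw [List.mem_singleton] at hm
    cases hm
    rfl
  · rintro rfl
    exact ⟨i.2, lam, α, List.mem_singleton.2 rfl⟩

theorem prepared_append_prep {pre : Pattern n f I O} {i : {i : Fin n // i ∉ I}} (j : Fin n) :
    Prepared (pre ++ [Command.prep i]) j ↔ Prepared pre j ∨ j = i := by
  rw [prepared_append]
  refine or_congr_right ⟨?_, ?_⟩
  · rintro ⟨h, hm⟩
    rw [List.mem_singleton] at hm
    cases hm
    rfl
  · rintro rfl
    exact ⟨i.2, List.mem_singleton.2 rfl⟩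

theorem live_append_of_ne {pre : Pattern n f I O} {c : Command n f I O}
    (hc : ∀ i, c ≠ .prep i) (hc' : ∀ i lam α, c ≠ .measure i lam α) (j : Fin n) :
    Live (pre ++ [c]) j ↔ Live pre j := by
  unfold Live
  rw [prepared_append_of_ne hc, measured_append_of_ne hc']

theorem Exec.prepared_of_measured {pre post : Pattern n f I O} (h : Exec pre post)
    (H : ∀ i, Measured pre i → Prepared pre i) {i : Fin n} (hi : Measured (pre ++ post) i) :
    Prepared (pre ++ post) i := by
  induction post generalizing pre with
  | nil => simpa using H i (by simpa using hi)
  | cons c post ih =>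
    have := ih h.2 (fun j hj => ?_) (by simpa using hi)
    · simpa using this
    · rw [measured_append] at hj
      refine prepared_append.2 (Or.inl ?_)
      rcases hj with hj | ⟨hO, lam, α, hm⟩
      · exact H j hj
      · rw [List.mem_singleton] at hm
        subst hm
        exact h.1.1

theorem Exec.prepared_of_measured_nil {P : Pattern n f I O} (h : Exec [] P) {i : Fin n}
    (hi : Measured P i) : Prepared P i :=
  h.prepared_of_measured (fun _ hj => by simp [Measured] at hj) hi

/-- A basis vector that enters the remaining commands is read out as the sum of the weights of all
paths that start with its bits. -/
theorem foldl_basisVec (m : Outcomes n f O) (y : {i // i ∈ O} → Bool)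
    {pre post : Pattern n f I O} (h : Exec [] (pre ++ post)) (hp : ∀ i, Prepared (pre ++ post) i)
    (hm : ∀ i, i ∉ O → Measured (pre ++ post) i) (z : Fin n → Bool)
    (hz : ∀ i, ¬ Live pre i → z i = false) :
    post.foldl (fun ψ c => c.op m ψ) (basisVec z) (extend O y) =
      open Classical in
      ∑ b, if ∀ i, Prepared pre i → b i = z i then pathWeight m y post b else 0 := by
  classical
  induction post generalizing pre z with
  | nil =>
    simp only [List.append_nil] at hp hm
    have h1 : ∀ b : Fin n → Bool, (∀ i, Prepared pre i → b i = z i) ↔ b = z := fun b =>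
      ⟨fun hb => funext fun i => hb i (hp i), fun hb i _ => by rw [hb]⟩
    simp only [h1, Finset.sum_ite_eq', Finset.mem_univ, if_true, List.foldl_nil, basisVec,
      pathWeight, readout_eq_ite]
    refine if_congr ⟨?_, ?_⟩ rfl rfl
    · rintro rfl i
      simp [extend]
    · intro h2
      funext i
      by_cases hi : i ∈ O
      · rw [h2 ⟨i, hi⟩]; simp [extend, hi]
      · rw [hz i fun hl => hl.2 (hm i hi)]; simp [extend, hi]
  | cons c post ih =>
    obtain ⟨hc, hpost⟩ : Exec pre (c :: post) := h.append_right
    have hpre := h.of_append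
    have ih' := ih (pre := pre ++ [c]) (by simpa using h) (by simpa using hp) (by simpa using hm)
    rw [List.foldl_cons]
    cases c with
    | prep i =>
      have hzi : z i = false := hz i fun hl => hc hl.1
      have hlive : ∀ v j, ¬ Live (pre ++ [Command.prep i]) j →
          Function.update z i.1 v j = false := by
        intro v j hj
        have hji : j ≠ i := by
          rintro rfl
          refine hj ⟨(prepared_append_prep _).2 (Or.inr rfl), fun hmi => ?_⟩
          rw [measured_append_of_ne (by simp)] at hmi
          exact hc (hpre.prepared_of_measured_nil hmi)
        rw [Function.update_of_ne hji]
        refine hz j fun hl => hj ⟨(prepared_append_prep _).2 (Or.inl hl.1), ?_⟩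
        rw [measured_append_of_ne (by simp)]
        exact hl.2
      rw [op_prep_basisVec m i hzi, foldl_op_smul, foldl_op_add]
      simp only [Pi.smul_apply, Pi.add_apply, smul_eq_mul, pathWeight]
      rw [ih' _ (hlive _), ih' _ (hlive _), ← Finset.sum_add_distrib, Finset.mul_sum]
      refine Finset.sum_congr rfl fun b _ => ?_
      have hiff : ∀ v, (∀ j, Prepared (pre ++ [Command.prep i]) j →
          b j = Function.update z i.1 v j) ↔ b i = v ∧ ∀ j, Prepared pre j → b j = z j := by
        intro v
        constructor
        · intro hb
          refine ⟨by simpa using hb i ((prepared_append_prep _).2 (Or.inr rfl)), fun j hj => ?_⟩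
          rw [hb j ((prepared_append_prep _).2 (Or.inl hj)), Function.update_of_ne]
          rintro rfl; exact hc hj
        · rintro ⟨rfl, hb⟩ j hj
          by_cases hji : j = i
          · subst hji; simp
          · rw [Function.update_of_ne hji]
            exact hb j (((prepared_append_prep _).1 hj).resolve_right hji)
      simp only [hiff]
      cases b i <;> simp
    | entangle i j =>
      rw [op_entangle_basisVec, foldl_op_smul, Pi.smul_apply,
        ih' z fun l hl => hz l (by rwa [live_append_of_ne (by simp) (by simp)] at hl),
        smul_eq_mul, Finset.mul_sum]
      refine Finset.sum_congr rfl fun b _ => ?_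
      simp only [prepared_append_of_ne (c := Command.entangle i j) (by simp), pathWeight]
      split_ifs with hb
      · rw [hb i hc.2.1.1, hb j hc.2.2.1]
      · simp
    | fuse a τ c i j =>
      rw [op_fuse_basisVec, foldl_op_smul, Pi.smul_apply,
        ih' z fun l hl => hz l (by rwa [live_append_of_ne (by simp) (by simp)] at hl),
        smul_eq_mul, Finset.mul_sum]
      refine Finset.sum_congr rfl fun b _ => ?_
      simp only [prepared_append_of_ne (c := Command.fuse a τ c i j) (by simp), pathWeight]
      split_ifs with hb
      · rw [hb i hc.2.1.1, hb j hc.2.2.1.1]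
      · simp
    | measure i lam α =>
      have hcl : ∀ j, ¬ Live (pre ++ [Command.measure i lam α]) j →
          Function.update z i.1 false j = false := by
        intro j hj
        by_cases hji : j = i
        · subst hji; simp
        · rw [Function.update_of_ne hji]
          refine hz j fun hl => hj ⟨(prepared_append_of_ne (by simp) _).2 hl.1, ?_⟩
          rw [measured_append_measure, not_or]
          exact ⟨hl.2, hji⟩
      -- The operator resets the measured qubit to `|0⟩`, the paths keep its bit.
      rw [op_measure_basisVec, foldl_op_smul, Pi.smul_apply, ih' _ hcl, smul_eq_mul,
        Finset.mul_sum, ← sum_flipAt i.1 (z i)]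
      refine Finset.sum_congr rfl fun b _ => ?_
      have hiff : (∀ j, Prepared (pre ++ [Command.measure i lam α]) j →
          flipAt i.1 (z i) b j = Function.update z i.1 false j) ↔
          ∀ j, Prepared pre j → b j = z j := by
        simp only [prepared_append_of_ne (c := Command.measure i lam α) (by simp)]
        refine forall_congr' fun j => imp_congr_right fun _ => ?_
        by_cases hji : j = i
        · subst hji; simp [flipAt_self]
        · rw [Function.update_of_ne hji, flipAt_of_ne hji]
      simp only [hiff, pathWeight]
      split_ifs with hb
      · rw [hb i hc.1, pathWeight_flipAt hpost ((measured_append_measure _).2 (Or.inr rfl))]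
      · simp
    | corrX i t =>
      rw [op_corrX_basisVec, ih', ← sum_flipAt i (t.val m)]
      · refine Finset.sum_congr rfl fun b _ => ?_
        have hiff : (∀ j, Prepared (pre ++ [Command.corrX i t]) j →
            flipAt i (t.val m) b j = flipAt i (t.val m) z j) ↔
            ∀ j, Prepared pre j → b j = z j := by
          simp only [prepared_append_of_ne (c := Command.corrX i t) (by simp)]
          refine forall_congr' fun j => imp_congr_right fun _ => ?_
          by_cases hji : j = i
          · subst hji; simp [flipAt_self]
          · rw [flipAt_of_ne hji, flipAt_of_ne hji]
        simp only [hiff, pathWeight]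
      · intro j hj
        rw [live_append_of_ne (by simp) (by simp)] at hj
        rw [flipAt_of_ne (by rintro rfl; exact hj hc.1)]
        exact hz j hj
    | corrZ i t =>
      rw [op_corrZ_basisVec, foldl_op_smul, Pi.smul_apply,
        ih' z fun l hl => hz l (by rwa [live_append_of_ne (by simp) (by simp)] at hl),
        smul_eq_mul, Finset.mul_sum]
      refine Finset.sum_congr rfl fun b _ => ?_
      simp only [prepared_append_of_ne (c := Command.corrZ i t) (by simp), pathWeight]
      split_ifs with hb
      · rw [hb i hc.1.1]
      · simp

/-- The branch of a pattern as a sum over computational paths. -/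
theorem branch_eq_sum_pathWeight {P : Pattern n f I O} (hrun : P.Runnable) (m : Outcomes n f O)
    (y : {i // i ∈ O} → Bool) (x : {i // i ∈ I} → Bool) :
    P.branch m y x =
      ∑ b, if ∀ i : {i // i ∈ I}, b i = x i then pathWeight m y P b else 0 := by
  classical
  have h := foldl_basisVec m y (pre := []) (post := P) (by simpa using hrun.exec)
    (by simpa using hrun.2.1) (by simpa using hrun.2.2.1) (extend I x) (fun i hi => ?_)
  · unfold Pattern.branch
    unfold basisVec at h
    rw [h]
    refine Finset.sum_congr rfl fun b _ => if_congr ?_ rfl rfl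
    constructor
    · intro hb i
      rw [hb i (Or.inl i.2)]
      simp [extend]
    · intro hb i hi
      have hI : i ∈ I := by simpa [Prepared] using hi
      rw [hb ⟨i, hI⟩]
      simp [extend, hI]
  · have : i ∉ I := fun hI => hi ⟨Or.inl hI, by simp [Measured]⟩
    simp [extend, this]

/-! ### Pauli frames -/

theorem cz_xor (a b x y : Bool) :
    cz (a ^^ x) (b ^^ y) = cz x y * cz a b * sgn (y && a) * sgn (x && b) := by
  cases a <;> cases b <;> cases x <;> cases y <;> simp [cz]

theorem phaseS_xor (c a x : Bool) :
    phaseS c (a ^^ x) = phaseS c x * phaseS c a * sgn ((c && x) && a) := by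
  cases c <;> cases a <;> cases x <;> simp [phaseS]

theorem sgn_xor (a b : Bool) : sgn (a ^^ b) = sgn a * sgn b := by
  cases a <;> cases b <;> simp

theorem sgn_mul_self (a : Bool) : sgn a * sgn a = 1 := by cases a <;> simp

theorem norm_sgn (a : Bool) : ‖sgn a‖ = 1 := by cases a <;> simp

theorem norm_phaseS (c a : Bool) : ‖phaseS c a‖ = 1 := by cases c <;> cases a <;> simp [phaseS]

theorem norm_cz (a b : Bool) : ‖cz a b‖ = 1 := by cases a <;> cases b <;> simp [cz]

/-- `X` operators on the two qubits flip the outcome of a fusion if their number is odd. -/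
theorem fusionKraus_xor (τ : FusionType) (c κ a b x y : Bool) :
    fusionKraus τ c κ (a ^^ x) (b ^^ y) = phaseS c x * phaseS c y *
      (fusionKraus τ c (κ ^^ (x ^^ y)) a b * sgn ((c && x) && a) * sgn ((c && y) && b)) := by
  rw [fusionKraus_eq τ c κ, fusionKraus_eq τ c (κ ^^ _), phaseS_xor, phaseS_xor,
    fusionKraus_false, fusionKraus_false]
  simp only [sgn_xor]
  ring

/-- The powers of `X` in the Pauli frame after a command. -/
def stepX (m : Outcomes n f O) (x : Fin n → Bool) : Command n f I O → Fin n → Bool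
  | .corrX i t => flipAt i (t.val m) x
  | _ => x

/-- The powers of `X` in the Pauli frame after a sequence of commands. -/
def frameX (m : Outcomes n f O) : Pattern n f I O → (Fin n → Bool) → Fin n → Bool
  | [], x => x
  | c :: P, x => frameX m P (stepX m x c)

/-- The bit string with value `v` at `i` and zeros elsewhere. -/
def single (i : Fin n) (v : Bool) : Fin n → Bool := fun l => decide (l = i) && v

/-- The powers of `Z` that a command adds to the Pauli frame if the current powers of `X` are `x`
and the fusion named `a` leaves the byproducts `Z^(sA a)` and `Z^(sB a)` on its two qubits. -/
def stepZ (m : Outcomes n f O) (sA sB : Fin f → Bool) (x : Fin n → Bool) :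
    Command n f I O → Fin n → Bool
  | .entangle i j => fun l => single i (x j) l ^^ single j (x i) l
  | .fuse a _ c i j => fun l => single i (sA a ^^ (c && x i)) l ^^ single j (sB a ^^ (c && x j)) l
  | .corrZ i t => single i (t.val m)
  | _ => fun _ => false

/-- The powers of `Z` that a sequence of commands adds to the Pauli frame. -/
def frameZ (m : Outcomes n f O) (sA sB : Fin f → Bool) :
    Pattern n f I O → (Fin n → Bool) → Fin n → Bool
  | [], _ => fun _ => false
  | c :: P, x => fun l => stepZ m sA sB x c l ^^ frameZ m sA sB P (stepX m x c) l

/-- The difference between the outcome of a fusion in the pattern and the outcome of the same fusion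
if all `X`-corrections are postponed. -/
def fusionShift (m : Outcomes n f O) : Pattern n f I O → (Fin n → Bool) → Fin f → Bool
  | [], _ => fun _ => false
  | .fuse a _ _ i j :: P, x => Function.update (fusionShift m P x) a (x i ^^ x j)
  | c :: P, x => fusionShift m P (stepX m x c)

theorem prod_sgn_single (i : Fin n) (v : Bool) (b : Fin n → Bool) :
    ∏ l, sgn (single i v l && b l) = sgn (v && b i) := by
  rw [Finset.prod_eq_single i]
  · simp [single]
  · intro l _ hl; simp [single, hl]
  · simp

theorem prod_sgn_xor (z z' b : Fin n → Bool) :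
    ∏ l, sgn ((z l ^^ z' l) && b l) = (∏ l, sgn (z l && b l)) * ∏ l, sgn (z' l && b l) := by
  rw [← Finset.prod_mul_distrib]
  exact Finset.prod_congr rfl fun l _ => sgn_xor_and _ _ _

/-- The frame of a measured qubit does not change any more. -/
theorem Exec.frameX_eq {pre post : Pattern n f I O} (h : Exec pre post) {i : Fin n}
    (hi : Measured pre i) (m : Outcomes n f O) (x : Fin n → Bool) :
    frameX m post x i = x i := by
  induction post generalizing pre x with
  | nil => rfl
  | cons c post ih =>
    rw [frameX, ih h.2 (measured_append.2 (Or.inl hi))]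
    cases c with
    | corrX j t => exact flipAt_of_ne (live_of_measured_ne hi h.1.1) _ _
    | _ => rfl

/-- No powers of `Z` are added to the frame of a measured qubit. -/
theorem Exec.frameZ_eq {pre post : Pattern n f I O} (h : Exec pre post) {i : Fin n}
    (hi : Measured pre i) (m : Outcomes n f O) (sA sB : Fin f → Bool) (x : Fin n → Bool) :
    frameZ m sA sB post x i = false := by
  induction post generalizing pre x with
  | nil => rfl
  | cons c post ih =>
    simp only [frameZ]
    rw [ih h.2 (measured_append.2 (Or.inl hi)), Bool.xor_false]
    have hne : ∀ {j v}, Live pre j → single j v i = false := fun hj => by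
      simp [single, live_of_measured_ne hi hj]
    cases c with
    | entangle j k => simp [stepZ, hne h.1.2.1, hne h.1.2.2]
    | fuse a τ c j k => simp [stepZ, hne h.1.2.1, hne h.1.2.2.1]
    | corrZ j t => exact hne h.1.1
    | _ => rfl

/-- The factor of a command in the weight of a path when all corrections are postponed to the end:
`xf` are the final powers of `X`, `sh` the changes of the fusion outcomes, and the fusion named `a`
leaves byproducts `Z^(sA a)` and `Z^(sB a)`. -/
def postponedWeight (m : Outcomes n f O) (xf : Fin n → Bool) (sh sA sB : Fin f → Bool)
    (b : Fin n → Bool) : Command n f I O → ℂ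
  | .prep _ => rsqrt2
  | .entangle i j => cz (b i) (b j)
  | .fuse a τ c i j =>
      fusionKraus τ c (m.2 a ^^ sh a) (b i) (b j) * sgn (sA a && b i) * sgn (sB a && b j)
  | .measure i lam α => conj (lam.ket α (m.1 i) (b i ^^ xf i))
  | .corrX _ _ => 1
  | .corrZ _ _ => 1

/-- Up to a global phase, all corrections can be postponed to the end. -/
theorem pathWeight_eq_postponed (m : Outcomes n f O) (sA sB : Fin f → Bool)
    {pre post : Pattern n f I O} (h : Exec pre post) (x : Fin n → Bool) (sh : Fin f → Bool)
    (hsh : ∀ a, Fused post a → sh a = fusionShift m post x a) :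
    ∃ u : ℂ, ‖u‖ = 1 ∧ ∀ (y : {i // i ∈ O} → Bool) (b : Fin n → Bool),
      pathWeight m y post (fun l => b l ^^ x l) =
        u * (∏ l, sgn (frameZ m sA sB post x l && b l)) *
        (post.map (postponedWeight m (frameX m post x) sh sA sB b)).prod *
        readout y (fun l => b l ^^ frameX m post x l) := by
  induction post generalizing pre x with
  | nil => exact ⟨1, by simp, fun y b => by simp [pathWeight, frameZ, frameX]⟩
  | cons c post ih =>
    have hsh' : ∀ a, Fused post a → sh a = fusionShift m post (stepX m x c) a := by
      intro a ha
      rw [hsh a (fused_cons.2 (Or.inr ha))]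
      cases c with
      | fuse a' τ c i j =>
        have hne : a ≠ a' := by
          rintro rfl
          exact h.2.not_fused (fused_append.2 (Or.inr ⟨_, _, _, _, List.mem_singleton.2 rfl⟩)) ha
        simp [fusionShift, stepX, hne]
      | _ => rfl
    obtain ⟨u, hu, H⟩ := ih h.2 (stepX m x c) hsh'
    cases c with
    | prep i =>
      refine ⟨u, hu, fun y b => ?_⟩
      have := H y b
      simp only [stepX] at this
      simp only [pathWeight, this, frameZ, frameX, stepX, stepZ, List.map_cons, List.prod_cons,
        postponedWeight, Bool.false_xor]
      ring
    | entangle i j =>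
      refine ⟨cz (x i) (x j) * u, by simp [norm_cz, hu], fun y b => ?_⟩
      have := H y b
      simp only [stepX] at this
      simp only [pathWeight, this, frameZ, frameX, stepX, stepZ, List.map_cons, List.prod_cons,
        postponedWeight, prod_sgn_xor, prod_sgn_single, cz_xor]
      ring
    | fuse a τ c i j =>
      refine ⟨phaseS c (x i) * phaseS c (x j) * u, by simp [norm_phaseS, hu], fun y b => ?_⟩
      have := H y b
      simp only [stepX] at this
      have hs : sh a = (x i ^^ x j) := by
        rw [hsh a (fused_cons.2 (Or.inl ⟨_, _, _, _, List.mem_singleton.2 rfl⟩))]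
        simp [fusionShift]
      simp only [pathWeight, this, frameZ, frameX, stepX, stepZ, List.map_cons, List.prod_cons,
        postponedWeight, prod_sgn_xor, prod_sgn_single, fusionKraus_xor, hs]
      rw [sgn_xor_and, sgn_xor_and]
      cases sA a && b i <;> cases sB a && b j <;> simp only [sgn_true, sgn_false] <;> ring
    | measure i lam α =>
      refine ⟨u, hu, fun y b => ?_⟩
      have := H y b
      simp only [stepX] at this
      simp only [pathWeight, this, frameZ, frameX, stepX, stepZ, List.map_cons, List.prod_cons,
        postponedWeight, Bool.false_xor,
        h.2.frameX_eq ((measured_append_measure _).2 (Or.inr rfl))]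
      ring
    | corrX i t =>
      refine ⟨u, hu, fun y b => ?_⟩
      have := H y b
      simp only [pathWeight, frameZ, frameX, stepZ, List.map_cons, List.prod_cons,
        postponedWeight, Bool.false_xor, one_mul]
      rw [← this]
      congr 1
      funext l
      by_cases hl : l = i
      · subst hl; simp [stepX, flipAt_self]
      · simp [stepX, flipAt_of_ne hl]
    | corrZ i t =>
      refine ⟨sgn (t.val m && x i) * u, by simp [norm_sgn, hu], fun y b => ?_⟩
      have := H y b
      simp only [stepX] at this
      have hs : sgn (t.val m && (b i ^^ x i)) = sgn (t.val m && x i) * sgn (t.val m && b i) := by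
        cases t.val m <;> cases b i <;> cases x i <;> simp
      simp only [pathWeight, this, frameZ, frameX, stepX, stepZ, List.map_cons, List.prod_cons,
        postponedWeight, prod_sgn_xor, prod_sgn_single, hs]
      ring

end Paths

section Causality

variable {n f : ℕ} {I O : Finset (Fin n)}

/-! ### Causality of the Pauli frame -/

/-- The outcomes obtained by the commands `pre` are the same in `m` and `m'`. -/
def Agree (pre : Pattern n f I O) (m m' : Outcomes n f O) : Prop :=
  (∀ i : {i : Fin n // i ∉ O}, Measured pre i → m.1 i = m'.1 i) ∧ ∀ a, Fused pre a → m.2 a = m'.2 a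

theorem Agree.of_append {p q : Pattern n f I O} {m m' : Outcomes n f O} (h : Agree (p ++ q) m m') :
    Agree p m m' :=
  ⟨fun i hi => h.1 i (measured_append.2 (Or.inl hi)),
    fun a ha => h.2 a (fused_append.2 (Or.inl ha))⟩

theorem Signal.Known.val_congr {pre : Pattern n f I O} {t : Signal n f O} (ht : t.Known pre)
    {m m' : Outcomes n f O} (h : Agree pre m m') : t.val m = t.val m' := by
  have h1 : (t.meas.filter fun i => m.1 i = true) = t.meas.filter fun i => m'.1 i = true :=
    Finset.filter_congr fun i hi => by rw [h.1 i (ht.1 i hi)]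
  have h2 : (t.fus.filter fun a => m.2 a = true) = t.fus.filter fun a => m'.2 a = true :=
    Finset.filter_congr fun a ha => by rw [h.2 a (ht.2 a ha)]
  unfold Signal.val
  rw [h1, h2]

theorem frameX_append (m : Outcomes n f O) (p q : Pattern n f I O) (x : Fin n → Bool) :
    frameX m (p ++ q) x = frameX m q (frameX m p x) := by
  induction p generalizing x with
  | nil => rfl
  | cons c p ih => exact ih _

theorem frameZ_append (m : Outcomes n f O) (sA sB : Fin f → Bool) (p q : Pattern n f I O)
    (x : Fin n → Bool) (l : Fin n) : frameZ m sA sB (p ++ q) x l =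
      (frameZ m sA sB p x l ^^ frameZ m sA sB q (frameX m p x) l) := by
  induction p generalizing x with
  | nil => simp [frameZ, frameX]
  | cons c p ih => simp only [List.cons_append, frameZ, frameX, ih, Bool.xor_assoc]

theorem Exec.ne_of_fused {pre post : Pattern n f I O} {a a' : Fin f} {τ : FusionType} {c : Bool}
    {i j : Fin n} (h : Exec pre (.fuse a τ c i j :: post)) (ha : Fused post a') : a' ≠ a := by
  rintro rfl
  exact h.2.not_fused (fused_append.2 (Or.inr ⟨_, _, _, _, List.mem_singleton.2 rfl⟩)) ha

theorem Exec.fusionShift_append {pre p q : Pattern n f I O} (h : Exec pre (p ++ q)) {a : Fin f}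
    (ha : Fused p a) (m : Outcomes n f O) (x : Fin n → Bool) :
    fusionShift m (p ++ q) x a = fusionShift m p x a := by
  induction p generalizing pre x with
  | nil => simp [Fused] at ha
  | cons c p ih =>
    rw [fused_cons] at ha
    cases c with
    | fuse a' τ c i j =>
      by_cases haa : a = a'
      · subst haa; simp [fusionShift]
      · have ha' : Fused p a := ha.resolve_left (by simp [Fused, haa])
        simp [fusionShift, haa, ih h.2 ha']
    | _ => exact ih h.2 (ha.resolve_left (by simp [Fused])) _

/-- The outcomes of the pattern and the frame after the commands `p` are determined by the outcomes
that are found for `p` when all corrections are postponed. -/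
theorem Exec.agree_of_postponed {pre p : Pattern n f I O} (h : Exec pre p)
    {m m' : Outcomes n f O} (hpre : Agree pre m m') (x : Fin n → Bool)
    (h₁ : ∀ i : {i : Fin n // i ∉ O}, Measured p i → m.1 i = m'.1 i)
    (h₂ : ∀ a, Fused p a →
      (m.2 a ^^ fusionShift m p x a) = (m'.2 a ^^ fusionShift m' p x a)) :
    Agree (pre ++ p) m m' ∧ frameX m p x = frameX m' p x ∧
      ∀ sA sA' sB sB' : Fin f → Bool, (∀ a, Fused p a → sA a = sA' a ∧ sB a = sB' a) →
        frameZ m sA sB p x = frameZ m' sA' sB' p x := by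
  induction p generalizing pre x with
  | nil => exact ⟨by simpa using hpre, rfl, fun _ _ _ _ _ => rfl⟩
  | cons c p ih =>
    have hfst : (∀ i, Fused [c] i → m.2 i = m'.2 i) := by
      rintro a ⟨τ, c', i, j, hc⟩
      rw [List.mem_singleton] at hc
      subst hc
      have := h₂ a ⟨_, _, _, _, List.mem_cons_self⟩
      simpa [fusionShift] using this
    have hpre' : Agree (pre ++ [c]) m m' := by
      constructor
      · intro i hi
        rcases measured_append.1 hi with hi | hi
        · exact hpre.1 i hi
        · exact h₁ i (measured_cons.2 (Or.inl hi))
      · intro a ha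
        rcases fused_append.1 ha with ha | ha
        · exact hpre.2 a ha
        · exact hfst a ha
    have hx : stepX m x c = stepX m' x c := by
      cases c with
      | corrX i t => simp only [stepX, h.1.2.val_congr hpre]
      | _ => rfl
    have hs : ∀ a, Fused p a → (m.2 a ^^ fusionShift m p (stepX m x c) a) =
        (m'.2 a ^^ fusionShift m' p (stepX m x c) a) := by
      intro a ha
      have := h₂ a (fused_cons.2 (Or.inr ha))
      cases c with
      | fuse a' τ c i j => simpa [fusionShift, h.ne_of_fused ha, stepX] using this
      | corrX i t => simpa only [fusionShift, hx] using this
      | _ => exact this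
    obtain ⟨ih₁, ih₂, ih₃⟩ := ih h.2 hpre' (stepX m x c)
      (fun i hi => h₁ i (measured_cons.2 (Or.inr hi))) hs
    refine ⟨by simpa using ih₁, by rw [frameX, frameX, ih₂, hx], fun sA sA' sB sB' hab => ?_⟩
    have hz := ih₃ sA sA' sB sB' fun a ha => hab a (fused_cons.2 (Or.inr ha))
    have hstep : stepZ m sA sB x c = stepZ m' sA' sB' x c := by
      cases c with
      | corrZ i t => simp only [stepZ, h.1.2.val_congr hpre]
      | fuse a τ c i j =>
        have := hab a ⟨_, _, _, _, List.mem_cons_self⟩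
        simp only [stepZ, this.1, this.2]
      | _ => rfl
    rw [frameZ, frameZ, hz, hstep, hx]

/-- The outcomes that are found when all corrections of the pattern are postponed to the end, for
given outcomes of the pattern. -/
def Pattern.rawOutcomes (P : Pattern n f I O) (m : Outcomes n f O) : Outcomes n f O :=
  (m.1, fun a => m.2 a ^^ fusionShift m P (fun _ => false) a)

/-- The outcomes of the pattern can be recovered from the raw outcomes, since the correction that
shifts an outcome depends on earlier outcomes only. -/
theorem Pattern.Runnable.rawOutcomes_bijective {P : Pattern n f I O} (h : P.Runnable) :
    Function.Bijective P.rawOutcomes := by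
  refine Finite.injective_iff_bijective.1 fun m m' hm => ?_
  simp only [Pattern.rawOutcomes, Prod.mk.injEq] at hm
  have := (h.exec.agree_of_postponed (m := m) (m' := m') ⟨by simp [Measured], by simp [Fused]⟩
    (fun _ => false) (fun i _ => by rw [hm.1]) fun a _ => congrFun hm.2 a).1
  simp only [List.nil_append] at this
  exact Prod.ext (funext fun i => this.1 i (h.2.2.1 i i.2)) (funext fun a => this.2 a (h.2.2.2 a))

/-- The number of commands up to the measurement of qubit `i`. -/
def Pattern.measureTime (P : Pattern n f I O) (i : Fin n) : ℕ := sInf {t | Measured (P.take t) i}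

/-- The number of commands up to the fusion named `a`. -/
def Pattern.fuseTime (P : Pattern n f I O) (a : Fin f) : ℕ := sInf {t | Fused (P.take t) a}

theorem Pattern.measureTime_pos {P : Pattern n f I O} {i : Fin n} (h : Measured P i) :
    0 < P.measureTime i := by
  have : P.measureTime i ∈ {t | Measured (P.take t) i} :=
    Nat.sInf_mem ⟨P.length, by simpa using h⟩
  rcases Nat.eq_zero_or_pos (P.measureTime i) with h0 | h0
  · rw [h0] at this; simp [Measured] at this
  · exact h0

theorem Pattern.measureTime_le {p q : Pattern n f I O} {i : Fin n} (h : Measured p i) :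
    Pattern.measureTime (p ++ q) i ≤ p.length := Nat.sInf_le (by simpa using h)

theorem Pattern.fuseTime_le {p q : Pattern n f I O} {a : Fin f} (h : Fused p a) :
    Pattern.fuseTime (p ++ q) a ≤ p.length := Nat.sInf_le (by simpa using h)

/-- The final Pauli frame of a measured qubit is determined by what is found before its measurement
when all corrections are postponed. -/
theorem Pattern.Runnable.frame_congr {P : Pattern n f I O} (h : P.Runnable)
    {i : Fin n} (hi : Measured P i) {m m' : Outcomes n f O} {sA sA' sB sB' : Fin f → Bool}
    (h₁ : ∀ j : {j : Fin n // j ∉ O}, P.measureTime j < P.measureTime i →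
      (P.rawOutcomes m).1 j = (P.rawOutcomes m').1 j)
    (h₂ : ∀ a, P.fuseTime a < P.measureTime i →
      (P.rawOutcomes m).2 a = (P.rawOutcomes m').2 a ∧ sA a = sA' a ∧ sB a = sB' a) :
    frameX m P (fun _ => false) i = frameX m' P (fun _ => false) i ∧
      frameZ m sA sB P (fun _ => false) i = frameZ m' sA' sB' P (fun _ => false) i := by
  obtain ⟨hO, lam, α, hmem⟩ := hi
  obtain ⟨p, q, hP⟩ := List.append_of_mem hmem
  have hex := h.exec
  have hP' : P = (p ++ [Command.measure ⟨i, hO⟩ lam α]) ++ q := by simp [hP]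
  have hex' := hex
  rw [hP'] at hex'
  have hpm : ¬ Measured p i := fun hp =>
    (hP ▸ hex).append_right.not_measured (by simpa using hp) ⟨hO, lam, α, List.mem_cons_self⟩
  have htime : p.length < P.measureTime i := by
    by_contra hle
    have hmem' : P.measureTime i ∈ {t | Measured (P.take t) i} :=
      Nat.sInf_mem ⟨P.length, by simpa using ⟨hO, lam, α, hmem⟩⟩
    rw [Set.mem_ofPred_eq, hP, List.take_append_of_le_length (by rw [← hP]; omega)] at hmem'
    obtain ⟨h1, lam', α', h2⟩ := hmem'
    exact hpm ⟨h1, lam', α', List.mem_of_mem_take h2⟩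
  have hexp : Exec [] (p ++ Command.measure ⟨i, hO⟩ lam α :: q) := hP ▸ hex
  obtain ⟨-, hx, hz⟩ := hexp.of_append.agree_of_postponed (m := m) (m' := m')
    ⟨by simp [Measured], by simp [Fused]⟩ (fun _ => false)
    (fun j hj => h₁ j (lt_of_le_of_lt (hP ▸ Pattern.measureTime_le hj) htime)) (fun a ha => by
      have := (h₂ a (lt_of_le_of_lt (hP ▸ Pattern.fuseTime_le ha) htime)).1
      simp only [Pattern.rawOutcomes] at this
      rw [hP, hexp.fusionShift_append ha, hexp.fusionShift_append ha] at this
      exact this)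
  have hz' := hz sA sA' sB sB' fun a ha =>
    (h₂ a (lt_of_le_of_lt (hP ▸ Pattern.fuseTime_le ha) htime)).2
  have hq : Exec (p ++ [Command.measure ⟨i, hO⟩ lam α]) q := by simpa using hex'.append_right
  have hmeas : Measured (p ++ [Command.measure ⟨i, hO⟩ lam α]) i :=
    (measured_append_measure _).2 (Or.inr rfl)
  rw [hP']
  constructor
  · rw [frameX_append m, hq.frameX_eq hmeas, frameX_append m, frameX_append m',
      hq.frameX_eq hmeas, frameX_append m', hx]
    rfl
  · rw [frameZ_append m, hq.frameZ_eq hmeas, frameZ_append m, frameZ_append m',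
      hq.frameZ_eq hmeas, frameZ_append m', hz', hx]
    rfl

end Causality

section TracePreservation

variable {n f : ℕ} {I O : Finset (Fin n)}

/-! ### Products over the commands of a pattern -/

/-- A weight of commands, given by one function for each kind. -/
def commandWeight {R : Type*} [CommMonoid R] (wP : R) (wE : Fin n → Fin n → R)
    (wF : Fin f → FusionType → Bool → Fin n → Fin n → R)
    (wM : {i : Fin n // i ∉ O} → Label → ℝ → R) : Command n f I O → R
  | .prep _ => wP
  | .entangle i j => wE i j
  | .fuse a τ c i j => wF a τ c i j
  | .measure i lam α => wM i lam α
  | .corrX _ _ => 1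
  | .corrZ _ _ => 1

/-- The entangling part of a product of weights over a pattern. -/
def entangleProd {R : Type*} [CommMonoid R] (wE : Fin n → Fin n → R) : Pattern n f I O → R
  | [] => 1
  | .entangle i j :: P => wE i j * entangleProd wE P
  | _ :: P => entangleProd wE P

theorem prod_ite_or_eq {ι R : Type*} [Fintype ι] [CommMonoid R] (a : ι) (p : ι → Prop)
    [DecidablePred p] {_ : DecidablePred fun i => i = a ∨ p i} (hp : ¬ p a) (W : ι → R) :
    ∏ i, (if i = a ∨ p i then W i else 1) = W a * ∏ i, if p i then W i else 1 := by
  classical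
  have : ∀ i, (if i = a ∨ p i then W i else 1) =
      (if i = a then W i else 1) * if p i then W i else 1 := by
    intro i
    by_cases h : i = a
    · subst h; simp [hp]
    · simp [h]
  simp_rw [this, Finset.prod_mul_distrib]
  simp

open Classical in
/-- The product of the weights of executable commands, sorted by the kind of the commands. -/
theorem Exec.prod_commandWeight_aux {R : Type*} [CommMonoid R] {wP : R} {wE : Fin n → Fin n → R}
    {wF : Fin f → FusionType → Bool → Fin n → Fin n → R}
    {wM : {i : Fin n // i ∉ O} → Label → ℝ → R} {WF : Fin f → R} {WM : {i : Fin n // i ∉ O} → R}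
    {pre post : Pattern n f I O} (h : Exec pre post)
    (hF : ∀ a τ c i j, Command.fuse a τ c i j ∈ post → wF a τ c i j = WF a)
    (hM : ∀ i lam α, Command.measure i lam α ∈ post → wM i lam α = WM i) :
    (post.map (commandWeight wP wE wF wM)).prod =
      (∏ i : {i : Fin n // i ∉ I}, if Command.prep i ∈ post then wP else 1) *
      entangleProd wE post * (∏ a, if Fused post a then WF a else 1) *
      ∏ i : {i : Fin n // i ∉ O}, if Measured post i then WM i else 1 := by
  induction post generalizing pre with
  | nil => simp [entangleProd, Fused, Measured]
  | cons c post ih =>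
    rw [List.map_cons, List.prod_cons, ih h.2
      (fun a τ c i j hm => hF a τ c i j (List.mem_cons_of_mem _ hm))
      (fun i lam α hm => hM i lam α (List.mem_cons_of_mem _ hm))]
    have hm : ∀ j, Measured (c :: post) j ↔ Measured [c] j ∨ Measured post j :=
      fun j => measured_cons
    have hf : ∀ a, Fused (c :: post) a ↔ Fused [c] a ∨ Fused post a := fun a => fused_cons
    simp only [hm, hf, List.mem_cons]
    clear hm hf
    cases c with
    | prep i =>
      have hi : Command.prep i ∉ post :=
        h.2.not_prepared ((prepared_append_prep _).2 (Or.inr rfl)) i.2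
      have h1 : ∀ j, Measured [(Command.prep i : Command n f I O)] j ↔ False := by simp [Measured]
      have h2 : ∀ a, Fused [(Command.prep i : Command n f I O)] a ↔ False := by simp [Fused]
      simp only [h1, h2, false_or, commandWeight, entangleProd, Command.prep.injEq]
      rw [prod_ite_or_eq i (fun j => Command.prep j ∈ post) hi (fun _ => wP)]
      simp only [mul_assoc]
    | entangle i j =>
      have h1 : ∀ l, Measured [(Command.entangle i j : Command n f I O)] l ↔ False := by
        simp [Measured]
      have h2 : ∀ a, Fused [(Command.entangle i j : Command n f I O)] a ↔ False := by simp [Fused]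
      simp only [h1, h2, false_or, commandWeight, entangleProd, reduceCtorEq]
      simp only [mul_assoc, mul_left_comm]
    | fuse a τ c i j =>
      have ha : ¬ Fused post a := fun ha => h.ne_of_fused ha rfl
      have h1 : ∀ l, Measured [(Command.fuse a τ c i j : Command n f I O)] l ↔ False := by
        simp [Measured]
      have h2 : ∀ a', Fused [(Command.fuse a τ c i j : Command n f I O)] a' ↔ a' = a := by
        simp [Fused]
      simp only [h1, h2, false_or, commandWeight, entangleProd, reduceCtorEq]
      rw [prod_ite_or_eq a (fun a => Fused post a) ha, hF a τ c i j List.mem_cons_self]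
      simp only [mul_assoc, mul_left_comm]
    | measure i lam α =>
      have hi : ¬ Measured post i := h.2.not_measured ((measured_append_measure _).2 (Or.inr rfl))
      have h1 : ∀ l : {i : Fin n // i ∉ O},
          Measured [(Command.measure i lam α : Command n f I O)] l ↔ l = i := by
        intro l
        simpa [Subtype.ext_iff, Measured] using
          measured_append_measure (pre := ([] : Pattern n f I O)) (i := i) (lam := lam) (α := α) l
      have h2 : ∀ a', Fused [(Command.measure i lam α : Command n f I O)] a' ↔ False := by
        simp [Fused]
      simp only [h1, h2, false_or, commandWeight, entangleProd, reduceCtorEq]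
      rw [prod_ite_or_eq i (fun i : {i : Fin n // i ∉ O} => Measured post i.1) hi,
        hM i lam α List.mem_cons_self]
      simp only [mul_left_comm]
    | corrX i t =>
      have h1 : ∀ l, Measured [(Command.corrX i t : Command n f I O)] l ↔ False := by
        simp [Measured]
      have h2 : ∀ a, Fused [(Command.corrX i t : Command n f I O)] a ↔ False := by simp [Fused]
      simp only [h1, h2, false_or, commandWeight, entangleProd, reduceCtorEq, one_mul]
    | corrZ i t =>
      have h1 : ∀ l, Measured [(Command.corrZ i t : Command n f I O)] l ↔ False := by
        simp [Measured]
      have h2 : ∀ a, Fused [(Command.corrZ i t : Command n f I O)] a ↔ False := by simp [Fused]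
      simp only [h1, h2, false_or, commandWeight, entangleProd, reduceCtorEq, one_mul]

/-- In a runnable pattern every non-input qubit is prepared once, every non-output qubit is measured
once, and every fusion is done once. -/
theorem Pattern.Runnable.prod_commandWeight {R : Type*} [CommMonoid R] {wP : R}
    {wE : Fin n → Fin n → R} {wF : Fin f → FusionType → Bool → Fin n → Fin n → R}
    {wM : {i : Fin n // i ∉ O} → Label → ℝ → R} {WF : Fin f → R} {WM : {i : Fin n // i ∉ O} → R}
    {P : Pattern n f I O} (h : P.Runnable)
    (hF : ∀ a τ c i j, Command.fuse a τ c i j ∈ P → wF a τ c i j = WF a)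
    (hM : ∀ i lam α, Command.measure i lam α ∈ P → wM i lam α = WM i) :
    (P.map (commandWeight wP wE wF wM)).prod =
      wP ^ (n - I.card) * entangleProd wE P * (∏ a, WF a) * ∏ i, WM i := by
  classical
  rw [h.exec.prod_commandWeight_aux hF hM]
  have h1 : ∀ i : {i : Fin n // i ∉ I}, Command.prep i ∈ P := fun i =>
    ((h.2.1 i).resolve_left i.2).2
  have h2 : ∀ i : {i : Fin n // i ∉ O}, Measured P i := fun i => h.2.2.1 i i.2
  simp [h1, h2, h.2.2.2]

/-! ### The branches of a pattern form an instrument -/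

/-- The squared norm of an amplitude vector. -/
def normSq {ι : Type} [Fintype ι] [DecidableEq ι] (ψ : Vec ι) : ℝ := ∑ z, ‖ψ z‖ ^ 2

/-- Two sums over bit strings agree if they agree for every choice of the bits other than `i`. -/
theorem sum_eq_of_pair (i : Fin n) (F G : (Fin n → Bool) → ℝ)
    (h : ∀ z, F (Function.update z i false) + F (Function.update z i true) =
      G (Function.update z i false) + G (Function.update z i true)) : ∑ z, F z = ∑ z, G z := by
  have key : ∀ F : (Fin n → Bool) → ℝ, 2 * ∑ z, F z =
      ∑ z, (F (Function.update z i false) + F (Function.update z i true)) := by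
    intro F
    have : ∀ z, F (Function.update z i false) + F (Function.update z i true) =
        F z + F (flipAt i true z) := by
      intro z
      cases hz : z i
      · have h1 : Function.update z i false = z := by rw [← hz]; simp
        simp [flipAt, hz, h1]
      · have h1 : Function.update z i true = z := by rw [← hz]; simp
        simp [flipAt, hz, h1, add_comm]
    simp_rw [this]
    rw [Finset.sum_add_distrib, sum_flipAt]
    ring
  have := key F
  have := key G
  simp_rw [h] at *
  linarith

theorem norm_rsqrt2_sq : ‖rsqrt2‖ ^ 2 = 1 / 2 := by
  rw [sq, ← norm_mul, rsqrt2_mul_self]; simp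

theorem norm_sq_hadamard (u w : ℂ) :
    ‖rsqrt2 * (u + w)‖ ^ 2 + ‖rsqrt2 * (u - w)‖ ^ 2 = ‖u‖ ^ 2 + ‖w‖ ^ 2 := by
  have := parallelogram_law_with_norm ℝ u w
  rw [norm_mul, norm_mul, mul_pow, mul_pow, norm_rsqrt2_sq]
  nlinarith

theorem norm_exp_conj (α : ℝ) : ‖conj (Complex.exp (α * Complex.I))‖ = 1 := by
  rw [RCLike.norm_conj, Complex.norm_exp_ofReal_mul_I]

/-- The two states of a measurement basis are orthonormal. -/
theorem Label.sum_norm_sq (lam : Label) (α : ℝ) (p q : ℂ) :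
    ‖conj (lam.ket α false false) * p + conj (lam.ket α false true) * q‖ ^ 2 +
      ‖conj (lam.ket α true false) * p + conj (lam.ket α true true) * q‖ ^ 2 =
      ‖p‖ ^ 2 + ‖q‖ ^ 2 := by
  have hX : ∀ p q : ℂ, ‖conj (ketX false false) * p + conj (ketX false true) * q‖ ^ 2 +
      ‖conj (ketX true false) * p + conj (ketX true true) * q‖ ^ 2 = ‖p‖ ^ 2 + ‖q‖ ^ 2 := by
    intro p q
    rw [← norm_sq_hadamard p q]
    simp only [ketX, ketZ, map_mul, conj_rsqrt2]
    congr 3 <;> simp <;> ring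
  have hY : ∀ p q : ℂ, ‖conj (ketY false false) * p + conj (ketY false true) * q‖ ^ 2 +
      ‖conj (ketY true false) * p + conj (ketY true true) * q‖ ^ 2 = ‖p‖ ^ 2 + ‖q‖ ^ 2 := by
    intro p q
    have : ‖-Complex.I * q‖ ^ 2 = ‖q‖ ^ 2 := by simp
    rw [← this, ← norm_sq_hadamard p]
    simp only [ketY, ketZ, map_mul, conj_rsqrt2]
    congr 3 <;> simp <;> ring
  have hE := norm_exp_conj α
  cases lam with
  | X => exact hX p q
  | Y => exact hY p q
  | Z => simp [Label.ket, ketZ]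
  | XY =>
    have : ‖conj (Complex.exp (α * Complex.I)) * q‖ ^ 2 = ‖q‖ ^ 2 := by rw [norm_mul, hE, one_mul]
    rw [← this, ← norm_sq_hadamard p]
    simp only [Label.ket, ketZ, map_mul, map_add, conj_rsqrt2]
    generalize conj (Complex.exp (α * Complex.I)) = e
    congr 3 <;> simp <;> ring
  | YZ =>
    have : ‖conj (Complex.exp (α * Complex.I)) *
        (conj (ketX true false) * p + conj (ketX true true) * q)‖ ^ 2 =
        ‖conj (ketX true false) * p + conj (ketX true true) * q‖ ^ 2 := by
      rw [norm_mul, hE, one_mul]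
    rw [← hX p q, ← this,
      ← norm_sq_hadamard (conj (ketX false false) * p + conj (ketX false true) * q)]
    simp only [Label.ket, map_mul, map_add, conj_rsqrt2]
    generalize conj (Complex.exp (α * Complex.I)) = e
    congr 3 <;> simp <;> ring
  | XZ =>
    have : ‖conj (Complex.exp (α * Complex.I)) *
        (conj (ketY true false) * p + conj (ketY true true) * q)‖ ^ 2 =
        ‖conj (ketY true false) * p + conj (ketY true true) * q‖ ^ 2 := by
      rw [norm_mul, hE, one_mul]
    rw [← hY p q, ← this,
      ← norm_sq_hadamard (conj (ketY false false) * p + conj (ketY false true) * q)]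
    simp only [Label.ket, map_mul, map_add, conj_rsqrt2]
    generalize conj (Complex.exp (α * Complex.I)) = e
    congr 3 <;> simp <;> ring

theorem fusionKraus_sum_norm_sq (τ : FusionType) (c a b : Bool) :
    ‖fusionKraus τ c false a b‖ ^ 2 + ‖fusionKraus τ c true a b‖ ^ 2 = 1 := by
  rw [fusionKraus_eq τ c false, fusionKraus_eq τ c true, norm_mul, norm_mul _ (_ * _), norm_mul,
    norm_phaseS, norm_phaseS, mul_one, mul_one, mul_one, fusionKraus_false, fusionKraus_false]
  have := parallelogram_law_with_norm ℝ (1 : ℂ) (fusionPhase τ * (sgn a * sgn b))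
  rw [norm_mul (fusionPhase τ), norm_mul (sgn a), norm_fusionPhase, norm_sgn, norm_sgn] at this
  simp only [sgn_false, sgn_true, one_mul, neg_mul, norm_mul, mul_pow, ← sub_eq_add_neg]
  norm_num at this ⊢
  nlinarith

theorem sum_eq_half_of_involutive {ι : Type*} [Fintype ι] (σ : ι → ι)
    (hσ : Function.Involutive σ) (g h : ι → ℝ) (H : ∀ m, g m + g (σ m) = h m) :
    ∑ m, g m = 1 / 2 * ∑ m, h m := by
  have : ∑ m, g (σ m) = ∑ m, g m := Equiv.sum_comp hσ.toPerm g
  simp_rw [← H]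
  rw [Finset.sum_add_distrib, this]
  ring

/-- The factor by which a command changes the sum over all outcomes of the squared norms: a
measurement and a fusion have two outcomes each. -/
def halfWeight : Command n f I O → ℝ :=
  commandWeight 1 (fun _ _ => 1) (fun _ _ _ _ _ => 1 / 2) fun _ _ _ => 1 / 2

/-- An allowed command acts as told by the outcomes obtained so far and its own one. -/
theorem Command.Allowed.op_congr {pre : Pattern n f I O} {c : Command n f I O}
    (hc : c.Allowed pre) {m m' : Outcomes n f O} (h : Agree (pre ++ [c]) m m') :
    c.op m = c.op m' := by
  funext ψ
  cases c with
  | fuse a τ c i j =>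
    have := h.2 a (fused_append.2 (Or.inr ⟨_, _, _, _, List.mem_singleton.2 rfl⟩))
    simp only [Command.op, this]
  | measure i lam α =>
    have := h.1 i ((measured_append_measure _).2 (Or.inr rfl))
    simp only [Command.op, this]
  | corrX i t => simp only [Command.op, hc.2.val_congr h.of_append]
  | corrZ i t => simp only [Command.op, hc.2.val_congr h.of_append]
  | _ => rfl

/-- Qubits that are not in use are kept in the state `|0⟩`. -/
def Supported (pre : Pattern n f I O) (ψ : Vec (Fin n)) : Prop :=
  ∀ z i, ¬ Live pre i → z i = true → ψ z = 0

theorem Supported.sum_eq_zero {pre : Pattern n f I O} {ψ : Vec (Fin n)} (h : Supported pre ψ)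
    (A : Bool → ℂ) {i j : Fin n} (hij : j ≠ i) (hj : ¬ Live pre j) {z : Fin n → Bool}
    (hz : z j = true) : ∑ b, A b * ψ (Function.update z i b) = 0 := by
  refine Finset.sum_eq_zero fun b _ => ?_
  rw [h _ j hj (by rw [Function.update_of_ne hij, hz]), mul_zero]

theorem Supported.op {pre : Pattern n f I O} (hpre : Exec [] pre) {c : Command n f I O}
    (hc : c.Allowed pre) {ψ : Vec (Fin n)} (h : Supported pre ψ) (m : Outcomes n f O) :
    Supported (pre ++ [c]) (c.op m ψ) := by
  intro z j hj hz
  cases c with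
  | prep i =>
    rw [Live, prepared_append_prep, measured_append_of_ne (by simp)] at hj
    by_cases hji : j = i
    · have hm : Measured pre j := by
        by_contra hm
        exact hj ⟨Or.inr hji, hm⟩
      rw [hji] at hm
      exact absurd (hpre.prepared_of_measured_nil hm) hc
    · simp only [Command.op, apply1]
      exact h.sum_eq_zero _ hji (fun hl => hj ⟨Or.inl hl.1, hl.2⟩) hz
  | entangle i k =>
    rw [live_append_of_ne (by simp) (by simp)] at hj
    simp [Command.op, applyDiag2, h z j hj hz]
  | fuse a τ c i k =>
    rw [live_append_of_ne (by simp) (by simp)] at hj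
    simp [Command.op, applyDiag2, h z j hj hz]
  | measure i lam α =>
    by_cases hji : j = i
    · subst hji
      simp [Command.op, apply1, hz, ketZ]
    · simp only [Command.op, apply1]
      refine h.sum_eq_zero _ hji (fun hl => hj ⟨(prepared_append_of_ne (by simp) _).2 hl.1, ?_⟩) hz
      rw [measured_append_measure, not_or]
      exact ⟨hl.2, hji⟩
  | corrX i t =>
    rw [live_append_of_ne (by simp) (by simp)] at hj
    exact h.sum_eq_zero _ (by rintro rfl; exact hj hc.1) hj hz
  | corrZ i t =>
    rw [live_append_of_ne (by simp) (by simp)] at hj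
    exact h.sum_eq_zero _ (by rintro rfl; exact hj hc.1) hj hz

/-- Flip the outcome of the measurement of qubit `i`. -/
def flipMeasure (i : {i : Fin n // i ∉ O}) (m : Outcomes n f O) : Outcomes n f O :=
  (Function.update m.1 i (!m.1 i), m.2)

/-- Flip the outcome of the fusion named `a`. -/
def flipFusion (a : Fin f) (m : Outcomes n f O) : Outcomes n f O :=
  (m.1, Function.update m.2 a (!m.2 a))

/-- For two outcomes that differ only in the bit of a measurement or fusion, the states before it
agree, and the squared norms after it add up to the squared norm of the common state. -/
theorem sum_normSq_op {pre : Pattern n f I O} {c : Command n f I O}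
    (hc : c.Allowed pre) (ψ : Outcomes n f O → Vec (Fin n))
    (h₁ : ∀ m m', Agree pre m m' → ψ m = ψ m') (h₂ : ∀ m, Supported pre (ψ m)) :
    ∑ m, normSq (c.op m (ψ m)) = halfWeight c * ∑ m, normSq (ψ m) := by
  cases c with
  | prep i =>
    simp only [halfWeight, commandWeight, one_mul]
    refine Finset.sum_congr rfl fun m _ => sum_eq_of_pair i.1 _ _ fun z => ?_
    have h0 := h₂ m (Function.update z i.1 true) i.1 (fun hl => hc hl.1) (by simp)
    simp only [Command.op, apply1, Fintype.sum_bool, Function.update_self,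
      Function.update_idem, h0]
    simp [ketX, ketZ, mul_pow, norm_rsqrt2_sq]
    ring
  | entangle i j =>
    simp only [halfWeight, commandWeight, one_mul]
    refine Finset.sum_congr rfl fun m _ => Finset.sum_congr rfl fun z _ => ?_
    simp [Command.op, applyDiag2, norm_cz]
  | fuse a τ c i j =>
    have hinv : Function.Involutive (flipFusion (n := n) (O := O) a) := fun m => by
      simp [flipFusion]
    refine sum_eq_half_of_involutive _ hinv _ _ fun m => ?_
    have hψ : ψ (flipFusion a m) = ψ m := h₁ _ _ ⟨fun _ _ => rfl, fun a' ha' => by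
      have : a' ≠ a := by rintro rfl; exact hc.2.2.2 ha'
      simp [flipFusion, this]⟩
    rw [hψ]
    simp only [normSq]
    rw [← Finset.sum_add_distrib]
    refine Finset.sum_congr rfl fun z _ => ?_
    have := fusionKraus_sum_norm_sq τ c (z i) (z j)
    simp only [Command.op, applyDiag2, norm_mul, mul_pow, flipFusion, Function.update_self]
    rw [← add_mul]
    cases m.2 a
    · rw [Bool.not_false, this, one_mul]
    · rw [Bool.not_true, add_comm, this, one_mul]
  | measure i lam α =>
    have hinv : Function.Involutive (flipMeasure (f := f) i) := fun m => by simp [flipMeasure]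
    refine sum_eq_half_of_involutive _ hinv _ _ fun m => ?_
    have hψ : ψ (flipMeasure i m) = ψ m := h₁ _ _ ⟨fun j hj => by
      have : j ≠ i := by rintro rfl; exact hc.2 hj
      simp [flipMeasure, this], fun _ _ => rfl⟩
    rw [hψ]
    simp only [normSq]
    rw [← Finset.sum_add_distrib]
    refine sum_eq_of_pair i.1 _ _ fun z => ?_
    have := lam.sum_norm_sq α (ψ m (Function.update z i.1 false)) (ψ m (Function.update z i.1 true))
    simp only [Command.op, apply1, Fintype.sum_bool, Function.update_self,
      Function.update_idem, flipMeasure, Function.update_self]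
    rw [← this]
    cases m.1 i <;> simp [ketZ, add_comm]
  | corrX i t =>
    simp only [halfWeight, commandWeight, one_mul]
    refine Finset.sum_congr rfl fun m _ => sum_eq_of_pair i _ _ fun z => ?_
    simp only [Command.op, apply1, Fintype.sum_bool, Function.update_self,
      Function.update_idem]
    cases t.val m <;> simp [pauli, add_comm]
  | corrZ i t =>
    simp only [halfWeight, commandWeight, one_mul]
    refine Finset.sum_congr rfl fun m _ => sum_eq_of_pair i _ _ fun z => ?_
    simp only [Command.op, apply1, Fintype.sum_bool, Function.update_self,
      Function.update_idem]
    cases t.val m <;> simp [pauli]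

/-- The sum runs over all outcomes, including those that are not yet obtained and do not affect the
state; the weights `1 / 2` compensate for them in the end. -/
theorem sum_normSq_foldl {pre post : Pattern n f I O} (h : Exec [] (pre ++ post))
    (ψ : Outcomes n f O → Vec (Fin n))
    (h₁ : ∀ m m', Agree pre m m' → ψ m = ψ m') (h₂ : ∀ m, Supported pre (ψ m)) :
    ∑ m, normSq (post.foldl (fun ψ c => c.op m ψ) (ψ m)) =
      (post.map halfWeight).prod * ∑ m, normSq (ψ m) ∧
    ∀ m, Supported (pre ++ post) (post.foldl (fun ψ c => c.op m ψ) (ψ m)) := by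
  induction post generalizing pre ψ with
  | nil => simpa using h₂
  | cons c post ih =>
    obtain ⟨hc, -⟩ : Exec pre (c :: post) := h.append_right
    obtain ⟨h3, h4⟩ := ih (pre := pre ++ [c]) (by simpa using h) (fun m => c.op m (ψ m))
      (fun m m' hm => by rw [hc.op_congr hm, h₁ m m' hm.of_append]) fun m =>
        (h₂ m).op h.of_append hc m
    refine ⟨?_, by simpa using h4⟩
    simp only [List.foldl_cons, List.map_cons, List.prod_cons]
    rw [h3, sum_normSq_op hc ψ h₁ h₂]
    ring

/-- The branches of a runnable pattern form an instrument: the probabilities of all outcomes add up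
to one for every basis state of the inputs. -/
theorem Pattern.Runnable.sum_norm_sq_branch {P : Pattern n f I O} (h : P.Runnable)
    (x : {i // i ∈ I} → Bool) : ∑ m, ∑ y, ‖P.branch m y x‖ ^ 2 = 1 := by
  obtain ⟨h3, h4⟩ := sum_normSq_foldl (pre := []) (post := P) (by simpa using h.exec)
    (fun _ => basisVec (extend I x)) (fun _ _ _ => rfl) fun m z i hi hz => by
      have : i ∉ I := fun hI => hi ⟨Or.inl hI, by simp [Measured]⟩
      refine if_neg ?_
      rintro rfl
      simp [extend, this] at hz
  have h5 : normSq (basisVec (extend I x)) = 1 := by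
    simp [normSq, basisVec, apply_ite]
  have h6 : (P.map halfWeight).prod * ∑ _m : Outcomes n f O, (1 : ℝ) = 1 := by
    unfold halfWeight
    rw [h.prod_commandWeight (WF := fun _ => 1 / 2) (WM := fun _ => 1 / 2) (fun _ _ _ _ _ _ => rfl)
      fun _ _ _ _ => rfl]
    have h7 : entangleProd (fun _ _ => (1 : ℝ)) P = 1 := by
      clear h3 h4 h
      induction P with
      | nil => rfl
      | cons c P ih => cases c <;> simp [entangleProd, ih]
    rw [h7]
    simp only [Finset.prod_const, Finset.sum_const, Finset.card_univ, Fintype.card_prod,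
      Fintype.card_fun, Fintype.card_bool, nsmul_eq_mul, mul_one, one_pow, one_mul]
    push_cast
    rw [mul_comm ((2 : ℝ) ^ _), mul_mul_mul_comm, ← mul_pow, ← mul_pow]
    norm_num
  rw [h5, h6] at h3
  rw [← h3]
  refine Finset.sum_congr rfl fun m _ => ?_
  refine Finset.sum_of_injOn (extend O) ?_ (by simp) (fun z _ hz => ?_) fun y _ => ?_
  · intro y _ y' _ hy
    funext i
    have := congrFun hy i
    simpa [extend] using this
  · have hex : ∃ i, i ∉ O ∧ z i = true := by
      by_contra! hcon
      refine hz ⟨fun i => z i, by simp, funext fun i => ?_⟩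
      by_cases hi : i ∈ O
      · simp [extend, hi]
      · simp [extend, hi, hcon i hi]
    obtain ⟨i, hi, hzi⟩ := hex
    rw [h4 m z i (fun hl => hl.2 (by simpa using h.2.2.1 i hi)) hzi]
    simp
  · rfl

end TracePreservation

/-! ### The state of the emitted photons -/

/-- The Hadamard gate. -/
def hadamard : Matrix.unitaryGroup Bool ℂ :=
  ⟨Matrix.of fun a b => rsqrt2 * sgn (a && b), by
    rw [Matrix.mem_unitaryGroup_iff]
    have h := rsqrt2_mul_self
    ext a b
    rw [Matrix.mul_apply, Fintype.sum_bool]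
    cases a <;> cases b <;> simp [Matrix.star_apply, conj_rsqrt2] <;> linear_combination 2 * h⟩

theorem hadamard_apply (a b : Bool) :
    (hadamard : Matrix Bool Bool ℂ) a b = rsqrt2 * sgn (a && b) := rfl

/-- The bits of all photons, followed by the bit of the atom. -/
def withAtom {N : ℕ} (x : Fin N → Bool) (a : Bool) (t : ℕ) : Bool :=
  if h : t < N then x ⟨t, h⟩ else a

theorem emitterState_eq_prod (u : ℕ → Matrix.unitaryGroup Bool ℂ) (N : ℕ) (x : Fin N → Bool)
    (a : Bool) : emitterState u N x a = rsqrt2 *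
      ∏ t ∈ Finset.range N, (u t : Matrix Bool Bool ℂ) (withAtom x a (t + 1)) (withAtom x a t) := by
  induction N generalizing a with
  | zero => cases a <;> simp [emitterState, ketX, ketZ]
  | succ N ih =>
    have h : emitterState u (N + 1) x a = (u N : Matrix Bool Bool ℂ) a (x (Fin.last N)) *
        emitterState u N (Fin.init x) (x (Fin.last N)) := by
      rw [emitterState, Fintype.sum_bool]
      cases x (Fin.last N) <;> simp
    rw [h, ih, Finset.prod_range_succ]
    have h1 : withAtom x a (N + 1) = a := by simp [withAtom]
    have h2 : withAtom x a N = x (Fin.last N) := by simp [withAtom, Fin.last]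
    have h3 : ∀ t ≤ N, withAtom (Fin.init x) (x (Fin.last N)) t = withAtom x a t := by
      intro t ht
      rcases ht.lt_or_eq with ht | rfl
      · simp only [withAtom, ht, ht.trans (Nat.lt_succ_self N), dif_pos]
        rfl
      · rw [h2]; simp [withAtom]
    rw [h1, h2, Finset.prod_congr rfl fun t ht => by
      rw [h3 t (Finset.mem_range.1 ht).le, h3 (t + 1) (Finset.mem_range.1 ht)]]
    ring

theorem exists_sorted_equiv {Φ : Type*} [Fintype Φ] (g : Φ → ℕ) :
    ∃ e : Fin (Fintype.card Φ) ≃ Φ, Monotone (g ∘ e) := by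
  let e₀ := (Fintype.equivFin Φ).symm
  exact ⟨(Tuple.sort (g ∘ e₀)).trans e₀, Tuple.monotone_sort (g ∘ e₀)⟩

/-- If consecutive photons of one group carry the same bit, the amplitude depends on the steps from
one group to the next only. -/
theorem prod_range_of_steps {N : ℕ} (G : ℕ → ℕ) (h0 : G 0 = 0)
    (hs : ∀ t < N, G (t + 1) = G t ∨ G (t + 1) = G t + 1) (A : ℕ → Matrix Bool Bool ℂ)
    (w : ℕ → Bool) :
    ∏ t ∈ Finset.range N, (if G (t + 1) = G t then (1 : Matrix Bool Bool ℂ) else A (G t))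
      (w (G (t + 1))) (w (G t)) = ∏ g ∈ Finset.range (G N), A g (w (g + 1)) (w g) := by
  induction N with
  | zero => simp [h0]
  | succ N ih =>
    rw [Finset.prod_range_succ, ih fun t ht => hs t (ht.trans (Nat.lt_succ_self N))]
    rcases hs N (Nat.lt_succ_self N) with h | h
    · rw [if_pos h, h, Matrix.one_apply_eq, mul_one]
    · rw [if_neg (by omega), h, Finset.prod_range_succ]

/-- The place of a group of photons in the order of emission: the photons of qubit `i`, then the
separator after qubit `i`. -/
def groupIndex {n : ℕ} : Fin n ⊕ Fin n → ℕ := Sum.elim (fun i => 2 * i) fun i => 2 * i + 1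

/-- The bits of all groups in the order of emission, followed by the bit of the atom. -/
def groupBits {n : ℕ} (w : Fin n ⊕ Fin n → Bool) (a : Bool) (k : ℕ) : Bool :=
  if h : k / 2 < n then (if k % 2 = 0 then w (Sum.inl ⟨k / 2, h⟩) else w (Sum.inr ⟨k / 2, h⟩))
  else a

theorem groupBits_groupIndex {n : ℕ} (w : Fin n ⊕ Fin n → Bool) (a : Bool) (γ : Fin n ⊕ Fin n) :
    groupBits w a (groupIndex γ) = w γ := by
  rcases γ with i | i
  · simp [groupBits, groupIndex]
  · have : (2 * (i : ℕ) + 1) / 2 = i := by omega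
    have h2 : (2 * (i : ℕ) + 1) % 2 = 1 := by omega
    simp [groupBits, groupIndex, this, h2]

theorem groupBits_end {n : ℕ} (w : Fin n ⊕ Fin n → Bool) (a : Bool) :
    groupBits w a (2 * n) = a := by simp [groupBits]

/-- The bit of the qubit after `i`, or of the atom if `i` is the last qubit. -/
def nextBit {n : ℕ} (b : Fin n → Bool) (a : Bool) (i : ℕ) : Bool :=
  if h : i + 1 < n then b ⟨i + 1, h⟩ else a

theorem prod_range_two_mul {M : Type*} [CommMonoid M] (F : ℕ → M) (n : ℕ) :
    ∏ k ∈ Finset.range (2 * n), F k = ∏ i ∈ Finset.range n, F (2 * i) * F (2 * i + 1) := by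
  induction n with
  | zero => rfl
  | succ n ih =>
    rw [Nat.mul_succ, Finset.prod_range_succ, Finset.prod_range_succ, ih, Finset.prod_range_succ,
      mul_assoc]

/-- The emitter can produce a chain of groups of photons, where the photons of a group carry the
same bit. The groups of successive qubits are linked via a separator. -/
theorem exists_emitter {n : ℕ} {Φ : Type} [Fintype Φ] (grp : Φ → Fin n ⊕ Fin n)
    (hgrp : Function.Surjective grp) (V : Fin n → Matrix.unitaryGroup Bool ℂ) :
    ∃ (u : ℕ → Matrix.unitaryGroup Bool ℂ) (e : Fin (Fintype.card Φ) ≃ Φ),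
      ∀ (F : (Φ → Bool) → ℂ) (a : Bool),
        ∑ x : Fin (Fintype.card Φ) → Bool,
            F (fun φ => x (e.symm φ)) * emitterState u (Fintype.card Φ) x a =
          ∑ b : Fin n → Bool, ∑ s : Fin n → Bool, F (fun φ => Sum.elim b s (grp φ)) *
            (rsqrt2 * ∏ i, (hadamard : Matrix Bool Bool ℂ) (s i) (b i) *
              (V i : Matrix Bool Bool ℂ) (nextBit b a i) (s i)) := by
  classical
  obtain ⟨e, he⟩ := exists_sorted_equiv fun φ => groupIndex (grp φ)
  revert e he
  generalize Fintype.card Φ = N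
  intro e he
  -- The group of photon number `t`. Every group is met, so `G` rises by steps of at most one.
  let G : ℕ → ℕ := fun t => if h : t < N then groupIndex (grp (e ⟨t, h⟩)) else 2 * n
  have hG : ∀ t : Fin N, G t = groupIndex (grp (e t)) := fun t => by simp [G]
  have hGN : ∀ t, N ≤ t → G t = 2 * n := fun t ht => dif_neg (by omega)
  have hlt : ∀ γ : Fin n ⊕ Fin n, groupIndex γ < 2 * n := by
    rintro (i | i) <;> simp only [groupIndex, Sum.elim_inl, Sum.elim_inr] <;> omega
  have hsurj : ∀ k < 2 * n, ∃ t : Fin N, G t = k := by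
    intro k hk
    have : ∃ γ : Fin n ⊕ Fin n, groupIndex γ = k := by
      rcases Nat.even_or_odd' k with ⟨j, rfl | rfl⟩
      · exact ⟨Sum.inl ⟨j, by omega⟩, rfl⟩
      · exact ⟨Sum.inr ⟨j, by omega⟩, rfl⟩
    obtain ⟨γ, rfl⟩ := this
    obtain ⟨φ, rfl⟩ := hgrp γ
    exact ⟨e.symm φ, by rw [hG]; simp⟩
  have hmono : Monotone G := by
    intro s t hst
    by_cases ht : t < N
    · have := he (show (⟨s, by omega⟩ : Fin N) ≤ ⟨t, ht⟩ from hst)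
      simpa [G, ht, lt_of_le_of_lt hst ht] using this
    · rw [hGN t (by omega)]
      by_cases hs : s < N
      · rw [hG ⟨s, hs⟩]; exact (hlt _).le
      · rw [hGN s (by omega)]
  have hle : ∀ t, G t ≤ 2 * n := fun t => by
    rw [← hGN (max t N) (le_max_right _ _)]
    exact hmono (le_max_left _ _)
  have h0 : G 0 = 0 := by
    rcases Nat.eq_zero_or_pos n with rfl | hn
    · have := hle 0; omega
    · obtain ⟨t, ht⟩ := hsurj 0 (by omega)
      have := hmono (Nat.zero_le t)
      omega
  have hstep : ∀ t < N, G (t + 1) = G t ∨ G (t + 1) = G t + 1 := by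
    intro t ht
    have h1 := hmono (Nat.le_succ t)
    by_contra! hcon
    have h2 := hle (t + 1)
    obtain ⟨s, hs⟩ := hsurj (G t + 1) (by simp only [Nat.succ_eq_add_one] at h1; omega)
    rcases Nat.lt_or_ge t s with h | h
    · have := hmono (Nat.succ_le_of_lt h)
      simp only [Nat.succ_eq_add_one] at this h1
      omega
    · have := hmono h
      omega
  -- The atom is left alone within a group and undergoes `T k` at the end of group number `k`.
  let T : ℕ → Matrix.unitaryGroup Bool ℂ := fun k =>
    if h : k / 2 < n then (if k % 2 = 0 then hadamard else V ⟨k / 2, h⟩) else 1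
  let u : ℕ → Matrix.unitaryGroup Bool ℂ := fun t => if G (t + 1) = G t then 1 else T (G t)
  have hu : ∀ t, (u t : Matrix Bool Bool ℂ) =
      if G (t + 1) = G t then (1 : Matrix Bool Bool ℂ) else (T (G t) : Matrix Bool Bool ℂ) := by
    intro t
    by_cases h : G (t + 1) = G t
    · simp [u, h]
    · simp [u, h]
  refine ⟨u, e, fun F a => ?_⟩
  have hwith : ∀ (w : Fin n ⊕ Fin n → Bool) t,
      withAtom (fun t : Fin N => w (grp (e t))) a t = groupBits w a (G t) := by
    intro w t
    by_cases ht : t < N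
    · rw [hG ⟨t, ht⟩, groupBits_groupIndex]; simp [withAtom, ht]
    · rw [hGN t (by omega), groupBits_end]; simp [withAtom, ht]
  have hem : ∀ w : Fin n ⊕ Fin n → Bool, emitterState u N (fun t => w (grp (e t))) a = rsqrt2 *
      ∏ i : Fin n, (hadamard : Matrix Bool Bool ℂ) (w (Sum.inr i)) (w (Sum.inl i)) *
        (V i : Matrix Bool Bool ℂ) (nextBit (fun i => w (Sum.inl i)) a i) (w (Sum.inr i)) := by
    intro w
    rw [emitterState_eq_prod]
    simp only [hwith, hu]
    rw [prod_range_of_steps G h0 hstep (fun k => (T k : Matrix Bool Bool ℂ)) (groupBits w a),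
      hGN N le_rfl, prod_range_two_mul, Finset.prod_range]
    congr 1
    refine Finset.prod_congr rfl fun i _ => ?_
    have e1 := groupBits_groupIndex w a (Sum.inl i)
    have e2 := groupBits_groupIndex w a (Sum.inr i)
    simp only [groupIndex, Sum.elim_inl, Sum.elim_inr] at e1 e2
    have e3 : groupBits w a (2 * i + 1 + 1) = nextBit (fun i => w (Sum.inl i)) a i := by
      have d1 : (2 * (i : ℕ) + 1 + 1) / 2 = i + 1 := by omega
      have d2 : (2 * (i : ℕ) + 1 + 1) % 2 = 0 := by omega
      simp [groupBits, nextBit, d1, d2]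
    have t1 : T (2 * i) = hadamard := by simp [T]
    have t2 : T (2 * i + 1) = V i := by
      have d1 : (2 * (i : ℕ) + 1) / 2 = i := by omega
      have d2 : (2 * (i : ℕ) + 1) % 2 = 1 := by omega
      simp [T, d1, d2]
    rw [e1, e2, e3, t1, t2]
  rw [← Fintype.sum_prod_type', ← (Equiv.sumArrowEquivProdArrow (Fin n) (Fin n) Bool).sum_comp]
  symm
  refine Finset.sum_of_injOn (fun w (t : Fin N) => w (grp (e t))) ?_ (by simp) (fun x _ hx => ?_)
    fun w _ => ?_
  · intro w _ w' _ hw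
    funext γ
    obtain ⟨φ, rfl⟩ := hgrp γ
    simpa using congrFun hw (e.symm φ)
  · -- If the photons of a group do not all carry the same bit, the amplitude is zero.
    by_contra hne
    have hem0 : emitterState u N x a ≠ 0 := right_ne_zero_of_mul hne
    rw [emitterState_eq_prod] at hem0
    have hfac := Finset.prod_ne_zero_iff.1 (right_ne_zero_of_mul hem0)
    have hsame : ∀ t < N, G (t + 1) = G t → withAtom x a (t + 1) = withAtom x a t := by
      intro t ht h
      have := hfac t (Finset.mem_range.2 ht)
      rw [hu, if_pos h, Matrix.one_apply] at this
      by_contra hc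
      exact this (if_neg hc)
    have hconst : ∀ d s, s + d < N → G (s + d) = G s → withAtom x a (s + d) = withAtom x a s := by
      intro d
      induction d with
      | zero => intro s _ _; rfl
      | succ d ih =>
        intro s hd h
        have g1 := hmono (show s ≤ s + d by omega)
        have g2 := hmono (show s + d ≤ s + (d + 1) by omega)
        rw [← ih s (by omega) (by omega)]
        exact hsame (s + d) (by omega) (by rw [← add_assoc] at h g2; omega)
    refine hx ⟨fun γ => x (e.symm (hgrp γ).choose), by simp, funext fun t => ?_⟩
    set t' := e.symm (hgrp (grp (e t))).choose with ht'
    have hgt : G t' = G t := by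
      rw [hG, hG, ht', Equiv.apply_symm_apply, (hgrp (grp (e t))).choose_spec]
    have hx' : ∀ t : Fin N, withAtom x a t = x t := fun t => by simp [withAtom]
    change x t' = x t
    rw [← hx', ← hx']
    rcases le_total (t : ℕ) t' with h | h
    · obtain ⟨d, hd⟩ := Nat.exists_eq_add_of_le h
      have := hconst d t (by omega) (by rw [← hd, hgt])
      rwa [← hd] at this
    · obtain ⟨d, hd⟩ := Nat.exists_eq_add_of_le h
      have := hconst d t' (by omega) (by rw [← hd, hgt])
      rw [← hd] at this
      exact this.symm
  · rw [hem]
    have : (fun φ => w (grp (e (e.symm φ)))) = fun φ =>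
        Sum.elim (fun i => w (Sum.inl i)) (fun i => w (Sum.inr i)) (grp φ) := by
      funext φ
      rw [Equiv.apply_symm_apply]
      cases grp φ <;> rfl
    simp only [this]
    rfl

section Links

variable {n f : ℕ} {I O : Finset (Fin n)}

/-! ### Links between successive qubits -/

/-- The number of commands that entangle qubit `l` with its successor. -/
def joins : Pattern n f I O → Fin n → ℕ
  | [], _ => 0
  | .entangle i j :: P, l => (if l = min i j then 1 else 0) + joins P l
  | _ :: P, l => joins P l

theorem cz_comm (a b : Bool) : cz a b = cz b a := by cases a <;> cases b <;> rfl

theorem cz_pow (a b : Bool) (k : ℕ) : cz a b ^ k = if Odd k then cz a b else 1 := by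
  have h : cz a b ^ 2 = 1 := by cases a <;> cases b <;> simp [cz]
  rcases Nat.even_or_odd' k with ⟨j, rfl | rfl⟩
  · simp [pow_mul, h]
  · simp [pow_add, pow_mul, h]

theorem entangleProd_eq_prod_joins {P : Pattern n f I O} (hlin : P.Linear) (b : Fin n → Bool)
    (a : Bool) : entangleProd (fun i j => cz (b i) (b j)) P =
      ∏ l, cz (b l) (nextBit b a l) ^ joins P l := by
  induction P with
  | nil => simp [entangleProd, joins]
  | cons c P ih =>
    have ih' := ih fun i j h => hlin i j (List.mem_cons_of_mem _ h)
    cases c with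
    | entangle i j =>
      have hcz : cz (b i) (b j) = cz (b (min i j)) (nextBit b a (min i j : Fin n)) := by
        rcases hlin i j List.mem_cons_self with h | h
        · have : min i j = i := min_eq_left (by rw [Fin.le_def]; omega)
          rw [this]
          have hj : nextBit b a i = b j := by
            simp only [nextBit, h, j.2, dif_pos]
          rw [hj]
        · have : min i j = j := min_eq_right (by rw [Fin.le_def]; omega)
          rw [this]
          have hj : nextBit b a j = b i := by
            simp only [nextBit, h, i.2, dif_pos]
          rw [hj, cz_comm]
      have hone : ∏ l, cz (b l) (nextBit b a l) ^ (if l = min i j then 1 else 0) =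
          cz (b (min i j)) (nextBit b a (min i j : Fin n)) := by
        rw [Finset.prod_eq_single (min i j)]
        · simp
        · intro l _ hl; simp [hl]
        · simp
      simp only [entangleProd, joins, pow_add]
      rw [Finset.prod_mul_distrib, hone, hcz, ih']
    | _ => exact ih'

/-- The qubit `i` is linked to its successor. -/
def Pattern.link (P : Pattern n f I O) (i : Fin n) : Bool := decide (Odd (joins P i))

/-- The separator of two linked qubits is measured in the `X` basis, otherwise in the `Z` basis. -/
def separatorLabel (link : Bool) : Label := if link then .X else .Z

/-- The gate on the atom after the emission of a separator. -/
def separatorGate (link : Bool) : Matrix.unitaryGroup Bool ℂ := if link then 1 else hadamard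

/-- After the measurement of the separator, two successive groups are linked by a `CZ` gate or not
linked, up to powers of `Z`. -/
theorem sum_separator (link o b b' : Bool) :
    ∑ s, conj ((separatorLabel link).ket 0 o s) *
      ((hadamard : Matrix Bool Bool ℂ) s b * (separatorGate link : Matrix Bool Bool ℂ) b' s) =
      1 / 2 * ((if link then cz b b' else 1) * sgn (o && b') * sgn ((!link && o) && b)) := by
  have h := rsqrt2_mul_self
  have h' : rsqrt2 ^ 2 = 1 / 2 := by rw [sq, h]
  cases link
  · cases o <;> cases b <;> cases b' <;>
      simp [separatorLabel, separatorGate, Label.ket, ketZ, hadamard_apply, h]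
  · cases o <;> cases b <;> cases b' <;>
      simp [separatorLabel, separatorGate, Label.ket, ketX, ketZ, hadamard_apply, h, cz,
        conj_rsqrt2, Matrix.one_apply]

/-- The bit before place `j`. -/
def prevBit (o : Fin n → Bool) (j : ℕ) : Bool :=
  if h : 0 < j ∧ j - 1 < n then o ⟨j - 1, h.2⟩ else false

/-- Powers of `Z` on the successors are powers of `Z` on the qubits, up to one on the atom. -/
theorem prod_sgn_nextBit (o b : Fin n → Bool) (a : Bool) :
    ∏ i, sgn (o i && nextBit b a i) =
      sgn (prevBit o n && a) * ∏ i : Fin n, sgn (prevBit o i && b i) := by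
  let g : ℕ → ℂ := fun j => sgn (prevBit o j && withAtom b a j)
  have h1 : ∏ i : Fin n, sgn (o i && nextBit b a i) = ∏ i ∈ Finset.range n, g (i + 1) := by
    rw [Finset.prod_range]
    refine Finset.prod_congr rfl fun i _ => ?_
    simp [g, prevBit, withAtom, nextBit]
  have h2 : ∏ i : Fin n, sgn (prevBit o i && b i) = ∏ i ∈ Finset.range n, g i := by
    rw [Finset.prod_range]
    refine Finset.prod_congr rfl fun i _ => ?_
    simp [g, withAtom]
  have h3 : g n = sgn (prevBit o n && a) := by simp [g, withAtom]
  have h4 : g 0 = 1 := by simp [g, prevBit]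
  rw [h1, h2, ← h3]
  have := (Finset.prod_range_succ' g n).symm.trans (Finset.prod_range_succ g n)
  rw [h4, mul_one] at this
  rw [this, mul_comm]

theorem sum_mul_pauli (g : Bool → ℂ) (x z c : Bool) :
    ∑ b, g b * pauli x z b c = g (c ^^ x) * sgn (z && c) := by
  rw [Fintype.sum_bool]
  cases x <;> cases z <;> cases c <;> simp [pauli]

theorem pauli_apply (x z b c : Bool) :
    pauli x z b c = (if (c ^^ x) = b then 1 else 0) * sgn (z && c) := by
  cases x <;> cases z <;> cases c <;> cases b <;> simp [pauli]

/-- The product over the commands of a pattern, all corrections being postponed. -/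
theorem Pattern.Runnable.prod_postponedWeight {P : Pattern n f I O} (h : P.Runnable)
    {τ : Fin f → FusionType} {c : Fin f → Bool} {fi fj : Fin f → Fin n}
    {lam : {i : Fin n // i ∉ O} → Label} {α : {i : Fin n // i ∉ O} → ℝ}
    (hfuse : ∀ a, Command.fuse a (τ a) (c a) (fi a) (fj a) ∈ P)
    (hmeas : ∀ i, Command.measure i (lam i) (α i) ∈ P)
    (m : Outcomes n f O) (xf : Fin n → Bool) (sh sA sB : Fin f → Bool) (b : Fin n → Bool) :
    (P.map (postponedWeight m xf sh sA sB b)).prod = rsqrt2 ^ (n - I.card) *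
      entangleProd (fun i j => cz (b i) (b j)) P *
      (∏ a, fusionKraus (τ a) (c a) (m.2 a ^^ sh a) (b (fi a)) (b (fj a)) * sgn (sA a && b (fi a)) *
        sgn (sB a && b (fj a))) *
      ∏ i : {i : Fin n // i ∉ O}, conj ((lam i).ket (α i) (m.1 i) (b i ^^ xf i)) := by
  have : postponedWeight m xf sh sA sB b = (commandWeight rsqrt2 (fun i j => cz (b i) (b j))
      (fun a τ c i j => fusionKraus τ c (m.2 a ^^ sh a) (b i) (b j) * sgn (sA a && b i) *
        sgn (sB a && b j))
      (fun i lam α => conj (lam.ket α (m.1 i) (b i ^^ xf i))) : Command n f I O → ℂ) := by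
    funext d
    cases d <;> rfl
  rw [this]
  refine h.prod_commandWeight (fun a τ' c' i j hm => ?_) fun i lam' α' hm => ?_
  · obtain ⟨rfl, rfl, rfl, rfl⟩ := h.exec.fuse_unique hm (hfuse a)
    rfl
  · obtain ⟨rfl, rfl⟩ := h.exec.measure_unique hm (hmeas i)
    rfl

end Links

section Layout

variable {n f : ℕ} {I O : Finset (Fin n)}

/-! ### The settings of the protocol -/

/-- The time slots for a pattern: one for the separator after each qubit, one for each open input
leg, one for each fusion, one for each measured qubit, and one for each output qubit. -/
abbrev Slot (n f : ℕ) (I O : Finset (Fin n)) : Type :=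
  Fin n ⊕ {i // i ∈ I} ⊕ Fin f ⊕ {i : Fin n // i ∉ O} ⊕ {i // i ∈ O}

/-- The fusions and measurements of a pattern by name. -/
structure Layout (P : Pattern n f I O) where
  /-- Types of the fusions. -/
  τ : Fin f → FusionType
  /-- Clifford parameters of the fusions. -/
  c : Fin f → Bool
  /-- First qubits of the fusions. -/
  fi : Fin f → Fin n
  /-- Second qubits of the fusions. -/
  fj : Fin f → Fin n
  /-- Measurement labels. -/
  lam : {i : Fin n // i ∉ O} → Label
  /-- Measurement angles. -/
  α : {i : Fin n // i ∉ O} → ℝ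
  fuse_mem : ∀ a, Command.fuse a (τ a) (c a) (fi a) (fj a) ∈ P
  measure_mem : ∀ i, Command.measure i (lam i) (α i) ∈ P

theorem Pattern.Runnable.exists_layout {P : Pattern n f I O} (h : P.Runnable) :
    Nonempty (Layout P) := by
  choose τ c fi fj hF using h.2.2.2
  have hM : ∀ i : {i : Fin n // i ∉ O}, ∃ lam α, Command.measure i lam α ∈ P := fun i =>
    (h.2.2.1 i i.2).2
  choose lam α hM using hM
  exact ⟨⟨τ, c, fi, fj, lam, α, hF, hM⟩⟩

namespace Layout

variable {P : Pattern n f I O} (A : Layout P)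

/-- What the router connects in each slot. -/
def route : Slot n f I O → Route (Legs I O)
  | .inl i => .detect (separatorLabel (P.link i)) 0
  | .inr (.inl i) => .out (.inl i)
  | .inr (.inr (.inl a)) => .rus (A.τ a) (A.c a)
  | .inr (.inr (.inr (.inl i))) => .detect (A.lam i) (A.α i)
  | .inr (.inr (.inr (.inr i))) => .out (.inr i)

/-- The group of every photon: separators in the right summand, and in the left summand the photons
that carry the bit of a qubit. -/
def group (k : ℕ) : (j : Slot n f I O) → (A.route j).Port k → Fin n ⊕ Fin n
  | .inl i => fun _ => .inr i
  | .inr (.inl i) => fun _ => .inl i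
  | .inr (.inr (.inl a)) => fun (p : Fin k × Bool) => .inl (if p.2 then A.fj a else A.fi a)
  | .inr (.inr (.inr (.inl i))) => fun _ => .inl i
  | .inr (.inr (.inr (.inr i))) => fun _ => .inl i

/-- The order of the slots: first the separators, then fusions and measurements in the order of the
pattern, and the outputs last. So every correction is applied when the outcomes that it depends on
are known. -/
def time (P : Pattern n f I O) : Slot n f I O → ℕ
  | .inl _ => 0
  | .inr (.inl _) => 0
  | .inr (.inr (.inl a)) => P.fuseTime a
  | .inr (.inr (.inr (.inl i))) => P.measureTime i
  | .inr (.inr (.inr (.inr _))) => P.length + 1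

/-- The classical record, with the slots in place of the time at which they occur. -/
abbrev SlotRecord (k : ℕ) : Type := (j : Slot n f I O) → (A.route j).Record k

variable {k : ℕ}

/-- Outcome of the measurement of a separator. -/
def sepBit (ω : A.SlotRecord k) (i : Fin n) : Bool := ω (.inl i)

/-- Record of a fusion. -/
def fusionRecord (ω : A.SlotRecord k) (a : Fin f) : Fin k → Detection := ω (.inr (.inr (.inl a)))

/-- Outcome of the measurement of a qubit. -/
def measBit (ω : A.SlotRecord k) (i : {i : Fin n // i ∉ O}) : Bool :=
  ω (.inr (.inr (.inr (.inl i))))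

/-- How the records of the fusions are read: the outcome of the fusion and the powers of `Z` on the
two qubits. -/
structure Decoder (k f : ℕ) where
  /-- Outcome. -/
  κ : Fin f → (Fin k → Detection) → Bool
  /-- Power of `Z` on the first qubit. -/
  sA : Fin f → (Fin k → Detection) → Bool
  /-- Power of `Z` on the second qubit. -/
  sB : Fin f → (Fin k → Detection) → Bool

variable (hrun : P.Runnable) (R : Decoder k f)

/-- The outcomes that would be found in the pattern if its corrections were postponed. -/
def raw (ω : A.SlotRecord k) : Outcomes n f O :=
  (A.measBit ω, fun a => R.κ a (A.fusionRecord ω a))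

/-- The outcomes of the pattern. -/
def read (ω : A.SlotRecord k) : Outcomes n f O :=
  (Equiv.ofBijective _ hrun.rawOutcomes_bijective).symm (A.raw R ω)

theorem rawOutcomes_read (ω : A.SlotRecord k) :
    P.rawOutcomes (A.read hrun R ω) = A.raw R ω :=
  (Equiv.ofBijective _ hrun.rawOutcomes_bijective).apply_symm_apply _

theorem read_eq_iff (ω : A.SlotRecord k) (m : Outcomes n f O) :
    A.read hrun R ω = m ↔ A.raw R ω = P.rawOutcomes m := by
  rw [read, Equiv.symm_apply_eq]
  rfl

/-- Power of `X` in the correction of a qubit before its measurement or output. -/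
def correctionX (ω : A.SlotRecord k) (i : Fin n) : Bool :=
  frameX (A.read hrun R ω) P (fun _ => false) i

/-- Power of `Z` that the measurements of the separators leave on a qubit. -/
def separatorZ (ω : A.SlotRecord k) (i : Fin n) : Bool :=
  prevBit (A.sepBit ω) i ^^ (!P.link i && A.sepBit ω i)

/-- Power of `Z` in the correction of a qubit before its measurement or output. -/
def correctionZ (ω : A.SlotRecord k) (i : Fin n) : Bool :=
  A.separatorZ ω i ^^ frameZ (A.read hrun R ω) (fun a => R.sA a (A.fusionRecord ω a))
    (fun a => R.sB a (A.fusionRecord ω a)) P (fun _ => false) i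

/-- Setting of the correction module in each slot, for a function that gives the correction of each
qubit. -/
def slotCorrection (g : Fin n → Bool) : Slot n f I O → Bool
  | .inl _ => false
  | .inr (.inl _) => false
  | .inr (.inr (.inl _)) => false
  | .inr (.inr (.inr (.inl i))) => g i
  | .inr (.inr (.inr (.inr i))) => g i

/-- The corrections depend on the records of earlier slots only. -/
theorem correction_congr {ω ω' : A.SlotRecord k} (j : Slot n f I O)
    (h : ∀ j', time P j' < time P j → ω j' = ω' j') :
    slotCorrection (A.correctionX hrun R ω) j = slotCorrection (A.correctionX hrun R ω') j ∧
    slotCorrection (A.correctionZ hrun R ω) j = slotCorrection (A.correctionZ hrun R ω') j := by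
  have hsep : 0 < time P j → A.sepBit ω = A.sepBit ω' := fun h0 =>
    funext fun i => h (.inl i) h0
  have hsZ : 0 < time P j → ∀ i, A.separatorZ ω i = A.separatorZ ω' i := fun h0 i => by
    unfold separatorZ
    rw [hsep h0]
  have hfus : ∀ a, P.fuseTime a < time P j → A.fusionRecord ω a = A.fusionRecord ω' a := fun a ha =>
    h (.inr (.inr (.inl a))) ha
  have hmeas : ∀ i : {i : Fin n // i ∉ O}, P.measureTime i < time P j →
      A.measBit ω i = A.measBit ω' i := fun i hi =>
    h (.inr (.inr (.inr (.inl i)))) hi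
  rcases j with i | i | a | i | i
  · simp only [slotCorrection, and_self]
  · simp only [slotCorrection, and_self]
  · simp only [slotCorrection, and_self]
  · have hi : Measured P i.1 := hrun.2.2.1 i i.2
    have := hrun.frame_congr hi (m := A.read hrun R ω) (m' := A.read hrun R ω')
      (sA := fun a => R.sA a (A.fusionRecord ω a)) (sA' := fun a => R.sA a (A.fusionRecord ω' a))
      (sB := fun a => R.sB a (A.fusionRecord ω a)) (sB' := fun a => R.sB a (A.fusionRecord ω' a))
      (fun j hj => by
        rw [rawOutcomes_read, rawOutcomes_read]
        exact hmeas j hj)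
      (fun a ha => by
        rw [rawOutcomes_read, rawOutcomes_read]
        simp only [raw, hfus a ha, and_self])
    refine ⟨this.1, ?_⟩
    simp only [slotCorrection, correctionZ]
    rw [this.2, hsZ (Pattern.measureTime_pos hi)]
  · have hf' : ∀ a, A.fusionRecord ω a = A.fusionRecord ω' a := fun a => hfus a <| by
      have := Pattern.fuseTime_le (p := P) (q := []) (hrun.2.2.2 a)
      rw [List.append_nil] at this
      exact Nat.lt_succ_of_le this
    have hm' : A.measBit ω = A.measBit ω' := funext fun i => hmeas i <| by
      have := Pattern.measureTime_le (p := P) (q := []) (hrun.2.2.1 i i.2)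
      rw [List.append_nil] at this
      exact Nat.lt_succ_of_le this
    have hr : A.read hrun R ω = A.read hrun R ω' := by
      unfold read raw
      simp only [hf', hm']
    simp only [slotCorrection, correctionX, correctionZ, hr, hf', hsZ (Nat.succ_pos _), and_self]

end Layout

instance (k : ℕ) {L : Type} : (ρ : Route L) → Fintype (ρ.Port k)
  | .rus _ _ => inferInstanceAs (Fintype (Fin k × Bool))
  | .detect _ _ => inferInstanceAs (Fintype Unit)
  | .out _ => inferInstanceAs (Fintype Unit)

instance (k : ℕ) {L : Type} : (ρ : Route L) → Inhabited (ρ.Record k)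
  | .rus _ _ => ⟨fun _ => s(0, 0)⟩
  | .detect _ _ => ⟨false⟩
  | .out _ => ⟨()⟩

namespace Layout

variable {P : Pattern n f I O} (A : Layout P) {k : ℕ}

/-- All photons, for a given order of the slots. -/
abbrev Photon (k : ℕ) {N : ℕ} (e : Fin N ≃ Slot n f I O) : Type :=
  (r : Fin N) × (A.route (e r)).Port k

/-- The group of a photon. -/
def photonGroup {N : ℕ} (e : Fin N ≃ Slot n f I O) (φ : A.Photon k e) : Fin n ⊕ Fin n :=
  A.group k (e φ.1) φ.2

theorem photonGroup_surjective {N : ℕ} (e : Fin N ≃ Slot n f I O) :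
    Function.Surjective (A.photonGroup (k := k) e) := by
  have key : ∀ (j : Slot n f I O) (p : (A.route j).Port k), ∃ φ : A.Photon k e,
      A.photonGroup e φ = A.group k j p := by
    intro j p
    obtain ⟨r, rfl⟩ := e.surjective j
    exact ⟨⟨r, p⟩, rfl⟩
  rintro (i | i)
  · by_cases hi : i ∈ O
    · exact key (.inr (.inr (.inr (.inr ⟨i, hi⟩)))) ()
    · exact key (.inr (.inr (.inr (.inl ⟨i, hi⟩)))) ()
  · exact key (.inl i) ()

/-- The record of a run, sorted by slots. -/
def slotRecord {N : ℕ} (e : Fin N ≃ Slot n f I O) :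
    ((r : Fin N) → (A.route (e r)).Record k) ≃ A.SlotRecord k :=
  Equiv.piCongrLeft (fun j => (A.route j).Record k) e

theorem slotRecord_apply {N : ℕ} (e : Fin N ≃ Slot n f I O)
    (ω : (r : Fin N) → (A.route (e r)).Record k) (r : Fin N) : A.slotRecord e ω (e r) = ω r :=
  Equiv.piCongrLeft_apply_apply (fun j => (A.route j).Record k) e ω r

open Classical in
/-- Extend the record of the slots before `r` to all slots. -/
def fill {N : ℕ} (e : Fin N ≃ Slot n f I O) (r : Fin N)
    (ω : (s : Fin N) → s < r → (A.route (e s)).Record k) :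
    (s : Fin N) → (A.route (e s)).Record k :=
  fun s => if h : s < r then ω s h else default

variable (hrun : P.Runnable) (R : Decoder k f)

/-- The settings of the protocol for a pattern, for given orders of the slots and the photons and
given gates on the atom. -/
def protocol {N M : ℕ} (e : Fin N ≃ Slot n f I O) (σ : Fin M ≃ A.Photon k e)
    (u : ℕ → Matrix.unitaryGroup Bool ℂ) : Protocol k (Legs I O) where
  photons := M
  u := u
  slots := N
  ρ r := A.route (e r)
  σ := σ
  out_unique := by
    rintro (l | l)
    · refine ⟨e.symm (.inr (.inl l)), by simp [route], fun r hr => ?_⟩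
      rw [Equiv.eq_symm_apply]
      change A.route (e r) = _ at hr
      generalize e r = j at hr
      rcases j with i | i | a | i | i <;> simp_all [route]
    · refine ⟨e.symm (.inr (.inr (.inr (.inr l)))), by simp [route], fun r hr => ?_⟩
      rw [Equiv.eq_symm_apply]
      change A.route (e r) = _ at hr
      generalize e r = j at hr
      rcases j with i | i | a | i | i <;> simp_all [route]
  corrX r ω := slotCorrection (A.correctionX hrun R (A.slotRecord e (A.fill e r ω))) (e r)
  corrZ r ω := slotCorrection (A.correctionZ hrun R (A.slotRecord e (A.fill e r ω))) (e r)

theorem fusions_protocol {N M : ℕ} (e : Fin N ≃ Slot n f I O) (σ : Fin M ≃ A.Photon k e)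
    (u : ℕ → Matrix.unitaryGroup Bool ℂ) : (A.protocol hrun R e σ u).fusions = f := by
  have h : ∀ r : Fin N, (A.route (e r)).IsFusion ↔ ∃ a, e r = .inr (.inr (.inl a)) := by
    intro r
    rcases e r with i | i | a | i | i <;> simp [route, Route.IsFusion]
  unfold Protocol.fusions
  have hbij : Function.Bijective fun a : Fin f =>
      (⟨e.symm (.inr (.inr (.inl a))), (h _).2 ⟨a, by simp⟩⟩ :
        {r : Fin N // (A.route (e r)).IsFusion}) := by
    constructor
    · intro a a' haa
      simpa using haa
    · rintro ⟨r, hr⟩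
      obtain ⟨a, ha⟩ := (h r).1 hr
      exact ⟨a, Subtype.ext (by simp [← ha])⟩
  exact (Nat.card_congr (Equiv.ofBijective _ hbij)).symm.trans (by simp)

/-- If the slots are in the order of `time`, the settings of the correction modules are those that
belong to the complete record. -/
theorem correction_fill {N : ℕ} (e : Fin N ≃ Slot n f I O) (he : Monotone (time P ∘ e))
    (ω : (r : Fin N) → (A.route (e r)).Record k) (r : Fin N) :
    slotCorrection (A.correctionX hrun R (A.slotRecord e (A.fill e r fun s _ => ω s))) (e r) =
      slotCorrection (A.correctionX hrun R (A.slotRecord e ω)) (e r) ∧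
    slotCorrection (A.correctionZ hrun R (A.slotRecord e (A.fill e r fun s _ => ω s))) (e r) =
      slotCorrection (A.correctionZ hrun R (A.slotRecord e ω)) (e r) := by
  refine A.correction_congr hrun R (e r) fun j hj => ?_
  obtain ⟨s, rfl⟩ := e.surjective j
  rw [slotRecord_apply, slotRecord_apply]
  have hs : s < r := lt_of_not_ge fun hge => absurd (he hge) (not_le.2 hj)
  simp [fill, hs]

end Layout

end Layout

section Amplitude

variable {n f : ℕ} {I O : Finset (Fin n)}

/-! ### The amplitudes of the protocol -/

namespace Layout

variable {P : Pattern n f I O} (A : Layout P) {k : ℕ}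

/-- The effects of all slots, if every photon carries the bit of its group: `b i` for qubit `i` and
`s i` for the separator after it. -/
theorem prod_effect (gx gz : Fin n → Bool) (ω : A.SlotRecord k) (b s : Fin n → Bool)
    (y : Legs I O → Bool) :
    ∏ j, (A.route j).effect (slotCorrection gx j) (slotCorrection gz j) (ω j)
        (fun p => Sum.elim b s (A.group k j p)) y =
      (∏ i, conj ((separatorLabel (P.link i)).ket 0 (A.sepBit ω i) (s i))) *
      (∏ i : {i // i ∈ I}, if b i = y (.inl i) then 1 else 0) *
      (∏ a, rusEffect (A.τ a) (A.c a) (A.fusionRecord ω a)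
        fun p => if p.2 then b (A.fj a) else b (A.fi a)) *
      (∏ i : {i : Fin n // i ∉ O}, conj ((A.lam i).ket (A.α i) (A.measBit ω i) (b i ^^ gx i))) *
      readout (fun i => y (.inr i)) (fun l => b l ^^ gx l) *
      ∏ i, sgn (gz i && b i) := by
  have h1 : ∀ i : Fin n, (A.route (.inl i)).effect (slotCorrection gx (.inl i : Slot n f I O))
      (slotCorrection gz (.inl i : Slot n f I O)) (ω (.inl i))
      (fun p => Sum.elim b s (A.group k (.inl i) p)) y =
      conj ((separatorLabel (P.link i)).ket 0 (A.sepBit ω i) (s i)) := fun i =>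
    (sum_mul_pauli _ false false (s i)).trans (by simp [sepBit])
  have h2 : ∀ i : {i // i ∈ I}, (A.route (.inr (.inl i))).effect
      (slotCorrection gx (.inr (.inl i) : Slot n f I O))
      (slotCorrection gz (.inr (.inl i) : Slot n f I O)) (ω (.inr (.inl i)))
      (fun p => Sum.elim b s (A.group k (.inr (.inl i)) p)) y =
      if b i = y (.inl i) then 1 else 0 := fun i =>
    (pauli_apply false false (y (.inl i)) (b i)).trans (by simp)
  have h3 : ∀ a : Fin f, (A.route (.inr (.inr (.inl a)))).effect
      (slotCorrection gx (.inr (.inr (.inl a)) : Slot n f I O))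
      (slotCorrection gz (.inr (.inr (.inl a)) : Slot n f I O)) (ω (.inr (.inr (.inl a))))
      (fun p => Sum.elim b s (A.group k (.inr (.inr (.inl a))) p)) y =
      rusEffect (A.τ a) (A.c a) (A.fusionRecord ω a)
        fun p => if p.2 then b (A.fj a) else b (A.fi a) := fun a => by
    have hq : (fun p : Fin k × Bool => Sum.elim b s (.inl (if p.2 then A.fj a else A.fi a))) =
        fun p => if p.2 then b (A.fj a) else b (A.fi a) := funext fun p => by
      rw [Sum.elim_inl, apply_ite b]
    rw [← hq]
    rfl
  have h4 : ∀ i : {i : Fin n // i ∉ O}, (A.route (.inr (.inr (.inr (.inl i))))).effect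
      (slotCorrection gx (.inr (.inr (.inr (.inl i))) : Slot n f I O))
      (slotCorrection gz (.inr (.inr (.inr (.inl i))) : Slot n f I O))
      (ω (.inr (.inr (.inr (.inl i)))))
      (fun p => Sum.elim b s (A.group k (.inr (.inr (.inr (.inl i)))) p)) y =
      conj ((A.lam i).ket (A.α i) (A.measBit ω i) (b i ^^ gx i)) * sgn (gz i && b i) := fun i =>
    sum_mul_pauli _ (gx i) (gz i) (b i)
  have h5 : ∀ i : {i // i ∈ O}, (A.route (.inr (.inr (.inr (.inr i))))).effect
      (slotCorrection gx (.inr (.inr (.inr (.inr i))) : Slot n f I O))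
      (slotCorrection gz (.inr (.inr (.inr (.inr i))) : Slot n f I O))
      (ω (.inr (.inr (.inr (.inr i)))))
      (fun p => Sum.elim b s (A.group k (.inr (.inr (.inr (.inr i)))) p)) y =
      (if (b i ^^ gx i) = y (.inr i) then 1 else 0) * sgn (gz i && b i) := fun i =>
    pauli_apply (gx i) (gz i) (y (.inr i)) (b i)
  rw [Fintype.prod_sum_type, Fintype.prod_sum_type, Fintype.prod_sum_type, Fintype.prod_sum_type]
  simp only [h1, h2, h3, h4, h5, Finset.prod_mul_distrib]
  have hz : ∏ i, sgn (gz i && b i) = (∏ i : {i : Fin n // i ∈ O}, sgn (gz i && b i)) *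
      ∏ i : {i : Fin n // i ∉ O}, sgn (gz i && b i) := by
    convert (Fintype.prod_subtype_mul_prod_subtype (fun i => i ∈ O) fun i => sgn (gz i && b i)).symm
  rw [hz, readout]
  ring

/-- The separators turn the emitted state into the linear cluster state of the pattern, up to powers
of `Z`. -/
theorem sum_prod_separator (hlin : P.Linear) (ω : A.SlotRecord k) (b : Fin n → Bool) (a : Bool) :
    ∑ s : Fin n → Bool, (∏ i, conj ((separatorLabel (P.link i)).ket 0 (A.sepBit ω i) (s i))) *
        ∏ i, (hadamard : Matrix Bool Bool ℂ) (s i) (b i) *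
          (separatorGate (P.link i) : Matrix Bool Bool ℂ) (nextBit b a i) (s i) =
      (1 / 2) ^ n * entangleProd (fun i j => cz (b i) (b j)) P * sgn (prevBit (A.sepBit ω) n && a) *
        ∏ i, sgn (A.separatorZ ω i && b i) := by
  simp_rw [← Finset.prod_mul_distrib]
  rw [← Fintype.piFinset_univ, ← Finset.prod_univ_sum (fun _ => Finset.univ) fun i v =>
    conj ((separatorLabel (P.link i)).ket 0 (A.sepBit ω i) v) *
      ((hadamard : Matrix Bool Bool ℂ) v (b i) *
          (separatorGate (P.link i) : Matrix Bool Bool ℂ) (nextBit b a i) v)]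
  simp_rw [sum_separator]
  rw [entangleProd_eq_prod_joins hlin b a]
  simp only [Finset.prod_mul_distrib, Finset.prod_const, Finset.card_univ, Fintype.card_fin]
  rw [prod_sgn_nextBit]
  have hl : ∀ i : Fin n, cz (b i) (nextBit b a i) ^ joins P i =
      if P.link i = true then cz (b i) (nextBit b a i) else 1 := fun i => by
    rw [cz_pow]
    simp [Pattern.link]
  simp_rw [hl]
  have hs : ∏ i, sgn (A.separatorZ ω i && b i) =
      (∏ i : Fin n, sgn (prevBit (A.sepBit ω) i && b i)) *
      ∏ i, sgn ((!P.link i && A.sepBit ω i) && b i) := by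
    unfold separatorZ
    exact prod_sgn_xor _ _ _
  rw [hs]
  ring

/-- The amplitudes of the record `ω` agree with a branch of the pattern, up to a factor whose
modulus does not depend on the state of the atom. -/
theorem exists_amplitude_factor (hrun : P.Runnable) (hlin : P.Linear) (R : Decoder k f)
    (D : Fin f → (Fin k → Detection) → ℂ)
    (hR : ∀ a o, (∃ t, Heralds (o t)) → ∀ x p q, (∀ t, x (t, false) = p) → (∀ t, x (t, true) = q) →
      rusEffect (A.τ a) (A.c a) o x = D a o * fusionKraus (A.τ a) (A.c a) (R.κ a o) p q *
        sgn (R.sA a o && p) * sgn (R.sB a o && q))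
    (ω : A.SlotRecord k) (hω : ∀ a, ∃ t, Heralds (A.fusionRecord ω a t)) :
    ∃ C : Bool → ℂ, (∀ a, ‖C a‖ ^ 2 = 1 / 2 * (1 / 4) ^ n * 2 ^ (n - I.card) *
        ∏ a, ‖D a (A.fusionRecord ω a)‖ ^ 2) ∧
      ∀ (y : Legs I O → Bool) (a : Bool),
        ∑ b : Fin n → Bool, ∑ s : Fin n → Bool,
          (∏ j, (A.route j).effect (slotCorrection (A.correctionX hrun R ω) j)
            (slotCorrection (A.correctionZ hrun R ω) j) (ω j)
            (fun p => Sum.elim b s (A.group k j p)) y) *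
          (rsqrt2 * ∏ i, (hadamard : Matrix Bool Bool ℂ) (s i) (b i) *
            (separatorGate (P.link i) : Matrix Bool Bool ℂ) (nextBit b a i) (s i)) =
        C a * P.branch (A.read hrun R ω) (fun i => y (.inr i)) (fun i => y (.inl i)) := by
  set m := A.read hrun R ω with hm
  set sA : Fin f → Bool := fun a => R.sA a (A.fusionRecord ω a) with hsA
  set sB : Fin f → Bool := fun a => R.sB a (A.fusionRecord ω a) with hsB
  have hraw : P.rawOutcomes m = A.raw R ω := A.rawOutcomes_read hrun R ω
  have hm1 : ∀ i, m.1 i = A.measBit ω i := fun i => congrFun (congrArg Prod.fst hraw) i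
  have hm2 : ∀ a, (m.2 a ^^ fusionShift m P (fun _ => false) a) = R.κ a (A.fusionRecord ω a) :=
    fun a => congrFun (congrArg Prod.snd hraw) a
  obtain ⟨u, hu, hpath⟩ := pathWeight_eq_postponed m sA sB hrun.exec (fun _ => false)
    (fusionShift m P fun _ => false) fun _ _ => rfl
  have hu0 : u ≠ 0 := by
    rintro rfl
    simp at hu
  have hr0 : rsqrt2 ≠ 0 := by
    intro h
    have := rsqrt2_mul_self
    rw [h] at this
    norm_num at this
  refine ⟨fun a => rsqrt2 * (1 / 2) ^ n * sgn (prevBit (A.sepBit ω) n && a) *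
    (∏ a, D a (A.fusionRecord ω a)) / (u * rsqrt2 ^ (n - I.card)), fun a => ?_, fun y a => ?_⟩
  · rw [norm_div, norm_mul, norm_mul, norm_mul, norm_mul, norm_sgn, hu, norm_pow, norm_pow,
      norm_prod, div_pow, mul_pow, mul_pow, mul_pow, mul_pow, ← Finset.prod_pow, norm_rsqrt2_sq,
      ← pow_mul, ← pow_mul, mul_comm n, mul_comm (n - _), pow_mul, pow_mul, norm_rsqrt2_sq]
    simp only [norm_div, norm_one, Complex.norm_ofNat]
    rw [one_div_pow (2 : ℝ) (n - I.card)]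
    field_simp
    norm_num
    ring_nf
  · rw [branch_eq_sum_pathWeight hrun, Finset.mul_sum]
    refine Finset.sum_congr rfl fun b _ => ?_
    have hfus : ∀ a, rusEffect (A.τ a) (A.c a) (A.fusionRecord ω a)
        (fun p => if p.2 then b (A.fj a) else b (A.fi a)) =
        D a (A.fusionRecord ω a) * (fusionKraus (A.τ a) (A.c a)
          (m.2 a ^^ fusionShift m P (fun _ => false) a) (b (A.fi a)) (b (A.fj a)) *
          sgn (sA a && b (A.fi a)) * sgn (sB a && b (A.fj a))) := fun a => by
      rw [hR a _ (hω a) _ (b (A.fi a)) (b (A.fj a)) (fun _ => by simp) (fun _ => by simp), hm2]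
      ring
    -- The corrections cancel the byproducts of the separators and apply the frame.
    have hz : ∏ i, sgn (A.correctionZ hrun R ω i && b i) =
        (∏ i, sgn (A.separatorZ ω i && b i)) *
          ∏ i, sgn (frameZ m sA sB P (fun _ => false) i && b i) := prod_sgn_xor _ _ _
    have hsq : (∏ i, sgn (A.separatorZ ω i && b i)) * ∏ i, sgn (A.separatorZ ω i && b i) = 1 := by
      rw [← Finset.prod_mul_distrib]
      exact Finset.prod_eq_one fun i _ => sgn_mul_self _
    have hleg : ∀ w : ℂ, (if ∀ i : {i // i ∈ I}, b i = y (.inl i) then w else 0) =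
        (∏ i : {i // i ∈ I}, if b i = y (.inl i) then 1 else 0) * w := fun w => by
      rw [Finset.prod_ite_zero]
      simp
    have hp := hpath (fun i => y (.inr i)) b
    simp only [Bool.xor_false] at hp
    rw [hleg, hp, hrun.prod_postponedWeight A.fuse_mem A.measure_mem]
    simp_rw [prod_effect, hfus, hz]
    rw [Finset.prod_mul_distrib]
    simp_rw [hm1]
    have hsum := A.sum_prod_separator hlin ω b a
    change _ = _ * (_ * (u * _ * _ * readout _ fun l => b l ^^ A.correctionX hrun R ω l))
    have hx : ∀ i, A.correctionX hrun R ω i = frameX m P (fun _ => false) i := fun _ => rfl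
    simp_rw [← hx]
    generalize (∏ i : {i // i ∈ I}, if b i = y (.inl i) then (1 : ℂ) else 0) = v1
    generalize (∏ a, D a (A.fusionRecord ω a)) = v2
    generalize (∏ i : Fin f, fusionKraus (A.τ i) (A.c i)
      (m.2 i ^^ fusionShift m P (fun _ => false) i) (b (A.fi i)) (b (A.fj i)) *
      sgn (sA i && b (A.fi i)) * sgn (sB i && b (A.fj i))) = v3
    generalize (∏ i : {i : Fin n // i ∉ O}, conj ((A.lam i).ket (A.α i) (A.measBit ω i)
      (b i ^^ A.correctionX hrun R ω i))) = v4
    generalize (readout (fun i => y (.inr i)) fun l => b l ^^ A.correctionX hrun R ω l) = v5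
    generalize (∏ i, sgn (frameZ m sA sB P (fun _ => false) i && b i)) = v6
    generalize (∏ i, sgn (A.separatorZ ω i && b i)) = v7 at *
    have e1 : ∀ p q : ℂ, p * v1 * (v2 * v3) * v4 * v5 * (v7 * v6) * (rsqrt2 * q) =
      p * q * (v1 * (v2 * v3) * v4 * v5 * (v7 * v6) * rsqrt2) := fun p q => by ring
    simp_rw [e1]
    rw [← Finset.sum_mul, hsum]
    field_simp
    linear_combination (entangleProd (fun i j => cz (b i) (b j)) P * v1 * v2 * v3 * v4 * v5 * v6 *
      sgn (prevBit (A.sepBit ω) n && a)) * hsq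

end Layout

end Amplitude

section Output

variable {n f : ℕ} {I O : Finset (Fin n)}

/-! ### The output state and the probability of success -/

namespace Layout

variable {P : Pattern n f I O} (A : Layout P) {k : ℕ}

open Classical in
/-- The total weight of the successful records with given raw outcomes: the separators contribute a
factor `2` each, and the fusions are independent. -/
theorem sum_record_weight (R : Decoder k f) (D : Fin f → (Fin k → Detection) → ℂ)
    (hD : ∀ a κ₀, ∑ o, (if (∃ t, Heralds (o t)) ∧ R.κ a o = κ₀ then ‖D a o‖ ^ 2 else 0) =
      1 - 1 / 2 ^ k) (v : Outcomes n f O) :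
    ∑ ω : A.SlotRecord k, (if (∀ a, ∃ t, Heralds (A.fusionRecord ω a t)) ∧ A.raw R ω = v then
      ∏ a, ‖D a (A.fusionRecord ω a)‖ ^ 2 else 0) = 2 ^ n * (1 - 1 / 2 ^ k) ^ f := by
  let h : (j : Slot n f I O) → (A.route j).Record k → ℝ := fun j => match j with
    | .inl _ => fun _ => 1
    | .inr (.inl _) => fun _ => 1
    | .inr (.inr (.inl a)) => fun (o : Fin k → Detection) =>
        if (∃ t, Heralds (o t)) ∧ R.κ a o = v.2 a then ‖D a o‖ ^ 2 else 0
    | .inr (.inr (.inr (.inl i))) => fun (o : Bool) => if o = v.1 i then 1 else 0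
    | .inr (.inr (.inr (.inr _))) => fun _ => 1
  have hprod : ∀ ω : A.SlotRecord k,
      (if (∀ a, ∃ t, Heralds (A.fusionRecord ω a t)) ∧ A.raw R ω = v then
        ∏ a, ‖D a (A.fusionRecord ω a)‖ ^ 2 else 0) = ∏ j, h j (ω j) := by
    intro ω
    rw [Fintype.prod_sum_type, Fintype.prod_sum_type, Fintype.prod_sum_type, Fintype.prod_sum_type]
    change _ = (∏ _ : Fin n, (1 : ℝ)) * ((∏ _ : {i // i ∈ I}, (1 : ℝ)) *
      ((∏ a : Fin f, if (∃ t, Heralds (A.fusionRecord ω a t)) ∧ R.κ a (A.fusionRecord ω a) = v.2 a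
        then ‖D a (A.fusionRecord ω a)‖ ^ 2 else 0) *
      ((∏ i : {i : Fin n // i ∉ O}, if A.measBit ω i = v.1 i then 1 else 0) *
        ∏ _ : {i // i ∈ O}, (1 : ℝ))))
    rw [Finset.prod_ite_zero, Finset.prod_ite_zero]
    have hraw : A.raw R ω = v ↔ (∀ i, A.measBit ω i = v.1 i) ∧
        ∀ a, R.κ a (A.fusionRecord ω a) = v.2 a := by
      rw [raw, Prod.ext_iff, funext_iff, funext_iff]
    simp only [Finset.prod_const_one, one_mul, mul_one, Finset.mem_univ, true_implies, hraw,
      forall_and]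
    split_ifs <;> simp_all
  have hinl : ∀ i : Fin n, ∑ o, h (.inl i) o = 2 := fun i => by
    change ∑ _ : Bool, (1 : ℝ) = 2
    simp
  have hleg : ∀ i : {i // i ∈ I}, ∑ o, h (.inr (.inl i)) o = 1 := fun i => by
    change ∑ _ : Unit, (1 : ℝ) = 1
    simp
  have hfus : ∀ a : Fin f, ∑ o, h (.inr (.inr (.inl a))) o = 1 - 1 / 2 ^ k := fun a => hD a (v.2 a)
  have hmeas : ∀ i : {i : Fin n // i ∉ O}, ∑ o, h (.inr (.inr (.inr (.inl i)))) o = 1 := fun i => by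
    change ∑ o : Bool, (if o = v.1 i then (1 : ℝ) else 0) = 1
    simp
  have hout : ∀ i : {i // i ∈ O}, ∑ o, h (.inr (.inr (.inr (.inr i)))) o = 1 := fun i => by
    change ∑ _ : Unit, (1 : ℝ) = 1
    simp
  simp_rw [hprod]
  have hsum : ∑ ω : A.SlotRecord k, ∏ j, h j (ω j) = ∏ j, ∑ o, h j o := by
    rw [Finset.prod_univ_sum, Fintype.piFinset_univ]
  rw [hsum, Fintype.prod_sum_type, Fintype.prod_sum_type, Fintype.prod_sum_type,
    Fintype.prod_sum_type]
  simp only [hinl, hleg, hfus, hmeas, hout]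
  simp

variable (hrun : P.Runnable) (R : Decoder k f)

/-- The amplitudes of the protocol as a sum over the bits of the qubits and of the separators. -/
theorem amplitude_protocol {N M : ℕ} (e : Fin N ≃ Slot n f I O) (he : Monotone (time P ∘ e))
    (σ : Fin M ≃ A.Photon k e) (u : ℕ → Matrix.unitaryGroup Bool ℂ)
    {V : Fin n → Matrix.unitaryGroup Bool ℂ}
    (hu : ∀ (F : (A.Photon k e → Bool) → ℂ) (a : Bool),
      ∑ x : Fin M → Bool, F (fun φ => x (σ.symm φ)) * emitterState u M x a =
        ∑ b : Fin n → Bool, ∑ s : Fin n → Bool, F (fun φ => Sum.elim b s (A.photonGroup e φ)) *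
          (rsqrt2 * ∏ i, (hadamard : Matrix Bool Bool ℂ) (s i) (b i) *
            (V i : Matrix Bool Bool ℂ) (nextBit b a i) (s i)))
    (ω : (r : Fin N) → (A.route (e r)).Record k) (y : Legs I O → Bool) (a : Bool) :
    (A.protocol hrun R e σ u).amplitude ω y a =
      ∑ b : Fin n → Bool, ∑ s : Fin n → Bool,
        (∏ j, (A.route j).effect (slotCorrection (A.correctionX hrun R (A.slotRecord e ω)) j)
          (slotCorrection (A.correctionZ hrun R (A.slotRecord e ω)) j) (A.slotRecord e ω j)
          (fun p => Sum.elim b s (A.group k j p)) y) *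
        (rsqrt2 * ∏ i, (hadamard : Matrix Bool Bool ℂ) (s i) (b i) *
          (V i : Matrix Bool Bool ℂ) (nextBit b a i) (s i)) := by
  have := hu (fun q => ∏ r, (A.route (e r)).effect
    (slotCorrection (A.correctionX hrun R (A.slotRecord e (A.fill e r fun s _ => ω s))) (e r))
    (slotCorrection (A.correctionZ hrun R (A.slotRecord e (A.fill e r fun s _ => ω s))) (e r))
    (ω r) (fun p => q ⟨r, p⟩) y) a
  refine Eq.trans this (Finset.sum_congr rfl fun b _ => Finset.sum_congr rfl fun s _ => ?_)
  congr 1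
  rw [← Equiv.prod_comp e]
  refine Finset.prod_congr rfl fun r _ => ?_
  rw [(A.correction_fill hrun R e he ω r).1, (A.correction_fill hrun R e he ω r).2,
    slotRecord_apply]
  rfl

/-- The protocol succeeds if and only if every fusion has been heralded. -/
theorem success_protocol_iff {N M : ℕ} (e : Fin N ≃ Slot n f I O) (σ : Fin M ≃ A.Photon k e)
    (u : ℕ → Matrix.unitaryGroup Bool ℂ) (ω : (r : Fin N) → (A.route (e r)).Record k) :
    (A.protocol hrun R e σ u).Success ω ↔
      ∀ a, ∃ t, Heralds (A.fusionRecord (A.slotRecord e ω) a t) := by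
  have h1 : (A.protocol hrun R e σ u).Success ω ↔
      ∀ r, (A.route (e r)).Succeeds (A.slotRecord e ω (e r)) := by
    simp only [slotRecord_apply]
    rfl
  rw [h1, e.forall_congr_right (q := fun j => (A.route j).Succeeds (A.slotRecord e ω j))]
  refine ⟨fun h a => h (.inr (.inr (.inl a))), fun h j => ?_⟩
  rcases j with i | i | a | i | i
  · trivial
  · trivial
  · exact h a
  · trivial
  · trivial

/-- If the emitter and the fusions behave as required, every branch of the pattern is realised with
the same weight. -/
theorem outputState_protocol (hlin : P.Linear) (D : Fin f → (Fin k → Detection) → ℂ)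
    (hR : ∀ a o, (∃ t, Heralds (o t)) → ∀ x p q, (∀ t, x (t, false) = p) → (∀ t, x (t, true) = q) →
      rusEffect (A.τ a) (A.c a) o x = D a o * fusionKraus (A.τ a) (A.c a) (R.κ a o) p q *
        sgn (R.sA a o && p) * sgn (R.sB a o && q))
    (hD : ∀ v : Outcomes n f O, (open Classical in
      ∑ ω : A.SlotRecord k, (if (∀ a, ∃ t, Heralds (A.fusionRecord ω a t)) ∧ A.raw R ω = v then
        ∏ a, ‖D a (A.fusionRecord ω a)‖ ^ 2 else 0)) = 2 ^ n * (1 - 1 / 2 ^ k) ^ f)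
    {N M : ℕ} (e : Fin N ≃ Slot n f I O) (he : Monotone (time P ∘ e))
    (σ : Fin M ≃ A.Photon k e) (u : ℕ → Matrix.unitaryGroup Bool ℂ)
    (hu : ∀ (F : (A.Photon k e → Bool) → ℂ) (a : Bool),
      ∑ x : Fin M → Bool, F (fun φ => x (σ.symm φ)) * emitterState u M x a =
        ∑ b : Fin n → Bool, ∑ s : Fin n → Bool, F (fun φ => Sum.elim b s (A.photonGroup e φ)) *
          (rsqrt2 * ∏ i, (hadamard : Matrix Bool Bool ℂ) (s i) (b i) *
            (separatorGate (P.link i) : Matrix Bool Bool ℂ) (nextBit b a i) (s i)))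
    (m : Outcomes n f O) (y y' : Legs I O → Bool) :
    (A.protocol hrun R e σ u).outputState
        (fun ω => (A.protocol hrun R e σ u).Success ω ∧
          A.read hrun R (A.slotRecord e ω) = m) y y' =
      (((1 - 1 / 2 ^ k) ^ f / 2 ^ I.card : ℝ) : ℂ) *
        (P.branch m (fun i => y (.inr i)) (fun i => y (.inl i)) *
          conj (P.branch m (fun i => y' (.inr i)) (fun i => y' (.inl i)))) := by
  classical
  let B : (Legs I O → Bool) → ℂ := fun y => P.branch m (fun i => y (.inr i)) fun i => y (.inl i)
  let w : A.SlotRecord k → ℝ := fun ω =>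
    if (∀ a, ∃ t, Heralds (A.fusionRecord ω a t)) ∧ A.raw R ω = P.rawOutcomes m then
      ∏ a, ‖D a (A.fusionRecord ω a)‖ ^ 2 else 0
  have hterm : ∀ (ω : (r : Fin N) → (A.route (e r)).Record k)
      [Decidable ((A.protocol hrun R e σ u).Success ω ∧
        A.read hrun R (A.slotRecord e ω) = m)],
      (if (A.protocol hrun R e σ u).Success ω ∧ A.read hrun R (A.slotRecord e ω) = m then
        ∑ a, (A.protocol hrun R e σ u).amplitude ω y a *
          conj ((A.protocol hrun R e σ u).amplitude ω y' a) else 0) =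
      (((1 / 4) ^ n * 2 ^ (n - I.card) * w (A.slotRecord e ω) : ℝ) : ℂ) * (B y * conj (B y')) := by
    intro ω _
    have hiff : ((A.protocol hrun R e σ u).Success ω ∧ A.read hrun R (A.slotRecord e ω) = m) ↔
        (∀ a, ∃ t, Heralds (A.fusionRecord (A.slotRecord e ω) a t)) ∧
          A.raw R (A.slotRecord e ω) = P.rawOutcomes m :=
      and_congr (A.success_protocol_iff hrun R e σ u ω) (A.read_eq_iff hrun R _ m)
    by_cases h : (∀ a, ∃ t, Heralds (A.fusionRecord (A.slotRecord e ω) a t)) ∧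
          A.raw R (A.slotRecord e ω) = P.rawOutcomes m
    · obtain ⟨C, hC, hamp⟩ := A.exists_amplitude_factor hrun hlin R D hR (A.slotRecord e ω) h.1
      rw [(A.read_eq_iff hrun R _ m).2 h.2] at hamp
      have hamp' : ∀ y a, (A.protocol hrun R e σ u).amplitude ω y a = C a * B y := fun y a =>
        (A.amplitude_protocol hrun R e he σ u hu ω y a).trans (hamp y a)
      have hmul : ∀ a, C a * B y * conj (C a * B y') =
          ((‖C a‖ ^ 2 : ℝ) : ℂ) * (B y * conj (B y')) := fun a => by
          rw [← Complex.normSq_eq_norm_sq, ← Complex.mul_conj, map_mul]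
          ring
      rw [if_pos (hiff.2 h)]
      -- Both states of the atom contribute the same weight.
      simp only [w, if_pos h, hamp', hmul, hC, Fintype.sum_bool]
      push_cast
      ring
    · rw [if_neg (mt hiff.1 h)]
      simp only [w, if_neg h]
      simp
  have hsum : ∑ ω, w (A.slotRecord e ω) = 2 ^ n * (1 - 1 / 2 ^ k) ^ f := by
    rw [(A.slotRecord e).sum_comp w, ← hD (P.rawOutcomes m)]
  have hI : I.card ≤ n := (Finset.card_le_univ I).trans (Fintype.card_fin n).le
  refine Eq.trans (Finset.sum_congr rfl fun ω _ => @hterm ω (Classical.propDecidable _)) ?_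
  calc ∑ ω : (r : Fin N) → (A.route (e r)).Record k,
        (((1 / 4) ^ n * 2 ^ (n - I.card) * w (A.slotRecord e ω) : ℝ) : ℂ) * (B y * conj (B y'))
    _ = (((1 / 4) ^ n * 2 ^ (n - I.card) * (2 ^ n * (1 - 1 / 2 ^ k) ^ f) : ℝ) : ℂ) *
        (B y * conj (B y')) := by
      rw [← Finset.sum_mul, ← Complex.ofReal_sum, ← Finset.mul_sum, hsum]
    _ = _ := by
      congr 2
      have h2 : (2 : ℝ) ^ n = 2 ^ (n - I.card) * 2 ^ I.card := by
        rw [← pow_add, Nat.sub_add_cancel hI]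
      have h4 : (1 / 4 : ℝ) ^ n * 2 ^ n * 2 ^ n = 1 := by
        rw [← mul_pow, ← mul_pow]
        norm_num
      rw [eq_div_iff (by positivity)]
      linear_combination (1 - 1 / 2 ^ k) ^ f * h4 - (1 / 4) ^ n * 2 ^ n * (1 - 1 / 2 ^ k) ^ f * h2

end Layout

open Classical in
/-- If every branch of a pattern is realised with weight `p / 2^|I|`, then `p` is the probability of
success, since the branches form an instrument. -/
theorem successProb_eq {k : ℕ} {P : Pattern n f I O} (hrun : P.Runnable)
    (S : Protocol k (Legs I O)) (read : S.Record → Outcomes n f O) (p : ℝ)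
    (h : ∀ m y y', S.outputState (fun ω => S.Success ω ∧ read ω = m) y y' =
      ((p / 2 ^ I.card : ℝ) : ℂ) * (P.branch m (fun i => y (.inr i)) (fun i => y (.inl i)) *
        conj (P.branch m (fun i => y' (.inr i)) (fun i => y' (.inl i))))) :
    S.successProb = p := by
  have h1 : ∀ y, S.outputState S.Success y y = ((p / 2 ^ I.card *
      ∑ m, ‖P.branch m (fun i => y (.inr i)) (fun i => y (.inl i))‖ ^ 2 : ℝ) : ℂ) := by
    intro y
    have : S.outputState S.Success y y =
        ∑ m, S.outputState (fun ω => S.Success ω ∧ read ω = m) y y := by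
      unfold Protocol.outputState
      rw [Finset.sum_comm]
      refine Finset.sum_congr rfl fun ω _ => ?_
      by_cases hs : S.Success ω <;> simp [hs]
    simp_rw [this, h, Complex.mul_conj, Complex.normSq_eq_norm_sq]
    push_cast
    rw [Finset.mul_sum]
  have h2 : ∑ y : Legs I O → Bool, ∑ m,
      ‖P.branch m (fun i => y (.inr i)) (fun i => y (.inl i))‖ ^ 2 = 2 ^ I.card := by
    rw [← (Equiv.sumArrowEquivProdArrow {i // i ∈ I} {i // i ∈ O} Bool).symm.sum_comp,
      Fintype.sum_prod_type]
    have h3 : ∀ x : {i // i ∈ I} → Bool, ∑ z : {i // i ∈ O} → Bool, ∑ m,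
        ‖P.branch m z x‖ ^ 2 = 1 := fun x => by
      rw [Finset.sum_comm]
      exact hrun.sum_norm_sq_branch x
    exact (Finset.sum_congr rfl fun x _ => h3 x).trans (by simp)
  unfold Protocol.successProb Matrix.trace
  simp only [Matrix.diag_apply, h1]
  rw [← Complex.ofReal_sum, Complex.ofReal_re, ← Finset.mul_sum, h2]
  field_simp

/-- Settings of the protocol that realise a linear pattern, for an odd number of rounds. -/
theorem Pattern.Runnable.exists_protocol {P : Pattern n f I O} (hrun : P.Runnable)
    (hlin : P.Linear) {k : ℕ} (hk : Odd k) : ∃ S : Protocol k (Legs I O),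
      S.fusions = f ∧ S.successProb = (1 - 1 / 2 ^ k : ℝ) ^ f ∧ S.Implements P := by
  classical
  obtain ⟨A⟩ := hrun.exists_layout
  choose κ sA sB D hD hR using fun a => rusEffect_eq (A.τ a) (A.c a) hk
  let R : Layout.Decoder k f := ⟨κ, sA, sB⟩
  obtain ⟨e, he⟩ := exists_sorted_equiv (Layout.time P)
  obtain ⟨u, σ, hu⟩ := exists_emitter (A.photonGroup (k := k) e) (A.photonGroup_surjective e)
    fun i => separatorGate (P.link i)
  have hout := A.outputState_protocol hrun R hlin D hR
    (A.sum_record_weight R D hD) e he σ u hu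
  have hp := successProb_eq hrun (A.protocol hrun R e σ u)
    (fun ω => A.read hrun R (A.slotRecord e ω)) _ hout
  refine ⟨A.protocol hrun R e σ u, A.fusions_protocol hrun R e σ u, ?_, ?_⟩
  · convert hp
  · refine ⟨fun ω => A.read hrun R (A.slotRecord e ω), fun m y y' => (hout m y y').trans ?_⟩
    have hp' : (A.protocol hrun R e σ u).successProb = (1 - 1 / 2 ^ k : ℝ) ^ f := by convert hp
    rw [hp']
    push_cast
    ring

theorem exists_odd_lt_success_pow (f : ℕ) {ε : ℝ} (hε : 0 < ε) :
    ∃ k : ℕ, Odd k ∧ 1 - ε < (1 - 1 / 2 ^ k : ℝ) ^ f := by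
  have h : Filter.Tendsto (fun k : ℕ => (1 - (1 / 2 : ℝ) ^ k) ^ f) Filter.atTop (nhds 1) := by
    have := ((tendsto_pow_atTop_nhds_zero_of_lt_one (r := (1 / 2 : ℝ)) (by norm_num)
      (by norm_num)).const_sub 1).pow f
    simpa using this
  obtain ⟨j, hj⟩ := Filter.eventually_atTop.1 (h.eventually (lt_mem_nhds (by linarith : 1 - ε < 1)))
  refine ⟨2 * j + 1, odd_two_mul_add_one j, ?_⟩
  rw [← one_div_pow]
  exact hj _ (by omega)

end Output

end FBQC

end

theorem mainTheorem11 {n f : ℕ} (I O : Finset (Fin n)) (P : FBQC.Pattern n f I O)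
    (hrun : P.Runnable) (hlin : P.Linear) :
    (∀ k : ℕ, Odd k → ∃ S : FBQC.Protocol k (FBQC.Legs I O),
      S.fusions = f ∧ S.successProb = (1 - 1 / 2 ^ k : ℝ) ^ f ∧ S.Implements P) ∧
    ∀ ε : ℝ, 0 < ε → ∃ k : ℕ, Odd k ∧ 1 - ε < (1 - 1 / 2 ^ k : ℝ) ^ f := by
  refine ⟨fun k hk => hrun.exists_protocol hlin hk, fun ε hε => FBQC.exists_odd_lt_success_pow f hε⟩
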